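/- **The game.** Let $T\ge 2$. Means $q_1,\dots,q_T\in[0,1]$ are fixed in advance. In round $t$ a forecaster that has seen the past draws a prediction $p_t\in[0,1]$; independently, given the past, $y_t\sim\mathrm{Ber}(q_t)$ is drawn and then revealed. Put $n(p)=|\{t:p_t=p\}|$ and $$\mathrm{Cal}_1=\sum_{p:\,n(p)>0} n(p)\,\Bigl|\tfrac1{n(p)}\sum_{t:p_t=p}(y_t-p)\Bigr|,\qquad C=\min_{x\in[0,1]}\sum_{t=1}^T|q_t-x| .$$ **The epoch framework** (inputs $T$, $C$ and a number $\iota>0$). Epoch $m=1,2,\dots$ lasts $s_m=2^m$ rounds (the last one may be cut off). In epoch 1 the predictions are arbitrary fixed numbers in $[0,1]$. For $m\ge2$ let $\hat y_m$ be the average outcome in epoch $m-1$, $$r_m=\sqrt{\iota/s_{m-1}}+C/s_{m-1},\qquad I_m=[a_m,b_m]=[\hat y_m-2r_m,\hat y_m+2r_m]\cap[0,1],$$ $$N_m=\Bigl\lceil s_m^{1/3}(b_m-a_m)^{2/3}\iota^{-1/3}\Bigr\rceil,\qquad K=\Bigl\lceil\Bigl(\frac{(1+C)^2}{\iota T}\Bigr)^{1/3}\Bigr\rceil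 .$$ The partition $\Pi_m$ of $[0,1]$ consists of $N_m$ equal pieces of $I_m$ and of $K$ equal pieces of each nonempty band $$[a_m-(2^{q+1}-1)r_m,\;a_m-(2^q-1)r_m)\cap[0,1],\qquad (b_m+(2^q-1)r_m,\;b_m+(2^{q+1}-1)r_m]\cap[0,1],\qquad 0\le q\le\lceil\log_2T\rceil .$$ In epoch $m$ the following base algorithm (of Hu et al.) is run from scratch on $\Pi_m$ with horizon $H=s_m$. **The base algorithm.** There are $d=2|\Pi_m|$ experts $(J,\sigma)$, $J\in\Pi_m$, $\sigma=\pm1$, with weights $w_{J,\sigma}$, initially $1/d$. In a round let $\Phi(p)=\sum_{(J,\sigma)}w_{J,\sigma}\,\sigma\,\mathbf 1[p\in J]$. If $\Phi(0)>0$ let $P$ be the point mass at $0$; else if $\Phi(1)\le0$ the point mass at $1$; else choose $i\in\{0,\dots,H-1\}$ with $\Phi(\tfrac iH)\Phi(\tfrac{i+1}H)\le0$ and let $P$ put masses proportional to $|\Phi(\tfrac{i+1}H)|$ and $|\Phi(\tfrac iH)|$ on $\tfrac iH$ and $\tfrac{i+1}H$ (all mass on $\tfrac iH$ if both are $0$).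 Draw $\tilde p\sim P$ and predict $\sup J$ for the $J\in\Pi_m$ that contains $\tilde p$. After seeing $y$, each expert receives the gain $g_{J,\sigma}=\mathbb E_{u\sim P}[\sigma\mathbf 1[u\in J](u-y)]$, and the weights are updated by MsMwC (Chen, Luo, Wei) with loss $-g$ and zero optimism: with $V_e$ the sum of the squared earlier gains of expert $e$ in the epoch and $\eta_e=\min\{\tfrac1{64},\sqrt{\ln(dH)/V_e}\}$ ($=\tfrac1{64}$ if $V_e=0$), the new weight vector is the minimizer over $\{v:\sum_e v_e=1,\ v_e\ge\tfrac1{dH}\}$ of $$\sum_e v_e\bigl(-g_e+32\eta_e g_e^2\bigr)+\sum_e\frac1{\eta_e}\Bigl(v_e\ln\frac{v_e}{w_e}-v_e+w_e\Bigr).$$ **Implementation.** The minimizer is $v_e(\lambda)=\max\{\tfrac1{dH},\,w_e\exp(\eta_e(\lambda+g_e-32\eta_eg_e^2))\}$ for a multiplier $\lambda$. The *bisection implementation* replaces the exact step by $4m+16$ bisection steps for the equation $\sum_ev_e(\lambda)=1$ on $[-2,2]$, and finds $i$ by binary search. Its cost in a round is the number of elementary operations it executes on a real-arithmetic machine, where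 arithmetic, comparison, rounding up, $\sqrt{\cdot}$, $\exp$, $\log$, powers, one list or record step, and one random draw cost $1$ each; building the next partition counts towards the last round of an epoch. **Theorem.** There are absolute constants $c,A,B>0$ and $k\in\mathbb N$ such that for all $T\ge2$, $\delta\in(0,1)$, $q_1,\dots,q_T\in[0,1]$, all $\iota\ge c\ln(T/\delta)$ (in particular some $\iota=\Theta(\log(T/\delta))$) and all first-epoch predictions in $[0,1]$: 1. The framework with the base algorithm above, exact minimizers and any admissible choice of the indices $i$, satisfies, with probability at least $1-\delta$, $$\mathrm{Cal}_1\le A\bigl(\iota\ln T+\sqrt{\iota T}+(\iota TC)^{1/3}\bigr).$$ 2. The bisection implementation satisfies the same bound with probability at least $1-\delta$, and its cost in every round, on every transcript of positive probability, is at most $B\,(1+C)^{1/3}(\ln T)^k$, i.e. $\tilde O((1+C)^{1/3})$. -/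

import Mathlib

/-! Adaptive online calibration: the game, the calibration error, a step-counting
real-arithmetic machine, and the epoch framework with non-uniform partitions. -/

noncomputable section

namespace Calib

/-! ## Step counting

A computation over exact reals together with the number of elementary operations it executes.
`pure` only renames a value that is already there and is free; every operation below costs one.
All programs are written with these operations only, so that real numbers, natural numbers and
lists are never manipulated without being charged. -/

structure Timed (α : Type) where
  val : α
  cost : ℕ

instance : Monad Timed where
  pure a := ⟨a, 0⟩
  bind x f := ⟨(f x.val).val, x.cost + (f x.val).cost⟩

/-- One unit of bookkeeping (building or inspecting a list cell or record). -/
def tick {α : Type} (a : α) : Timed α := ⟨a, 1⟩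

def addR (x y : ℝ) : Timed ℝ := ⟨x + y, 1⟩
def subR (x y : ℝ) : Timed ℝ := ⟨x - y, 1⟩
def mulR (x y : ℝ) : Timed ℝ := ⟨x * y, 1⟩
def divR (x y : ℝ) : Timed ℝ := ⟨x / y, 1⟩
def maxR (x y : ℝ) : Timed ℝ := ⟨max x y, 1⟩
def minR (x y : ℝ) : Timed ℝ := ⟨min x y, 1⟩
def absR (x : ℝ) : Timed ℝ := ⟨|x|, 1⟩
def sqrtR (x : ℝ) : Timed ℝ := ⟨Real.sqrt x, 1⟩
def expR (x : ℝ) : Timed ℝ := ⟨Real.exp x, 1⟩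
def logR (x : ℝ) : Timed ℝ := ⟨Real.log x, 1⟩
def powR (x y : ℝ) : Timed ℝ := ⟨x ^ y, 1⟩
def ltR (x y : ℝ) : Timed Bool := ⟨decide (x < y), 1⟩
def leR (x y : ℝ) : Timed Bool := ⟨decide (x ≤ y), 1⟩
def ceilR (x : ℝ) : Timed ℕ := ⟨⌈x⌉₊, 1⟩
def castN (n : ℕ) : Timed ℝ := ⟨(n : ℝ), 1⟩
def addN (m n : ℕ) : Timed ℕ := ⟨m + n, 1⟩
def mulN (m n : ℕ) : Timed ℕ := ⟨m * n, 1⟩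
def halfN (n : ℕ) : Timed ℕ := ⟨n / 2, 1⟩
def eqN (m n : ℕ) : Timed Bool := ⟨decide (m = n), 1⟩
def leN (m n : ℕ) : Timed Bool := ⟨decide (m ≤ n), 1⟩

/-- Apply a program to every entry of a list. -/
def forEach {α β : Type} (f : α → Timed β) : List α → Timed (List β)
  | [] => tick []
  | a :: l => do
    let b ← f a
    let bs ← forEach f l
    tick (b :: bs)

/-- Run through a list with an accumulator. -/
def loop {α β : Type} (f : β → α → Timed β) (b : β) : List α → Timed β
  | [] => tick b
  | a :: l => do
    let b' ← f b a
    loop f (← tick b') l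

/-- Concatenate two lists by walking through the first one. -/
def append {α : Type} : List α → List α → Timed (List α)
  | [], l => tick l
  | a :: k, l => do
    let r ← append k l
    tick (a :: r)

/-! ## Intervals and partitions -/

/-- An interval with end points `lo`, `hi`; the flags tell which end points belong to it. -/
structure Cell where
  lo : ℝ
  hi : ℝ
  loIn : Bool
  hiIn : Bool

/-- Membership of `p` in the interval. -/
def Cell.mem (c : Cell) (p : ℝ) : Timed Bool := do
  let x ← if c.loIn then leR c.lo p else ltR c.lo p
  let y ← if c.hiIn then leR p c.hi else ltR p c.hi
  tick (x && y)

/-- The first `n` of the `N` equal-length pieces of the interval `c`: piece number `k < N` runs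
from `lo + (k / N) (hi - lo)` to `lo + ((k + 1) / N) (hi - lo)`, contains its left end point and
not its right one, except that the two outer end points are inherited from `c`. -/
def pieces (c : Cell) (N : ℕ) : ℕ → Timed (List Cell)
  | 0 => tick []
  | k + 1 => do
    let len ← subR c.hi c.lo
    let l ← addR c.lo (← mulR (← divR (← castN k) (← castN N)) len)
    let k' ← addN k 1
    let u ← addR c.lo (← mulR (← divR (← castN k') (← castN N)) len)
    let isFirst ← eqN k 0
    let isLast ← eqN k' N
    let rest ← pieces c N k
    tick (⟨l, u, if isFirst then c.loIn else true, if isLast then c.hiIn else false⟩ :: rest)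

/-- Uniform partition of an interval into `N` pieces of equal length. -/
def unifPart (c : Cell) (N : ℕ) : Timed (List Cell) := pieces c N N

/-- Uniform partition of an outer band; an empty band contributes nothing. -/
def band (c : Cell) (K : ℕ) : Timed (List Cell) := do
  if ← ltR c.lo c.hi then unifPart c K else tick []

/-- The partitioned outer bands, for `n` consecutive values of `q`; `pw` is `2 ^ q` for the first
of them. The left band is `[a - (2^(q+1) - 1) r, a - (2^q - 1) r) ∩ [0, 1]`, the right one
`(b + (2^q - 1) r, b + (2^(q+1) - 1) r] ∩ [0, 1]`. -/
def bands (K : ℕ) (a b r : ℝ) : ℕ → ℝ → Timed (List Cell)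
  | 0, _ => tick []
  | n + 1, pw => do
    let pw' ← mulR 2 pw
    let near ← mulR (← subR pw 1) r
    let far ← mulR (← subR pw' 1) r
    let left ← band ⟨← maxR 0 (← subR a far), ← subR a near, true, false⟩ K
    let right ← band ⟨← addR b near, ← minR 1 (← addR b far), false, true⟩ K
    let rest ← bands K a b r n pw'
    append left (← append right rest)

/-- What the forecaster is given: the number `T` of rounds, the confidence factor `iota`, the
non-stationarity `C`, and the predictions used in the first epoch. -/
structure Params where
  T : ℕ
  iota : ℝ
  C : ℝ
  init : ℕ → ℝ

/-- The partition for an epoch of length `s`, where the previous epoch had length `sPrev` and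
average outcome `y`. -/
def partition (P : Params) (sPrev s y : ℝ) : Timed (List Cell) := do
  let r ← addR (← sqrtR (← divR P.iota sPrev)) (← divR P.C sPrev)
  let twoR ← mulR 2 r
  let a ← maxR 0 (← subR y twoR)
  let b ← minR 1 (← addR y twoR)
  let len ← subR b a
  let third ← divR 1 3
  let twoThirds ← divR 2 3
  let N ← ceilR (← divR (← mulR (← powR s third) (← powR len twoThirds)) (← powR P.iota third))
  let T ← castN P.T
  let C1 ← addR 1 P.C
  let K ← ceilR (← powR (← divR (← mulR C1 C1) (← mulR P.iota T)) third)
  let Q ← ceilR (← divR (← logR T) (← logR 2))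
  let inner ← unifPart ⟨a, b, true, true⟩ N
  let outer ← bands K a b r (← addN Q 1) 1
  append inner outer

/-! ## The expert algorithm MsMwC

Mirror descent with the weighted entropy `∑ wᵢ log wᵢ / ηᵢ` over the probability vectors with all
entries at least `floor`, optimism vector zero (so that the played vector is the last iterate). -/

/-- Data of one expert in a mirror step: current weight, learning rate, corrected loss. -/
structure Item where
  w : ℝ
  eta : ℝ
  loss : ℝ

/-- `⟨v, loss⟩` plus the Bregman divergence of the weighted entropy between `v` and the current
weights. -/
def mirrorObjective (items : List Item) (v : List ℝ) : ℝ :=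
  (List.zipWith (fun (e : Item) (x : ℝ) =>
    x * e.loss + (x * Real.log (x / e.w) - x + e.w) / e.eta) items v).sum

/-- The truncated simplex in dimension `d`. -/
def truncSimplex (d : ℕ) (floor : ℝ) : Set (List ℝ) :=
  {v | v.length = d ∧ (∀ x ∈ v, floor ≤ x) ∧ v.sum = 1}

/-- The two subroutines that the description of the algorithm leaves open: the solution of the
mirror step (for an epoch of length `2 ^ m`), and the choice of an index `i < n` between two
consecutive values of different sign. -/
structure Routines where
  mirror : (m : ℕ) → (floor : ℝ) → List Item → Timed (List ℝ)
  crossing : (n : ℕ) → (ℕ → Timed ℝ) → Timed ℕ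

/-- The subroutines do exactly what is asked: the mirror step returns a minimizer of the objective
over the truncated simplex, and `crossing` returns any index with a sign change. -/
structure Routines.Exact (R : Routines) : Prop where
  mirror : ∀ (m : ℕ) (floor : ℝ) (items : List Item), items ≠ [] →
    (∀ e ∈ items, 0 < e.w ∧ 0 < e.eta) → 0 < floor → floor * items.length ≤ 1 →
    (R.mirror m floor items).val ∈ truncSimplex items.length floor ∧
    ∀ v ∈ truncSimplex items.length floor,
      mirrorObjective items (R.mirror m floor items).val ≤ mirrorObjective items v
  crossing : ∀ (n : ℕ) (f : ℕ → Timed ℝ), 0 < n → (f 0).val ≤ 0 → 0 < (f n).val →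
    (R.crossing n f).val < n ∧
    (f (R.crossing n f).val).val * (f ((R.crossing n f).val + 1)).val ≤ 0

/-- Stationary point of the mirror step for a given Lagrange multiplier. -/
def mirrorAt (floor : ℝ) (items : List Item) (mult : ℝ) : Timed (List ℝ) :=
  forEach (fun e => do
    maxR floor (← mulR e.w (← expR (← mulR e.eta (← subR mult e.loss))))) items

/-- Bisection for the multiplier at which the weights sum to one. -/
def bisectMult (floor : ℝ) (items : List Item) : ℕ → ℝ → ℝ → Timed ℝ
  | 0, _, hi => tick hi
  | n + 1, lo, hi => do
    let mid ← divR (← addR lo hi) 2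
    let tot ← loop addR 0 (← mirrorAt floor items mid)
    if ← ltR tot 1 then bisectMult floor items n mid hi else bisectMult floor items n lo mid

/-- Binary search for a sign change between `lo` and `hi`; `fuel` only makes the recursion
visibly terminate. -/
def bisectSign (f : ℕ → Timed ℝ) : (fuel lo hi : ℕ) → Timed ℕ
  | 0, lo, _ => tick lo
  | fuel + 1, lo, hi => do
    if ← leN hi (← addN lo 1) then tick lo
    else
      let mid ← halfN (← addN lo hi)
      if ← leR (← f mid) 0 then bisectSign f fuel mid hi else bisectSign f fuel lo mid

/-- The implementation with elementary operations only: `4 m + 16` bisection steps for the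
multiplier of the mirror step, and binary search for the sign change. -/
def bisection : Routines where
  mirror m floor items := do
    let steps ← addN (← mulN 4 m) 16
    let mult ← bisectMult floor items steps (-2) 2
    mirrorAt floor items mult
  crossing n f := bisectSign f n 0 n

/-! ## The base calibration algorithm and the epoch framework -/

/-- An expert `(J, σ)`: interval, sign, weight, and sum of the squares of its past gains. -/
structure Arm where
  cell : Cell
  sgn : ℝ
  w : ℝ
  V : ℝ

/-- State of the forecaster: epoch number `m`, epoch length `len = 2 ^ m`, number `idx` of rounds
already played in the epoch, sum of the outcomes of these rounds, the partition, the lower bound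
`1 / (d * len)` on the weights and `log (d * len)`, where `d` is the number of experts, and the
experts. In the first epoch there are no intervals and no experts. -/
structure State where
  m : ℕ
  len : ℕ
  idx : ℕ
  ones : ℝ
  cells : List Cell
  floor : ℝ
  logDim : ℝ
  arms : List Arm

def start : State := ⟨1, 2, 0, 0, [], 0, 0, []⟩

/-- The distribution that puts mass `1 - θ` on `u` and mass `θ` on `v`. -/
structure Mix where
  u : ℝ
  v : ℝ
  θ : ℝ

/-- `Φ(p) = ∑ w_(J,σ) σ 1[p ∈ J]`. -/
def Phi (arms : List Arm) (p : ℝ) : Timed ℝ :=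
  loop (fun acc a => do
    if ← a.cell.mem p then addR acc (← mulR a.w a.sgn) else tick acc) 0 arms

/-- The distribution of the auxiliary prediction. -/
def mixture (R : Routines) (P : Params) (s : State) : Timed Mix := do
  if ← leN s.m 1 then tick ⟨P.init s.idx, P.init s.idx, 0⟩
  else
    let f0 ← Phi s.arms 0
    if ← ltR 0 f0 then tick ⟨0, 0, 0⟩
    else
      let f1 ← Phi s.arms 1
      if ← leR f1 0 then tick ⟨1, 1, 0⟩
      else
        let len ← castN s.len
        let i ← R.crossing s.len (fun j => do Phi s.arms (← divR (← castN j) len))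
        let u ← divR (← castN i) len
        let v ← divR (← castN (← addN i 1)) len
        let x ← absR (← Phi s.arms u)
        let y ← absR (← Phi s.arms v)
        tick ⟨u, v, ← divR x (← addR x y)⟩

/-- The right end point of the interval that contains `p`. -/
def locate (p : ℝ) : List Cell → Timed ℝ
  | [] => tick p
  | c :: l => do
    if ← c.mem p then tick c.hi else locate p l

/-- The prediction made when the auxiliary prediction is `p`. -/
def output (s : State) (p : ℝ) : Timed ℝ := do
  if ← leN s.m 1 then tick p else locate p s.cells

/-- The gain `E_(p ∼ D) [σ 1[p ∈ J] (p - y)]` of an expert. -/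
def gain (D : Mix) (y : ℝ) (a : Arm) : Timed ℝ := do
  let x ← if ← a.cell.mem D.u then mulR (← subR 1 D.θ) (← subR D.u y) else tick 0
  let z ← if ← a.cell.mem D.v then mulR D.θ (← subR D.v y) else tick 0
  mulR a.sgn (← addR x z)

/-- Learning rate `η = min (1/64) (sqrt (logDim / V))` (with `sqrt (logDim / 0) = ∞`), and
corrected loss `-g + 32 η g²` of an expert with gain `g`. -/
def toItem (logDim : ℝ) (ag : Arm × ℝ) : Timed Item := do
  let eta ← divR 1 (← maxR 64 (← sqrtR (← divR ag.1.V logDim)))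
  let corr ← mulR (← mulR 32 eta) (← mulR ag.2 ag.2)
  tick ⟨ag.1.w, eta, ← subR corr ag.2⟩

/-- Store the new weights and add the squared gains. -/
def reweigh : List (Arm × ℝ) → List ℝ → Timed (List Arm)
  | (a, g) :: l, w :: ws => do
    let V ← addR a.V (← mulR g g)
    let rest ← reweigh l ws
    tick (⟨a.cell, a.sgn, w, V⟩ :: rest)
  | _, _ => tick []

/-- One round of MsMwC after outcome `y`. -/
def learn (R : Routines) (s : State) (D : Mix) (y : ℝ) : Timed (List Arm) := do
  let ags ← forEach (fun a => do tick (a, ← gain D y a)) s.arms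
  let items ← forEach (toItem s.logDim) ags
  let ws ← R.mirror s.m s.floor items
  reweigh ags ws

/-- Start the epoch that follows epoch `m` of length `len` in which the outcomes sum to `ones`:
build the new partition and start the base algorithm from scratch with uniform weights. -/
def newEpoch (P : Params) (m len : ℕ) (ones : ℝ) : Timed State := do
  let m' ← addN m 1
  let len' ← mulN 2 len
  let sPrev ← castN len
  let s ← castN len'
  let cells ← partition P sPrev s (← divR ones sPrev)
  let d ← mulR 2 (← loop (fun n _ => addR n 1) 0 cells)
  let dim ← mulR d s
  let floor ← divR 1 dim
  let logDim ← logR dim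
  let w ← divR 1 d
  let pos ← forEach (fun c => tick (⟨c, 1, w, 0⟩ : Arm)) cells
  let neg ← forEach (fun c => tick (⟨c, -1, w, 0⟩ : Arm)) cells
  let arms ← append pos neg
  tick ⟨m', len', 0, 0, cells, floor, logDim, arms⟩

/-- Process the outcome `y` of a round in which the auxiliary prediction had distribution `D`. -/
def update (R : Routines) (P : Params) (s : State) (D : Mix) (y : Bool) : Timed State := do
  let yv : ℝ := if y then 1 else 0
  let arms ← if ← leN s.m 1 then tick [] else learn R s D yv
  let ones ← addR s.ones yv
  let idx ← addN s.idx 1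
  if ← eqN idx s.len then newEpoch P s.m s.len ones
  else tick ⟨s.m, s.len, idx, ones, s.cells, s.floor, s.logDim, arms⟩

/-! ## The game -/

/-- The Bernoulli distribution with mean `x` (only used for `0 ≤ x ≤ 1`). -/
def coin (x : ℝ) : PMF Bool :=
  PMF.ofFintype
    (fun b => ENNReal.ofReal (if b then max 0 (min 1 x) else 1 - max 0 (min 1 x))) (by
      have h0 : (0 : ℝ) ≤ max 0 (min 1 x) := le_max_left _ _
      have h1 : max 0 (min 1 x) ≤ (1 : ℝ) := max_le zero_le_one (min_le_left _ _)
      rw [Fintype.sum_bool]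
      simp only [if_true, Bool.false_eq_true, if_false]
      rw [← ENNReal.ofReal_add h0 (by linarith)]
      simp)

/-- What is recorded of a round: prediction, outcome, number of elementary operations. -/
structure Round where
  p : ℝ
  y : Bool
  cost : ℕ

/-- One round: given the past, the auxiliary prediction and the outcome (of mean `q`) are drawn
independently. Drawing the auxiliary prediction costs one operation. -/
def roundLaw (R : Routines) (P : Params) (s : State) (q : ℝ) : PMF (Round × State) :=
  (coin (mixture R P s).val.θ).bind fun b =>
  (coin q).map fun y =>
    let D := mixture R P s
    let out := output s (if b then D.val.v else D.val.u)
    let next := update R P s D.val y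
    (⟨out.val, y, D.cost + 1 + out.cost + next.cost⟩, next.val)

/-- The law of the transcript of the game from state `s` on, for outcomes with the given means. -/
def play (R : Routines) (P : Params) : List ℝ → State → PMF (List Round)
  | [], _ => PMF.pure []
  | q :: qs, s => (roundLaw R P s q).bind fun rs => (play R P qs rs.2).map (rs.1 :: ·)

/-- The law of the transcript of the whole game. -/
def transcript (R : Routines) (P : Params) (q : Fin P.T → ℝ) : PMF (List Round) :=
  play R P (List.ofFn q) start

/-- The `ℓ_r` calibration error
`∑_p n(p) |(1 / n(p)) ∑_(t : p_t = p) (y_t - p)| ^ r` over the predictions `p` that occur. -/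
def calError (r : ℕ) (h : List Round) : ℝ :=
  ∑ p ∈ (h.map Round.p).toFinset,
    let hp := h.filter (fun x => x.p = p)
    (hp.length : ℝ) *
      |1 / (hp.length : ℝ) * (hp.map (fun x => (if x.y then (1 : ℝ) else 0) - p)).sum| ^ r

/-- The non-stationarity `C = min_(x ∈ [0,1]) ∑_t |q_t - x|`. -/
def nonStationarity {T : ℕ} (q : Fin T → ℝ) : ℝ :=
  ⨅ x : Set.Icc (0 : ℝ) 1, ∑ t, |q t - x|

end Calib

end

/-! Let `xs` minimise `∑ |q_t - x|`. The mean outcome of an epoch of length `s` differs from `xs` by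
at most `√(ι/s) + C/s`, so in the next epoch `xs` lies in `I_m` at depth at least `r_m` from every
end point that is not 0 or 1. Within an epoch the calibration error is at most the sum over the
intervals `J` of `|∑ 1[p̃ ∈ J] (p̃ - y)|` plus `n(J) |J|`.

The first term is the realized gain of the experts `(J, ±1)`. The choice of `P` makes the
forecaster's own weighted gain at most `2/H` per round against either outcome (`mix_spec`). The
second-order regret bound of MsMwC (`regret_coordinate`, `regret_chain`, `regret_epoch`) therefore
bounds the expected gain of every expert by about `ι + √(ι n(J))`. The difference to the realized
gain is controlled by exponential supermartingales and one union bound over polynomially many of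
them (`prob_of_supermartingales`, `super_pot`). Square roots never enter the sums: `√(ι n)` appears
as `λ n + ι/λ`, with a scale `λ` that depends on the epoch and the interval only (`cell_conc`).

The inner intervals cost `√(N ι S) + S |I_m| / N`, which the choice of `N_m` balances. The outer
intervals are handled by a self-bounding argument (`epoch_error`). If an interval at distance `g`
from `xs` is hit `n` times, then `g n` is at most its realized gain, plus the outcome noise, plus
the part of `∑ |q_t - xs|` that falls on its hits. With the scale `λ = μ g` and `μ` small, the sum
`X` of all `g n` is at most `2 C_m + O(K ι / (μ r))`, where `C_m` is the share of the epoch in `C`;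
here `∑ 1/g = O(K/r)`, because the bands double (`mem_bands`). An outer interval is no wider than
`g/K`, so rounding predictions to end points costs only `X/K`.

Altogether an epoch costs `O(√(ι 2^m) + (ι 2^m C)^(1/3) + C_m/κ)`, where `K = ⌈κ⌉`
(`epoch_numeric`). The first two terms grow geometrically in `m`, the shares `C_m` add up to `C`,
and `C/κ ≤ (ι T C)^(1/3)` (`error_from`, `calibration_bound`).

Exact minimizers and bisection are treated together: the analysis uses only the approximate
optimality in `Routines.Good`, which both provide (`Routines.Exact.good`, `bisection_good`). For the
cost, the numbers `N_m` and `K` are both `O((1+C)^(1/3))`, there are `O(log T)` bands, and each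
round makes `O(log T)` passes over the experts (`round_cost_bound`). -/

noncomputable section

namespace Calib

/-! ## Values of the programs -/

@[simp] theorem bind_val {α β : Type} (x : Timed α) (f : α → Timed β) :
    (x >>= f).val = (f x.val).val := rfl
@[simp] theorem bind_cost {α β : Type} (x : Timed α) (f : α → Timed β) :
    (x >>= f).cost = x.cost + (f x.val).cost := rfl

@[simp] theorem tick_val {α : Type} (a : α) : (tick a).val = a := rfl
@[simp] theorem addR_val (x y : ℝ) : (addR x y).val = x + y := rfl
@[simp] theorem subR_val (x y : ℝ) : (subR x y).val = x - y := rfl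
@[simp] theorem mulR_val (x y : ℝ) : (mulR x y).val = x * y := rfl
@[simp] theorem divR_val (x y : ℝ) : (divR x y).val = x / y := rfl
@[simp] theorem maxR_val (x y : ℝ) : (maxR x y).val = max x y := rfl
@[simp] theorem minR_val (x y : ℝ) : (minR x y).val = min x y := rfl
@[simp] theorem absR_val (x : ℝ) : (absR x).val = |x| := rfl
@[simp] theorem sqrtR_val (x : ℝ) : (sqrtR x).val = Real.sqrt x := rfl
@[simp] theorem expR_val (x : ℝ) : (expR x).val = Real.exp x := rfl
@[simp] theorem logR_val (x : ℝ) : (logR x).val = Real.log x := rfl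
@[simp] theorem powR_val (x y : ℝ) : (powR x y).val = x ^ y := rfl
@[simp] theorem ltR_val (x y : ℝ) : (ltR x y).val = decide (x < y) := rfl
@[simp] theorem leR_val (x y : ℝ) : (leR x y).val = decide (x ≤ y) := rfl
@[simp] theorem ceilR_val (x : ℝ) : (ceilR x).val = ⌈x⌉₊ := rfl
@[simp] theorem castN_val (n : ℕ) : (castN n).val = (n : ℝ) := rfl
@[simp] theorem addN_val (m n : ℕ) : (addN m n).val = m + n := rfl
@[simp] theorem mulN_val (m n : ℕ) : (mulN m n).val = m * n := rfl
@[simp] theorem halfN_val (n : ℕ) : (halfN n).val = n / 2 := rfl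
@[simp] theorem eqN_val (m n : ℕ) : (eqN m n).val = decide (m = n) := rfl
@[simp] theorem leN_val (m n : ℕ) : (leN m n).val = decide (m ≤ n) := rfl

theorem ite_val {α : Type} (c : Prop) [Decidable c] (x y : Timed α) :
    (if c then x else y).val = if c then x.val else y.val := by split <;> rfl
theorem ite_cost {α : Type} (c : Prop) [Decidable c] (x y : Timed α) :
    (if c then x else y).cost = if c then x.cost else y.cost := by split <;> rfl

@[simp] theorem forEach_val {α β : Type} (f : α → Timed β) (l : List α) :
    (forEach f l).val = l.map (fun a => (f a).val) := by
  induction l with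
  | nil => rfl
  | cons a l ih => simp [forEach, ih]

@[simp] theorem loop_val {α β : Type} (f : β → α → Timed β) (l : List α) (b : β) :
    (loop f b l).val = l.foldl (fun b a => (f b a).val) b := by
  induction l generalizing b with
  | nil => rfl
  | cons a l ih => simp [loop, ih]

@[simp] theorem append_val {α : Type} (k l : List α) : (append k l).val = k ++ l := by
  induction k with
  | nil => rfl
  | cons a k ih => simp [append, ih]

theorem foldl_add_sum (l : List ℝ) (b : ℝ) : l.foldl (fun x y => x + y) b = b + l.sum := by
  induction l generalizing b with
  | nil => simp
  | cons a l ih => simp [ih]; ring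

/-- Membership in an interval as a proposition. -/
def Cell.Has (c : Cell) (p : ℝ) : Prop :=
  (if c.loIn then c.lo ≤ p else c.lo < p) ∧ (if c.hiIn then p ≤ c.hi else p < c.hi)

theorem Cell.mem_val (c : Cell) (p : ℝ) : (c.mem p).val = true ↔ c.Has p := by
  unfold Cell.mem Cell.Has
  cases c.loIn <;> cases c.hiIn <;> simp

open Classical in
/-- Indicator function of an interval. -/
def Cell.ind (c : Cell) (p : ℝ) : ℝ := if c.Has p then 1 else 0

theorem Cell.ind_eq (c : Cell) (p : ℝ) : c.ind p = if (c.mem p).val = true then 1 else 0 := by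
  unfold Cell.ind
  by_cases h : c.Has p
  · simp [h, (c.mem_val p).mpr h]
  · simp [h, mt (c.mem_val p).mp h]

theorem Cell.ind_nonneg (c : Cell) (p : ℝ) : 0 ≤ c.ind p := by
  unfold Cell.ind; split <;> norm_num
theorem Cell.ind_le_one (c : Cell) (p : ℝ) : c.ind p ≤ 1 := by
  unfold Cell.ind; split <;> norm_num
theorem Cell.ind_sq (c : Cell) (p : ℝ) : c.ind p ^ 2 = c.ind p := by
  unfold Cell.ind; split <;> norm_num
theorem Cell.ind_zero_or_one (c : Cell) (p : ℝ) :
    (c.ind p = 0 ∧ ¬ c.Has p) ∨ (c.ind p = 1 ∧ c.Has p) := by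
  unfold Cell.ind; split
  · exact Or.inr ⟨rfl, ‹_›⟩
  · exact Or.inl ⟨rfl, ‹_›⟩

theorem Cell.has_le_hi {c : Cell} {p : ℝ} (h : c.Has p) : p ≤ c.hi := by
  obtain ⟨_, h⟩ := h; split at h <;> linarith
theorem Cell.has_lo_le {c : Cell} {p : ℝ} (h : c.Has p) : c.lo ≤ p := by
  obtain ⟨h, _⟩ := h; split at h <;> linarith

theorem Phi_val (arms : List Arm) (p : ℝ) :
    (Phi arms p).val = (arms.map fun a => a.w * a.sgn * a.cell.ind p).sum := by
  have key : ∀ (l : List Arm) (b : ℝ),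
      (loop (fun acc a => do
        if ← a.cell.mem p then addR acc (← mulR a.w a.sgn) else tick acc) b l).val
      = b + (l.map fun a => a.w * a.sgn * a.cell.ind p).sum := by
    intro l
    induction l with
    | nil => intro b; simp
    | cons a l ih =>
      intro b
      simp only [loop, bind_val, tick_val, List.map_cons, List.sum_cons]
      rw [ih, Cell.ind_eq]
      split <;> simp <;> ring
  have := key arms 0
  simpa [Phi] using this

theorem gain_val (D : Mix) (y : ℝ) (a : Arm) :
    (gain D y a).val = a.sgn * ((1 - D.θ) * (D.u - y) * a.cell.ind D.u
      + D.θ * (D.v - y) * a.cell.ind D.v) := by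
  simp only [gain, bind_val, Cell.ind_eq]
  by_cases h1 : (a.cell.mem D.u).val = true <;> by_cases h2 : (a.cell.mem D.v).val = true <;>
    simp [h1, h2]

theorem toItem_val (L : ℝ) (ag : Arm × ℝ) :
    (toItem L ag).val = ⟨ag.1.w, 1 / max 64 (Real.sqrt (ag.1.V / L)),
      32 * (1 / max 64 (Real.sqrt (ag.1.V / L))) * (ag.2 * ag.2) - ag.2⟩ := rfl

theorem reweigh_val (l : List (Arm × ℝ)) (ws : List ℝ) :
    (reweigh l ws).val =
      List.zipWith (fun ag w => ⟨ag.1.cell, ag.1.sgn, w, ag.1.V + ag.2 * ag.2⟩) l ws := by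
  induction l generalizing ws with
  | nil => rfl
  | cons ag l ih =>
    obtain ⟨a, g⟩ := ag
    cases ws with
    | nil => rfl
    | cons w ws => simp [reweigh, ih]

theorem mirrorAt_val (floor : ℝ) (items : List Item) (mult : ℝ) :
    (mirrorAt floor items mult).val =
      items.map fun e => max floor (e.w * Real.exp (e.eta * (mult - e.loss))) := by
  simp [mirrorAt]

/-! ## Coins and expectations -/

/-- Expectation of a nonnegative function. -/
def ex {α : Type} (p : PMF α) (f : α → ENNReal) : ENNReal := ∑' a, p a * f a

theorem ex_pure {α : Type} (a : α) (f : α → ENNReal) : ex (PMF.pure a) f = f a := by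
  unfold ex
  rw [tsum_eq_single a]
  · simp
  · intro b hb; simp [hb]

theorem ex_bind {α β : Type} (p : PMF α) (k : α → PMF β) (f : β → ENNReal) :
    ex (p.bind k) f = ex p fun a => ex (k a) f := by
  unfold ex
  simp only [PMF.bind_apply, ← ENNReal.tsum_mul_right, ← ENNReal.tsum_mul_left]
  rw [ENNReal.tsum_comm]
  simp only [mul_assoc]

theorem ex_map {α β : Type} (p : PMF α) (g : α → β) (f : β → ENNReal) :
    ex (p.map g) f = ex p fun a => f (g a) := by
  unfold PMF.map
  rw [ex_bind]
  simp only [Function.comp, ex_pure]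

theorem ex_mul_left {α : Type} (p : PMF α) (c : ENNReal) (f : α → ENNReal) :
    (ex p fun a => c * f a) = c * ex p f := by
  unfold ex
  rw [← ENNReal.tsum_mul_left]
  congr 1; funext a; ring

theorem ex_sum {α ι : Type} (p : PMF α) (S : Finset ι) (f : ι → α → ENNReal) :
    (ex p fun a => ∑ i ∈ S, f i a) = ∑ i ∈ S, ex p (f i) := by
  unfold ex
  simp only [Finset.mul_sum]
  exact Summable.tsum_finsetSum (fun i _ => ENNReal.summable)

theorem ex_coin (x : ℝ) (f : Bool → ENNReal) (h0 : 0 ≤ x) (h1 : x ≤ 1) :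
    ex (coin x) f = ENNReal.ofReal x * f true + ENNReal.ofReal (1 - x) * f false := by
  unfold ex
  rw [tsum_fintype, Fintype.sum_bool]
  simp [coin, h0, h1]

/-- Markov's inequality in the form of a lower bound for the probability of the complement. -/
theorem markov_compl {α : Type} (p : PMF α) (f : α → ENNReal) (good : Set α) (δ : ℝ)
    (hδ : 0 ≤ δ) (hf : ex p f ≤ ENNReal.ofReal δ)
    (hgood : ∀ a ∈ p.support, f a < 1 → a ∈ good) :
    ENNReal.ofReal (1 - δ) ≤ p.toOuterMeasure good := by
  have h1 : (1 : ENNReal) ≤ p.toOuterMeasure good + ENNReal.ofReal δ := by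
    rw [← p.tsum_coe, PMF.toOuterMeasure_apply]
    -- A point of the support outside `good` has `f a ≥ 1`, so its mass is paid for by `p a * f a`.
    calc ∑' a, p a ≤ ∑' a, (good.indicator p a + p a * f a) := by
          refine ENNReal.tsum_le_tsum fun a => ?_
          by_cases ha : a ∈ good
          · simp [ha]
          · by_cases hs : a ∈ p.support
            · have : 1 ≤ f a := by
                by_contra hc
                exact ha (hgood a hs (not_le.mp hc))
              calc p a = p a * 1 := (mul_one _).symm
                _ ≤ p a * f a := by gcongr
                _ ≤ _ := le_add_self
            · have : p a = 0 := by simpa [PMF.mem_support_iff] using hs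
              simp [this]
      _ = _ := by rw [ENNReal.tsum_add]
      _ ≤ _ := by gcongr; exact hf
  rw [ENNReal.ofReal_sub _ hδ, ENNReal.ofReal_one]
  exact tsub_le_iff_right.mpr h1

/-! ## The game with a full record of the rounds -/

/-- A round: state before the round, mean outcome, coin of the forecaster, outcome. -/
structure Step where
  s : State
  q : ℝ
  b : Bool
  y : Bool

/-- The distribution of the auxiliary prediction. -/
def State.mix (R : Routines) (P : Params) (s : State) : Mix := (mixture R P s).val

/-- The next state. -/
def State.next (R : Routines) (P : Params) (s : State) (y : Bool) : State :=
  (update R P s (s.mix R P) y).val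

/-- The auxiliary prediction. -/
def Step.aux (R : Routines) (P : Params) (st : Step) : ℝ :=
  if st.b then (st.s.mix R P).v else (st.s.mix R P).u

/-- What the transcript records. -/
def Step.round (R : Routines) (P : Params) (st : Step) : Round :=
  ⟨(output st.s (st.aux R P)).val, st.y,
    (mixture R P st.s).cost + 1 + (output st.s (st.aux R P)).cost
      + (update R P st.s (st.s.mix R P) st.y).cost⟩

/-- The law of the full record. -/
def steps (R : Routines) (P : Params) : List ℝ → State → PMF (List Step)
  | [], _ => PMF.pure []
  | q :: qs, s => (coin (s.mix R P).θ).bind fun b => (coin q).bind fun y =>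
      (steps R P qs (s.next R P y)).map (⟨s, q, b, y⟩ :: ·)

/-- The transcript forgets the states, the coins and the means, on which the martingale differences
depend; the finer law keeps them. The next state depends on the outcome but not on the coin, because
experts receive gains averaged over the coin. -/
theorem play_eq (R : Routines) (P : Params) (qs : List ℝ) (s : State) :
    play R P qs s = (steps R P qs s).map (List.map (Step.round R P)) := by
  induction qs generalizing s with
  | nil => simp [play, steps, PMF.pure_map]
  | cons q qs ih =>
    simp only [play, steps, roundLaw, PMF.bind_bind, PMF.map_bind, PMF.bind_map]
    refine congrArg _ (funext fun b => congrArg _ (funext fun y => ?_))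
    simp only [Function.comp, PMF.map_comp]
    rw [ih]
    simp only [PMF.map_comp]
    rfl

/-- The records that are consistent with the dynamics. -/
def Valid (R : Routines) (P : Params) : List ℝ → State → List Step → Prop
  | [], _, l => l = []
  | q :: qs, s, l => ∃ st l', l = st :: l' ∧ st.s = s ∧ st.q = q ∧
      Valid R P qs (s.next R P st.y) l'

theorem valid_of_mem_support (R : Routines) (P : Params) (qs : List ℝ) (s : State) (l : List Step)
    (h : l ∈ (steps R P qs s).support) : Valid R P qs s l := by
  induction qs generalizing s l with
  | nil => simpa [steps, Valid] using h
  | cons q qs ih =>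
    simp only [steps, PMF.mem_support_bind_iff, PMF.mem_support_map_iff] at h
    obtain ⟨b, _, y, _, l', hl', rfl⟩ := h
    exact ⟨_, _, rfl, rfl, rfl, ih _ _ hl'⟩

/-- An exponential supermartingale along the game. -/
theorem ex_exp_sum_le_one (R : Routines) (P : Params) (Inv : State → Prop)
    (hnext : ∀ s y, Inv s → Inv (s.next R P y)) (φ : Step → ℝ)
    (hθ : ∀ s, Inv s → 0 ≤ (s.mix R P).θ ∧ (s.mix R P).θ ≤ 1)
    (hφ : ∀ s q, Inv s → 0 ≤ q → q ≤ 1 →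
      (s.mix R P).θ * (q * Real.exp (φ ⟨s, q, true, true⟩)
        + (1 - q) * Real.exp (φ ⟨s, q, true, false⟩))
      + (1 - (s.mix R P).θ) * (q * Real.exp (φ ⟨s, q, false, true⟩)
        + (1 - q) * Real.exp (φ ⟨s, q, false, false⟩)) ≤ 1)
    (qs : List ℝ) (hq : ∀ q ∈ qs, 0 ≤ q ∧ q ≤ 1) (s : State) (hs : Inv s) :
    ex (steps R P qs s) (fun l => ENNReal.ofReal (Real.exp (l.map φ).sum)) ≤ 1 := by
  induction qs generalizing s with
  | nil => simp [steps, ex_pure]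
  | cons q qs ih =>
    have ih' := fun y => ih (fun q hq' => hq q (by simp [hq'])) (s.next R P y) (hnext s y hs)
    obtain ⟨hq0, hq1⟩ := hq q (by simp)
    obtain ⟨ht0, ht1⟩ := hθ s hs
    have hinner : ∀ b y, ex ((steps R P qs (s.next R P y)).map (⟨s, q, b, y⟩ :: ·))
        (fun l => ENNReal.ofReal (Real.exp (l.map φ).sum))
        ≤ ENNReal.ofReal (Real.exp (φ ⟨s, q, b, y⟩)) := by
      intro b y
      rw [ex_map]
      simp only [List.map_cons, List.sum_cons, Real.exp_add]
      simp only [ENNReal.ofReal_mul (Real.exp_pos _).le]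
      rw [ex_mul_left]
      calc _ ≤ ENNReal.ofReal (Real.exp (φ ⟨s, q, b, y⟩)) * 1 := by gcongr; exact ih' y
        _ = _ := mul_one _
    rw [steps, ex_bind]
    simp only [ex_bind]
    rw [ex_coin _ _ ht0 ht1]
    simp only [ex_coin _ _ hq0 hq1]
    calc _ ≤ ENNReal.ofReal (s.mix R P).θ *
          (ENNReal.ofReal q * ENNReal.ofReal (Real.exp (φ ⟨s, q, true, true⟩))
          + ENNReal.ofReal (1 - q) * ENNReal.ofReal (Real.exp (φ ⟨s, q, true, false⟩)))
          + ENNReal.ofReal (1 - (s.mix R P).θ) *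
          (ENNReal.ofReal q * ENNReal.ofReal (Real.exp (φ ⟨s, q, false, true⟩))
          + ENNReal.ofReal (1 - q) * ENNReal.ofReal (Real.exp (φ ⟨s, q, false, false⟩))) := by
            gcongr <;> exact hinner _ _
      _ = ENNReal.ofReal ((s.mix R P).θ * (q * Real.exp (φ ⟨s, q, true, true⟩)
        + (1 - q) * Real.exp (φ ⟨s, q, true, false⟩))
      + (1 - (s.mix R P).θ) * (q * Real.exp (φ ⟨s, q, false, true⟩)
        + (1 - q) * Real.exp (φ ⟨s, q, false, false⟩))) := by
          have h1 : 0 ≤ 1 - q := by linarith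
          have h2 : 0 ≤ 1 - (s.mix R P).θ := by linarith
          rw [ENNReal.ofReal_add (by positivity) (by positivity), ENNReal.ofReal_mul ht0,
            ENNReal.ofReal_mul h2, ENNReal.ofReal_add (by positivity) (by positivity),
            ENNReal.ofReal_add (by positivity) (by positivity), ENNReal.ofReal_mul hq0,
            ENNReal.ofReal_mul h1, ENNReal.ofReal_mul hq0, ENNReal.ofReal_mul h1]
      _ ≤ 1 := ENNReal.ofReal_le_one.mpr (hφ s q hs hq0 hq1)

/-- Union bound for finitely many exponential supermartingales. -/
theorem prob_of_supermartingales {ι : Type} (R : Routines) (P : Params) (Inv : State → Prop)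
    (hnext : ∀ s y, Inv s → Inv (s.next R P y)) (S : Finset ι) (φ : ι → Step → ℝ)
    (hθ : ∀ s, Inv s → 0 ≤ (s.mix R P).θ ∧ (s.mix R P).θ ≤ 1)
    (hφ : ∀ i ∈ S, ∀ s q, Inv s → 0 ≤ q → q ≤ 1 →
      (s.mix R P).θ * (q * Real.exp (φ i ⟨s, q, true, true⟩)
        + (1 - q) * Real.exp (φ i ⟨s, q, true, false⟩))
      + (1 - (s.mix R P).θ) * (q * Real.exp (φ i ⟨s, q, false, true⟩)
        + (1 - q) * Real.exp (φ i ⟨s, q, false, false⟩)) ≤ 1)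
    (qs : List ℝ) (hq : ∀ q ∈ qs, 0 ≤ q ∧ q ≤ 1) (s : State) (hs : Inv s)
    (δ x : ℝ) (hδ : 0 ≤ δ) (hx : (S.card : ℝ) ≤ δ * Real.exp x)
    (good : Set (List Round))
    (hgood : ∀ l, Valid R P qs s l → (∀ i ∈ S, (l.map (φ i)).sum ≤ x) →
      l.map (Step.round R P) ∈ good) :
    ENNReal.ofReal (1 - δ) ≤ (play R P qs s).toOuterMeasure good := by
  rw [play_eq, PMF.toOuterMeasure_map_apply]
  -- As soon as one sum exceeds `x`, its summand alone makes this function at least 1.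
  refine markov_compl _ (fun l => ENNReal.ofReal (Real.exp (-x)) *
    ∑ i ∈ S, ENNReal.ofReal (Real.exp (l.map (φ i)).sum)) _ δ hδ ?_ ?_
  · rw [ex_mul_left, ex_sum]
    calc _ ≤ ENNReal.ofReal (Real.exp (-x)) * ∑ i ∈ S, 1 := by
          gcongr with i hi
          exact ex_exp_sum_le_one R P Inv hnext (φ i) hθ (hφ i hi) qs hq s hs
      _ = ENNReal.ofReal (Real.exp (-x) * S.card) := by
          rw [ENNReal.ofReal_mul (Real.exp_pos _).le]
          simp
      _ ≤ ENNReal.ofReal δ := by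
          apply ENNReal.ofReal_le_ofReal
          calc Real.exp (-x) * S.card ≤ Real.exp (-x) * (δ * Real.exp x) := by gcongr
            _ = δ * (Real.exp (-x) * Real.exp x) := by ring
            _ = δ := by rw [← Real.exp_add]; simp
  · intro l hl hlt
    refine hgood l (valid_of_mem_support R P qs s l hl) fun i hi => ?_
    by_contra hc
    push Not at hc
    apply absurd hlt
    rw [not_lt]
    calc (1 : ENNReal) = ENNReal.ofReal (Real.exp (-x)) * ENNReal.ofReal (Real.exp x) := by
          rw [← ENNReal.ofReal_mul (Real.exp_pos _).le, ← Real.exp_add]; simp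
      _ ≤ ENNReal.ofReal (Real.exp (-x)) * ENNReal.ofReal (Real.exp (l.map (φ i)).sum) := by
          gcongr
      _ ≤ _ := by
          gcongr
          exact Finset.single_le_sum (f := fun i => ENNReal.ofReal (Real.exp (l.map (φ i)).sum))
            (fun _ _ => zero_le) hi

/-! ## The mirror step -/

/-- What the analysis needs from the subroutines: approximate first-order optimality of the mirror
step, and an index with a sign change. -/
structure Routines.Good (R : Routines) : Prop where
  mirror : ∀ (m n : ℕ) (floor : ℝ) (it : Fin n → Item), 0 < n → 0 < floor → floor * n ≤ 1 →
    (∀ i, floor ≤ (it i).w ∧ 0 < (it i).eta ∧ (it i).eta ≤ 1 / 64 ∧ |(it i).loss| ≤ 3 / 2) →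
    1 ≤ ∑ i, (it i).w → ∑ i, (it i).w ≤ 1 + (1 / 2) ^ m →
    ∃ v : Fin n → ℝ, (R.mirror m floor (List.ofFn it)).val = List.ofFn v ∧
      (∀ i, floor ≤ v i) ∧ 1 ≤ ∑ i, v i ∧ ∑ i, v i ≤ 1 + (1 / 2) ^ m ∧
      ∀ u : Fin n → ℝ, (∀ i, floor ≤ u i) → ∑ i, u i = 1 →
        -(2 * (1 / 2) ^ m) ≤
          ∑ i, (Real.log (v i / (it i).w) / (it i).eta + (it i).loss) * (u i - v i)
  crossing : ∀ (n : ℕ) (f : ℕ → Timed ℝ), 0 < n → (f 0).val ≤ 0 → 0 < (f n).val →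
    (R.crossing n f).val < n ∧
    (f (R.crossing n f).val).val * (f ((R.crossing n f).val + 1)).val ≤ 0

theorem zipWith_ofFn {α β γ : Type} {n : ℕ} (f : α → β → γ) (a : Fin n → α) (b : Fin n → β) :
    List.zipWith f (List.ofFn a) (List.ofFn b) = List.ofFn fun i => f (a i) (b i) := by
  apply List.ext_getElem
  · simp
  · intro i h1 h2
    simp

theorem mirrorObjective_ofFn {n : ℕ} (it : Fin n → Item) (v : Fin n → ℝ) :
    mirrorObjective (List.ofFn it) (List.ofFn v) =
      ∑ i, (v i * (it i).loss +
        (v i * Real.log (v i / (it i).w) - v i + (it i).w) / (it i).eta) := by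
  rw [mirrorObjective, zipWith_ofFn, List.sum_ofFn]

/-- The summand `-x` of the entropy cancels the constant that differentiating `x log x` produces, so
the gradient is `log (x/w)/η + loss` with no extra term. -/
theorem hasDerivAt_objective (w eta loss x : ℝ) (hw : 0 < w) (hx : 0 < x) (d : ℝ) :
    HasDerivAt (fun t : ℝ => (x + t * d) * loss +
      ((x + t * d) * Real.log ((x + t * d) / w) - (x + t * d) + w) / eta)
      ((Real.log (x / w) / eta + loss) * d) 0 := by
  have h1 : HasDerivAt (fun t : ℝ => x + t * d) d 0 := by
    simpa using ((hasDerivAt_id (0 : ℝ)).mul_const d).const_add x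
  have h2 : HasDerivAt (fun t : ℝ => (x + t * d) / w) (d / w) 0 := h1.div_const w
  have h3 := h2.log (by simp; exact ⟨hx.ne', hw.ne'⟩)
  have h4 := ((((h1.mul h3).sub h1).add_const w).div_const eta)
  have h5 := (h1.mul_const loss).add h4
  refine h5.congr_deriv ?_
  have : d / w / ((x + 0 * d) / w) = d / x := by
    rw [zero_mul, add_zero]; field_simp
  rw [this]
  simp only [zero_mul, add_zero]
  field_simp
  ring

/-- First-order optimality on a segment. -/
theorem deriv_nonneg_of_min {f : ℝ → ℝ} {f' : ℝ} (h : HasDerivAt f f' 0)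
    (hmin : ∀ t, 0 < t → t < 1 → f 0 ≤ f t) : 0 ≤ f' := by
  have h1 := h.tendsto_slope_zero_right
  refine ge_of_tendsto h1 ?_
  have h2 : ∀ᶠ t : ℝ in nhdsWithin 0 (Set.Ioi 0), t < 1 :=
    nhdsWithin_le_nhds (Iio_mem_nhds one_pos)
  filter_upwards [h2, self_mem_nhdsWithin] with t ht1 ht0
  simp only [zero_add, smul_eq_mul]
  have := hmin t ht0 ht1
  have : 0 < t := ht0
  apply mul_nonneg (by positivity) (by linarith)

/-- The truncated simplex is convex, so the derivative at the minimizer in the direction of any `u`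
is nonnegative. An exact step thus has both slacks of `Routines.Good` to spare. -/
theorem Routines.Exact.good {R : Routines} (hR : R.Exact) : R.Good where
  crossing := hR.crossing
  mirror m n floor it hn hf hfn hit _ _ := by
    have hne : List.ofFn it ≠ [] := by
      intro h
      have := congrArg List.length h
      simp at this
      omega
    obtain ⟨⟨hl, hfl, hsum⟩, hmin⟩ := hR.mirror m floor (List.ofFn it) hne
      (fun e he => by
        obtain ⟨i, rfl⟩ := (List.mem_ofFn' _ _).mp he
        exact ⟨hf.trans_le (hit i).1, (hit i).2.1⟩) hf (by simpa using hfn)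
    set vl := (R.mirror m floor (List.ofFn it)).val
    have hl' : vl.length = n := by simpa using hl
    obtain ⟨v, hv⟩ : ∃ v : Fin n → ℝ, vl = List.ofFn v := by
      refine ⟨fun i => vl[i.val]'(by omega), List.ext_getElem (by simp [hl']) fun i h1 h2 => ?_⟩
      simp
    have hvf : ∀ i, floor ≤ v i := fun i => hfl _ (by rw [hv]; exact (List.mem_ofFn' _ _).mpr ⟨i, rfl⟩)
    have hvs : ∑ i, v i = 1 := by rw [← List.sum_ofFn, ← hv, hsum]
    refine ⟨v, hv, hvf, hvs.ge, ?_, fun u hu hus => ?_⟩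
    · rw [hvs]; have : (0 : ℝ) < (1 / 2) ^ m := by positivity
      linarith
    have key : 0 ≤ ∑ i, (Real.log (v i / (it i).w) / (it i).eta + (it i).loss) * (u i - v i) := by
      refine deriv_nonneg_of_min (f := fun t => ∑ i, ((v i + t * (u i - v i)) * (it i).loss +
        ((v i + t * (u i - v i)) * Real.log ((v i + t * (u i - v i)) / (it i).w)
          - (v i + t * (u i - v i)) + (it i).w) / (it i).eta)) ?_ ?_
      · apply HasDerivAt.fun_sum
        intro i _
        exact hasDerivAt_objective _ _ _ _ (hf.trans_le (hit i).1) (hf.trans_le (hvf i)) _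
      · intro t ht0 ht1
        have := hmin (List.ofFn fun i => v i + t * (u i - v i)) ⟨by simp, ?_, ?_⟩
        · rw [hv, mirrorObjective_ofFn, mirrorObjective_ofFn] at this
          simpa using this
        · intro x hx
          obtain ⟨i, rfl⟩ := (List.mem_ofFn' _ _).mp hx
          nlinarith [hvf i, hu i]
        · rw [List.sum_ofFn, Finset.sum_add_distrib, ← Finset.mul_sum, Finset.sum_sub_distrib,
            hvs, hus]
          ring
    have : (0 : ℝ) < (1 / 2) ^ m := by positivity
    linarith

/-! ### The bisection implementation -/

/-- Sum of the entries of the stationary point. -/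
def totalAt {n : ℕ} (floor : ℝ) (it : Fin n → Item) (x : ℝ) : ℝ :=
  ∑ i, max floor ((it i).w * Real.exp ((it i).eta * (x - (it i).loss)))

/-- Invariant of the bisection: the total is at least 1 at the upper end, and below 1 at the lower
end unless that end has never moved. -/
theorem bisectMult_spec {n : ℕ} (floor : ℝ) (it : Fin n → Item) (k : ℕ) (lo hi : ℝ)
    (h : lo ≤ hi) (htot : 1 ≤ totalAt floor it hi) :
    ∃ r lo', (bisectMult floor (List.ofFn it) k lo hi).val = r ∧ 1 ≤ totalAt floor it r ∧
      r ≤ hi ∧ lo ≤ lo' ∧ r - lo' = (hi - lo) / 2 ^ k ∧ (lo' = lo ∨ totalAt floor it lo' < 1) := by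
  induction k generalizing lo hi with
  | zero => exact ⟨hi, lo, rfl, htot, le_rfl, le_rfl, by simp, Or.inl rfl⟩
  | succ k ih =>
    have hval : (bisectMult floor (List.ofFn it) (k + 1) lo hi).val =
        if totalAt floor it ((lo + hi) / 2) < 1 then
          (bisectMult floor (List.ofFn it) k ((lo + hi) / 2) hi).val
        else (bisectMult floor (List.ofFn it) k lo ((lo + hi) / 2)).val := by
      simp only [bisectMult, bind_val, addR_val, divR_val, loop_val, mirrorAt_val, ltR_val,
        foldl_add_sum, List.map_ofFn, List.sum_ofFn, zero_add, totalAt, ite_val,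
        decide_eq_true_eq]
      rfl
    rw [hval]
    split
    · rename_i hlt
      obtain ⟨r, lo', h1, h2, h3, h4, h5, h6⟩ := ih ((lo + hi) / 2) hi (by linarith) htot
      refine ⟨r, lo', h1, h2, h3, by linarith, ?_, Or.inr ?_⟩
      · rw [h5, pow_succ]; field_simp; ring
      · rcases h6 with rfl | h6
        · exact hlt
        · exact h6
    · rename_i hlt
      obtain ⟨r, lo', h1, h2, h3, h4, h5, h6⟩ :=
        ih lo ((lo + hi) / 2) (by linarith) (not_lt.mp hlt)
      refine ⟨r, lo', h1, h2, by linarith, h4, ?_, h6⟩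
      rw [h5, pow_succ]; field_simp; ring

/-- The search keeps `f lo ≤ 0 < f hi`. Fuel `hi - lo` suffices, since every step shortens the range
by at least one. -/
theorem bisectSign_spec (f : ℕ → Timed ℝ) (fuel lo hi : ℕ) (hlt : lo < hi)
    (hfuel : hi ≤ lo + fuel) (hlo : (f lo).val ≤ 0) (hhi : 0 < (f hi).val) :
    (bisectSign f fuel lo hi).val < hi ∧ (f (bisectSign f fuel lo hi).val).val ≤ 0 ∧
      0 ≤ (f ((bisectSign f fuel lo hi).val + 1)).val := by
  induction fuel generalizing lo hi with
  | zero => omega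
  | succ fuel ih =>
    simp only [bisectSign, bind_val, leN_val, addN_val, halfN_val, leR_val, ite_val,
      decide_eq_true_eq, tick_val]
    split
    · have : hi = lo + 1 := by omega
      subst this
      exact ⟨hlt, hlo, hhi.le⟩
    · split
      · rename_i h1 h2
        exact ih _ _ (by omega) (by omega) h2 hhi
      · rename_i h1 h2
        obtain ⟨h3, h4⟩ := ih lo ((lo + hi) / 2) (by omega) (by omega) hlo (not_le.mp h2)
        exact ⟨by omega, h4⟩

/-- Convexity of `exp` bounds the increment by the slope at the larger argument, and truncation from
below cannot enlarge it. -/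
theorem max_exp_sub_le (floor w a b : ℝ) (hw : 0 ≤ w) (hab : b ≤ a) :
    max floor (w * Real.exp a) ≤ max floor (w * Real.exp b) + w * Real.exp a * (a - b) := by
  have h1 : Real.exp a - Real.exp b ≤ Real.exp a * (a - b) := by
    have h := Real.add_one_le_exp (b - a)
    have : Real.exp b = Real.exp a * Real.exp (b - a) := by rw [← Real.exp_add]; ring_nf
    rw [this]
    nlinarith [Real.exp_pos a]
  have h2 : 0 ≤ w * Real.exp a * (a - b) := by
    have := Real.exp_pos a
    have : 0 ≤ a - b := by linarith
    positivity
  apply max_le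
  · have := le_max_left floor (w * Real.exp b); linarith
  · have := le_max_right floor (w * Real.exp b); nlinarith

theorem exp_one_le_three : Real.exp 1 ≤ 3 := by
  have := Real.exp_one_lt_d9; linarith

/-- At the returned multiplier `r`, `log (v/w)/η + loss` equals `r` on coordinates above the floor.
On a floored coordinate it is at least `r`, and there `u - v ≥ 0`. So the variational sum is at
least `r (1 - ∑ v)`, which is small because `r ≤ 2` and `∑ v` is within `2^(-m)` of 1. -/
theorem bisection_good : bisection.Good where
  crossing n f hn h0 h1 := by
    obtain ⟨h2, h3, h4⟩ := bisectSign_spec f n 0 n hn (by omega) h0 h1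
    exact ⟨h2, mul_nonpos_of_nonpos_of_nonneg h3 h4⟩
  mirror m n floor it hn hf hfn hit hw1 hw2 := by
    have hw0 : ∀ i, 0 < (it i).w := fun i => hf.trans_le (hit i).1
    have hloss : ∀ i, -(3 / 2) ≤ (it i).loss ∧ (it i).loss ≤ 3 / 2 :=
      fun i => abs_le.mp (hit i).2.2.2
    -- All losses are at most 3/2, so at the multiplier 2 no weight shrinks.
    have htop : 1 ≤ totalAt floor it 2 := by
      refine hw1.trans (Finset.sum_le_sum fun i _ => le_max_of_le_right ?_)
      have : 0 ≤ (it i).eta * (2 - (it i).loss) :=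
        mul_nonneg (hit i).2.1.le (by linarith [(hloss i).2])
      have := Real.one_le_exp this
      nlinarith [hw0 i]
    obtain ⟨r, lo', hr, htot, hr2, hlo, hgap, hcase⟩ :=
      bisectMult_spec floor it (4 * m + 16) (-2) 2 (by norm_num) htop
    have hp : (0 : ℝ) < (1 / 2) ^ m := by positivity
    have hp1 : ((1 : ℝ) / 2) ^ m ≤ 1 := pow_le_one₀ (by norm_num) (by norm_num)
    -- The initial bracket has length 4, and `4 / 2^16 = 1/16384`; the factor `2^(4m)` is more than
    -- needed.
    have hgap' : r - lo' ≤ (1 / 2) ^ m / 16384 := by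
      rw [hgap]
      have e1 : (2 : ℝ) ^ (4 * m + 16) = (2 ^ m) ^ 4 * 65536 := by
        rw [pow_add, mul_comm 4 m, pow_mul]; norm_num
      have e2 : ((1 : ℝ) / 2) ^ m = 1 / 2 ^ m := by rw [div_pow, one_pow]
      rw [e1, e2]
      have h1 : (1 : ℝ) ≤ 2 ^ m := one_le_pow₀ (by norm_num)
      have h2 : (2 : ℝ) ^ m ≤ (2 ^ m) ^ 4 := le_self_pow₀ h1 (by norm_num)
      rw [div_div, div_le_div_iff₀ (by positivity) (by positivity)]
      linarith
    have hgap0 : 0 ≤ r - lo' := by rw [hgap]; positivity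
    have htot_le : totalAt floor it r ≤ 1 + (1 / 2) ^ m := by
      -- If the lower end is still `-2`, then `r` is below every loss, no weight grows, and the old
      -- total bounds the new one. Otherwise the total was below 1 at distance `r - lo'`.
      rcases hcase with rfl | hlt
      · refine le_trans (Finset.sum_le_sum fun i _ => max_le (hit i).1 ?_) hw2
        have : (it i).eta * (r - (it i).loss) ≤ 0 := by
          apply mul_nonpos_of_nonneg_of_nonpos (hit i).2.1.le
          linarith [(hloss i).1]
        have := Real.exp_le_one_iff.mpr this
        nlinarith [hw0 i]
      · have hstep : totalAt floor it r ≤ totalAt floor it lo' + ∑ i, (it i).w * (1 / 2) ^ m / 2 := by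
          rw [totalAt, totalAt, ← Finset.sum_add_distrib]
          refine Finset.sum_le_sum fun i _ => ?_
          refine (max_exp_sub_le floor _ _ ((it i).eta * (lo' - (it i).loss)) (hw0 i).le ?_).trans ?_
          · exact mul_le_mul_of_nonneg_left (by linarith) (hit i).2.1.le
          · gcongr
            have h1 : (it i).eta * (r - (it i).loss) ≤ 1 := by
              have := (hit i).2.1; have := (hit i).2.2.1; have := (hloss i).1
              nlinarith
            have h2 := (Real.exp_le_exp.mpr h1).trans exp_one_le_three
            have h3 : (it i).eta * (r - (it i).loss) - (it i).eta * (lo' - (it i).loss)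
                ≤ (1 / 2) ^ m / 16384 := by
              have := (hit i).2.1; have := (hit i).2.2.1
              nlinarith
            calc (it i).w * _ * _ ≤ (it i).w * 3 * ((1 / 2) ^ m / 16384) := by
                  have := hw0 i
                  have h4 : (it i).eta * (lo' - (it i).loss) ≤ (it i).eta * (r - (it i).loss) :=
                    mul_le_mul_of_nonneg_left (by linarith) (hit i).2.1.le
                  have : 0 ≤ (it i).eta * (r - (it i).loss) - (it i).eta * (lo' - (it i).loss) := by
                    linarith
                  gcongr
              _ ≤ _ := by nlinarith [hw0 i, mul_pos (hw0 i) hp]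
        rw [← Finset.sum_div, ← Finset.sum_mul] at hstep
        have : (∑ i, (it i).w) * (1 / 2) ^ m / 2 ≤ (1 / 2) ^ m := by nlinarith
        linarith
    refine ⟨fun i => max floor ((it i).w * Real.exp ((it i).eta * (r - (it i).loss))), ?_,
      fun i => le_max_left _ _, htot, htot_le, ?_⟩
    · simp only [bisection, bind_val, mulN_val, addN_val, mirrorAt_val, hr, List.map_ofFn]
      rfl
    · intro u hu hus
      have hterm : ∀ i, r * (u i - max floor ((it i).w * Real.exp ((it i).eta * (r - (it i).loss))))
          ≤ (Real.log (max floor ((it i).w * Real.exp ((it i).eta * (r - (it i).loss))) / (it i).w)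
            / (it i).eta + (it i).loss) *
            (u i - max floor ((it i).w * Real.exp ((it i).eta * (r - (it i).loss)))) := by
        intro i
        have heta := (hit i).2.1
        rcases le_total floor ((it i).w * Real.exp ((it i).eta * (r - (it i).loss))) with h | h
        · rw [max_eq_right h, mul_div_cancel_left₀ _ (hw0 i).ne', Real.log_exp,
            mul_div_cancel_left₀ _ heta.ne']
          simp
        · rw [max_eq_left h]
          refine mul_le_mul_of_nonneg_right ?_ (by linarith [hu i])
          have : (it i).eta * (r - (it i).loss) ≤ Real.log (floor / (it i).w) := by
            rw [Real.le_log_iff_exp_le (div_pos hf (hw0 i)), le_div_iff₀ (hw0 i)]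
            linarith
          have : r - (it i).loss ≤ Real.log (floor / (it i).w) / (it i).eta := by
            rw [le_div_iff₀ heta]; linarith
          linarith
      refine le_trans ?_ (Finset.sum_le_sum fun i _ => hterm i)
      rw [← Finset.mul_sum, Finset.sum_sub_distrib, hus]
      change _ ≤ r * (1 - totalAt floor it r)
      nlinarith

/-! ## The regret of MsMwC -/

/-- The divergence of the entropy in one coordinate. -/
def klTerm (u w : ℝ) : ℝ := u * Real.log (u / w) - u + w

theorem klTerm_nonneg {u w : ℝ} (hu : 0 < u) (hw : 0 < w) : 0 ≤ klTerm u w := by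
  have h := Real.log_le_sub_one_of_pos (div_pos hw hu)
  have h2 : Real.log (u / w) = - Real.log (w / u) := by
    rw [← Real.log_inv, inv_div]
  have : u * (w / u) = w := by field_simp
  unfold klTerm
  rw [h2]
  nlinarith

/-- Fenchel's inequality for the entropy: it is the nonnegativity of the divergence between `v` and
`w * exp x`. -/
theorem mul_le_klTerm_add_exp {v w : ℝ} (hv : 0 < v) (hw : 0 < w) (x : ℝ) :
    v * x ≤ klTerm v w + w * (Real.exp x - 1) := by
  have h := klTerm_nonneg hv (mul_pos hw (Real.exp_pos x))
  unfold klTerm at *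
  rw [← div_div, Real.log_div (div_pos hv hw).ne' (Real.exp_pos x).ne', Real.log_exp] at h
  linarith

/-- This is what the correction `32 η g²` in the losses buys. Of the 32, a quarter is spent on the
change of the learning rate, so 31 remain available. -/
theorem exp_sub_sq_le (x : ℝ) (hx : |x| ≤ 1 / 64) : Real.exp (x - 31 * x ^ 2) ≤ 1 + x := by
  obtain ⟨h1, h2⟩ := abs_le.mp hx
  have hx2 : x ^ 2 ≤ 1 / 4096 := by nlinarith
  have hy : |x - 31 * x ^ 2| ≤ 1 := by
    rw [abs_le]; constructor <;> nlinarith [sq_nonneg x]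
  have h := Real.abs_exp_sub_one_sub_id_le hy
  have h3 := (abs_le.mp h).2
  have h4 : (x - 31 * x ^ 2) ^ 2 ≤ 4 * x ^ 2 := by
    have : (x - 31 * x ^ 2) ^ 2 = x ^ 2 * (1 - 31 * x) ^ 2 := by ring
    rw [this]
    have : (1 - 31 * x) ^ 2 ≤ 4 := by nlinarith
    nlinarith [sq_nonneg x]
  nlinarith [sq_nonneg x]

/-- The three-point identity splits the mirror inequality into the divergences from `u` to `w`, from
`u` to `v`, and from `v` to `w`. The last one pays, by Fenchel's inequality, for replacing `v` by
`w` in the gain. Changing the learning rate costs `κ (u L + v)`: the `u` part is `u η g² / 2`, and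
the `v` part is absorbed by shifting the loss by `κ` inside the exponential. The factor 33 covers
`32 + 1/2`. -/
theorem regret_coordinate (u w v g η η' L : ℝ) (hη : 0 < η) (hη1 : η ≤ 1 / 64)
    (hg : |g| ≤ 1) (hw : 0 < w) (hv : 0 < v) (hu : 0 < u) (hu1 : u ≤ 1) (hL : 2 ≤ L)
    (hvL : -L ≤ Real.log v)
    (hη' : 1 / η' - 1 / η ≤ η * g ^ 2 / (2 * L)) :
    u * g - w * g - 33 * (u * η * g ^ 2) - klTerm u w / η + klTerm u v / η' ≤
      -((Real.log (v / w) / η + (32 * η * g ^ 2 - g)) * (u - v)) := by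
  have hthree : Real.log (v / w) * (u - v) = klTerm u w - klTerm u v - klTerm v w := by
    unfold klTerm
    rw [Real.log_div hv.ne' hw.ne', Real.log_div hu.ne' hw.ne', Real.log_div hu.ne' hv.ne']
    ring
  -- Here `log u ≤ 0` and `-log v ≤ L`; the floor on the weights is what keeps the divergence
  -- bounded.
  have hkl : klTerm u v ≤ u * L + v := by
    unfold klTerm
    rw [Real.log_div hu.ne' hv.ne']
    have := Real.log_nonpos hu.le hu1
    nlinarith
  set κ := η * g ^ 2 / (2 * L) with hκ
  have hκ0 : 0 ≤ κ := by positivity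
  have hκ1 : κ ≤ η * g ^ 2 / 4 := by
    rw [hκ]; gcongr; linarith
  have hdiff : (1 / η' - 1 / η) * klTerm u v ≤ u * (η * g ^ 2 / 2) + κ * v := by
    calc (1 / η' - 1 / η) * klTerm u v ≤ κ * (u * L + v) := by
          apply mul_le_mul hη' hkl (klTerm_nonneg hu hv) hκ0
      _ = u * (κ * L) + κ * v := by ring
      _ = _ := by rw [hκ]; congr 2; field_simp
  have hx : |η * g| ≤ 1 / 64 := by
    rw [abs_mul, abs_of_pos hη]
    calc η * |g| ≤ 1 / 64 * 1 := by gcongr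
      _ = _ := by norm_num
  have hexp : Real.exp (-(η * (32 * η * g ^ 2 - g - κ))) ≤ 1 + η * g := by
    refine le_trans (Real.exp_le_exp.mpr ?_) (exp_sub_sq_le _ hx)
    have : η * κ ≤ η * (η * g ^ 2 / 4) := by gcongr
    nlinarith [sq_nonneg (η * g)]
  have hfen := mul_le_klTerm_add_exp hv hw (-(η * (32 * η * g ^ 2 - g - κ)))
  have hfen2 : -(v * (32 * η * g ^ 2 - g - κ)) ≤ klTerm v w / η + w * g := by
    rw [← sub_le_iff_le_add, le_div_iff₀ hη]
    have : w * (Real.exp (-(η * (32 * η * g ^ 2 - g - κ))) - 1) ≤ w * (η * g) := by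
      gcongr; linarith
    nlinarith
  have e1 : (Real.log (v / w) / η + (32 * η * g ^ 2 - g)) * (u - v) =
      klTerm u w / η - klTerm u v / η - klTerm v w / η + (32 * η * g ^ 2 - g) * (u - v) := by
    rw [add_mul, div_mul_eq_mul_div, hthree]; ring
  rw [e1]
  have e2 : klTerm u v / η' = (1 / η' - 1 / η) * klTerm u v + klTerm u v / η := by ring
  rw [e2]
  have : 0 ≤ u * η * g ^ 2 := by positivity
  nlinarith

/-- One round of the regret analysis. -/
theorem regret_step {n : ℕ} (u w v g η η' : Fin n → ℝ) (L ε : ℝ) (hL : 2 ≤ L)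
    (hη : ∀ i, 0 < η i) (hη1 : ∀ i, η i ≤ 1 / 64) (hg : ∀ i, |g i| ≤ 1) (hw : ∀ i, 0 < w i)
    (hv : ∀ i, 0 < v i) (hu : ∀ i, 0 < u i) (hu1 : ∀ i, u i ≤ 1)
    (hvL : ∀ i, -L ≤ Real.log (v i))
    (hη' : ∀ i, 1 / η' i - 1 / η i ≤ η i * g i ^ 2 / (2 * L))
    (hopt : -ε ≤ ∑ i, (Real.log (v i / w i) / η i + (32 * η i * g i ^ 2 - g i)) * (u i - v i)) :
    ∑ i, u i * g i + ∑ i, klTerm (u i) (v i) / η' i ≤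
      ∑ i, w i * g i + 33 * ∑ i, u i * η i * g i ^ 2 + ∑ i, klTerm (u i) (w i) / η i + ε := by
  have h := Finset.sum_le_sum fun i (_ : i ∈ Finset.univ) =>
    regret_coordinate (u i) (w i) (v i) (g i) (η i) (η' i) L (hη i) (hη1 i) (hg i) (hw i) (hv i)
      (hu i) (hu1 i) hL (hvL i) (hη' i)
  simp only [Finset.sum_sub_distrib, Finset.sum_add_distrib, Finset.sum_neg_distrib,
    ← Finset.mul_sum] at h
  linarith

/-! ### The adaptive learning rates -/

/-- The learning rate. -/
def rate (L V : ℝ) : ℝ := 1 / max 64 (Real.sqrt (V / L))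

theorem rate_pos (L V : ℝ) : 0 < rate L V := by unfold rate; positivity

theorem rate_le (L V : ℝ) : rate L V ≤ 1 / 64 := by
  unfold rate
  apply one_div_le_one_div_of_le (by norm_num) (le_max_left _ _)

theorem one_div_rate (L V : ℝ) : 1 / rate L V = max 64 (Real.sqrt (V / L)) := by
  unfold rate; rw [one_div_one_div]

/-- When `1/η` grows from `A` to `B`, one has `2 A (B - A) ≤ B² - A²`, and the squares under the
root differ by `x / L`. This is the hypothesis on `η'` in `regret_coordinate`. -/
theorem one_div_rate_sub {L V x : ℝ} (hL : 0 < L) (hV : 0 ≤ V) (hx : 0 ≤ x) :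
    1 / rate L (V + x) - 1 / rate L V ≤ rate L V * x / (2 * L) := by
  have hrw : rate L V * x / (2 * L) = x / L / (2 * (1 / rate L V)) := by
    have := (rate_pos L V).ne'
    field_simp
  rw [hrw, one_div_rate, one_div_rate]
  set A := max 64 (Real.sqrt (V / L)) with hA
  have hA64 : 64 ≤ A := le_max_left _ _
  have hAs : Real.sqrt (V / L) ≤ A := le_max_right _ _
  rw [le_div_iff₀ (by linarith)]
  rcases le_total (Real.sqrt ((V + x) / L)) 64 with h | h
  · rw [max_eq_left h]
    have : 0 ≤ x / L := by positivity
    nlinarith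
  · rw [max_eq_right h]
    set B := Real.sqrt ((V + x) / L) with hB
    have hB2 : B ^ 2 = V / L + x / L := by
      rw [hB, Real.sq_sqrt (by positivity)]; ring
    have hA2 : V / L ≤ A ^ 2 := by
      have : Real.sqrt (V / L) ^ 2 = V / L := Real.sq_sqrt (by positivity)
      rw [← this]
      gcongr
    rcases le_total A B with hAB | hAB
    · nlinarith
    · have : 0 ≤ x / L := by positivity
      nlinarith

/-- A learning rate times the next squared gain is controlled by the growth of `√V`. -/
theorem rate_mul_le {L V x : ℝ} (hL : 2 ≤ L) (hV : 0 ≤ V) (hx : 0 ≤ x) (hx1 : x ≤ 1) :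
    rate L V * x ≤ 4 * Real.sqrt L * (Real.sqrt (V + x + 1) - Real.sqrt (V + 1)) := by
  have hs1 : 0 < Real.sqrt (V + 1) := Real.sqrt_pos.mpr (by linarith)
  have hsL : 0 < Real.sqrt L := Real.sqrt_pos.mpr (by linarith)
  -- For `V ≤ 1` the cap 1/64 suffices; for `V ≥ 1` one has `V + 1 ≤ (3/2)² V`. The shift by 1 keeps
  -- the estimate valid at `V = 0`.
  have hrate : rate L V ≤ 3 / 2 * Real.sqrt L / Real.sqrt (V + 1) := by
    rw [le_div_iff₀ hs1]
    rcases le_total V 1 with h | h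
    · have h1 := rate_le L V
      have h2 : Real.sqrt (V + 1) ≤ 2 := by
        rw [Real.sqrt_le_left (by norm_num)]; linarith
      have h3 : 1 ≤ Real.sqrt L := by rw [Real.one_le_sqrt]; linarith
      nlinarith [rate_pos L V]
    · have h1 : rate L V ≤ Real.sqrt L / Real.sqrt V := by
        unfold rate
        rw [← one_div_div (Real.sqrt V), ← Real.sqrt_div hV]
        exact one_div_le_one_div_of_le (Real.sqrt_pos.mpr (by positivity)) (le_max_right _ _)
      have hsV : 0 < Real.sqrt V := Real.sqrt_pos.mpr (by linarith)
      have h2 : Real.sqrt (V + 1) ≤ 3 / 2 * Real.sqrt V := by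
        rw [Real.sqrt_le_left (by positivity), mul_pow, Real.sq_sqrt hV]; linarith
      calc rate L V * Real.sqrt (V + 1) ≤ Real.sqrt L / Real.sqrt V * (3 / 2 * Real.sqrt V) := by
            gcongr
        _ = 3 / 2 * Real.sqrt L := by field_simp
  have hdiff : x / (5 / 2 * Real.sqrt (V + 1)) ≤ Real.sqrt (V + x + 1) - Real.sqrt (V + 1) := by
    rw [div_le_iff₀ (by positivity)]
    have h1 : Real.sqrt (V + x + 1) ≤ 3 / 2 * Real.sqrt (V + 1) := by
      rw [Real.sqrt_le_left (by positivity), mul_pow, Real.sq_sqrt (by linarith)]; linarith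
    have h2 : Real.sqrt (V + 1) ≤ Real.sqrt (V + x + 1) := Real.sqrt_le_sqrt (by linarith)
    have h3 : Real.sqrt (V + x + 1) ^ 2 = V + x + 1 := Real.sq_sqrt (by linarith)
    have h4 : Real.sqrt (V + 1) ^ 2 = V + 1 := Real.sq_sqrt (by linarith)
    nlinarith
  calc rate L V * x ≤ 3 / 2 * Real.sqrt L / Real.sqrt (V + 1) * x := by gcongr
    _ = 15 / 4 * Real.sqrt L * (x / (5 / 2 * Real.sqrt (V + 1))) := by field_simp; ring
    _ ≤ 4 * Real.sqrt L * (x / (5 / 2 * Real.sqrt (V + 1))) := by gcongr; norm_num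
    _ ≤ _ := by gcongr

/-! ## The partition -/

/-- Sum over a list of intervals of the indicators at a point. -/
def indSum (l : List Cell) (p : ℝ) : ℝ := (l.map fun c => c.ind p).sum

@[simp] theorem indSum_nil (p : ℝ) : indSum [] p = 0 := rfl
@[simp] theorem indSum_cons (c : Cell) (l : List Cell) (p : ℝ) :
    indSum (c :: l) p = c.ind p + indSum l p := by simp [indSum]
@[simp] theorem indSum_append (k l : List Cell) (p : ℝ) :
    indSum (k ++ l) p = indSum k p + indSum l p := by simp [indSum]

theorem pieces_succ_val (c : Cell) (N k : ℕ) : (pieces c N (k + 1)).val =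
    ⟨c.lo + (k : ℝ) / N * (c.hi - c.lo), c.lo + ((k + 1 : ℕ) : ℝ) / N * (c.hi - c.lo),
      if k = 0 then c.loIn else true, if k + 1 = N then c.hiIn else false⟩
      :: (pieces c N k).val := by
  simp [pieces]

theorem pieces_length (c : Cell) (N k : ℕ) : (pieces c N k).val.length = k := by
  induction k with
  | zero => rfl
  | succ k ih => rw [pieces_succ_val, List.length_cons, ih]

theorem mem_pieces (c : Cell) (N k : ℕ) (hc : c.lo ≤ c.hi) (hk : k ≤ N) (hN : 0 < N)
    (c' : Cell) (h : c' ∈ (pieces c N k).val) :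
    c.lo ≤ c'.lo ∧ c'.hi ≤ c.hi ∧ c'.hi - c'.lo = (c.hi - c.lo) / N := by
  induction k with
  | zero => simp [pieces] at h
  | succ k ih =>
    rw [pieces_succ_val, List.mem_cons] at h
    rcases h with rfl | h
    · have hN' : (0 : ℝ) < N := by exact_mod_cast hN
      have hd : 0 ≤ c.hi - c.lo := by linarith
      have h1 : ((k + 1 : ℕ) : ℝ) / N ≤ 1 := by
        rw [div_le_one hN']; exact_mod_cast hk
      refine ⟨?_, ?_, ?_⟩
      · have : 0 ≤ (k : ℝ) / N * (c.hi - c.lo) := by positivity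
        simpa using this
      · simp only
        nlinarith
      · simp only
        push_cast
        field_simp
        ring
    · exact ih (by omega) h

/-- Disjointness and covering are expressed together: the indicators of the pieces add up to the
indicator of their union. For `k < N` the union is open on the right, and for `k = N` it inherits
the right end of `c`. -/
theorem pieces_indSum (c : Cell) (N k : ℕ) (hc : c.lo < c.hi) (hk : k ≤ N) (hN : 0 < N) (p : ℝ) :
    indSum (pieces c N k).val p =
      if (if c.loIn then c.lo ≤ p else c.lo < p) ∧
        (if k = N then (if c.hiIn then p ≤ c.hi else p < c.hi)
          else p < c.lo + (k : ℝ) / N * (c.hi - c.lo)) then 1 else 0 := by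
  have hN' : (0 : ℝ) < N := by exact_mod_cast hN
  have hd : 0 < c.hi - c.lo := by linarith
  induction k with
  | zero =>
    have : ¬ (0 = N) := by omega
    simp only [pieces, tick_val, indSum_nil, this, if_false, Nat.cast_zero, zero_div, zero_mul,
      add_zero]
    rw [if_neg]
    rintro ⟨h1, h2⟩
    split at h1 <;> linarith
  | succ k ih =>
    rw [pieces_succ_val, indSum_cons, ih (by omega)]
    have hkN : ¬ (k = N) := by omega
    simp only [hkN, if_false]
    have hstep : (k : ℝ) / N * (c.hi - c.lo) < ((k + 1 : ℕ) : ℝ) / N * (c.hi - c.lo) := by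
      gcongr; simp
    have hpos : k ≠ 0 → 0 < (k : ℝ) / N * (c.hi - c.lo) := by
      intro h
      have : 0 < k := Nat.pos_of_ne_zero h
      positivity
    have hlast : k + 1 = N → ((k + 1 : ℕ) : ℝ) / N * (c.hi - c.lo) = c.hi - c.lo := by
      rintro rfl
      rw [div_self hN'.ne', one_mul]
    set x := (k : ℝ) / N * (c.hi - c.lo)
    set z := ((k + 1 : ℕ) : ℝ) / N * (c.hi - c.lo)
    unfold Cell.ind Cell.Has
    by_cases h0 : k = 0
    · have hx : x = 0 := by simp [x, h0]
      have hno : ¬ ((if c.loIn = true then c.lo ≤ p else c.lo < p) ∧ p < c.lo + x) := by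
        rintro ⟨h1, h2⟩
        split at h1 <;> linarith
      rw [if_neg hno, add_zero]
      simp only [hx, h0, if_true, add_zero, zero_add]
      by_cases h1 : 1 = N
      · have := hlast (by omega)
        simp only [h1, if_true, this]
        rw [add_sub_cancel]
      · simp only [h1, if_false]
        congr 3
    · have hx := hpos h0
      simp only [h0, if_false, if_true]
      by_cases h1 : k + 1 = N
      · have hz := hlast h1
        simp only [h1, if_true, hz, add_sub_cancel]
        by_cases hp : p < c.lo + x
        · have h2 : ¬ (c.lo + x ≤ p) := not_le.mpr hp
          have h3 : (if c.hiIn = true then p ≤ c.hi else p < c.hi) := by split <;> linarith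
          simp [h2, h3, hp]
        · have h2 : c.lo + x ≤ p := not_lt.mp hp
          have h3 : (if c.loIn = true then c.lo ≤ p else c.lo < p) := by split <;> linarith
          simp [h2, h3, hp]
      · simp only [h1, if_false]
        by_cases hp : p < c.lo + x
        · have h2 : ¬ (c.lo + x ≤ p) := not_le.mpr hp
          have h3 : p < c.lo + z := by linarith
          simp [h2, h3, hp]
        · have h2 : c.lo + x ≤ p := not_lt.mp hp
          have h3 : (if c.loIn = true then c.lo ≤ p else c.lo < p) := by split <;> linarith
          simp [h2, h3, hp]

theorem unifPart_indSum (c : Cell) (N : ℕ) (hc : c.lo < c.hi) (hN : 0 < N) (p : ℝ) :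
    indSum (unifPart c N).val p = c.ind p := by
  rw [unifPart, pieces_indSum c N N hc le_rfl hN]
  unfold Cell.ind Cell.Has
  simp

theorem band_val (c : Cell) (K : ℕ) :
    (band c K).val = if c.lo < c.hi then (unifPart c K).val else [] := by
  simp only [band, bind_val, ltR_val, ite_val, decide_eq_true_eq, tick_val]

theorem band_length_le (c : Cell) (K : ℕ) : (band c K).val.length ≤ K := by
  rw [band_val]
  split
  · rw [unifPart, pieces_length]
  · simp

/-- A band with `lo ≥ hi` is dropped from the partition. This loses no point because one of its ends
is open; a degenerate closed interval would lose one. -/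
theorem band_indSum (c : Cell) (K : ℕ) (hK : 0 < K) (hflag : c.loIn = false ∨ c.hiIn = false)
    (p : ℝ) : indSum (band c K).val p = c.ind p := by
  rw [band_val]
  split
  · exact unifPart_indSum c K ‹_› hK p
  · rename_i h
    unfold Cell.ind
    rw [if_neg]
    · rfl
    · rintro ⟨h1, h2⟩
      rcases hflag with hf | hf <;> simp only [hf, Bool.false_eq_true, if_false] at h1 h2 <;>
        split at * <;> linarith

theorem bands_succ_val (K : ℕ) (a b r : ℝ) (n : ℕ) (pw : ℝ) : (bands K a b r (n + 1) pw).val =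
    (band ⟨max 0 (a - (2 * pw - 1) * r), a - (pw - 1) * r, true, false⟩ K).val ++
    ((band ⟨b + (pw - 1) * r, min 1 (b + (2 * pw - 1) * r), false, true⟩ K).val ++
      (bands K a b r n (2 * pw)).val) := by
  simp [bands]

theorem bands_length_le (K : ℕ) (a b r : ℝ) (n : ℕ) (pw : ℝ) :
    (bands K a b r n pw).val.length ≤ 2 * K * n := by
  induction n generalizing pw with
  | zero => simp [bands]
  | succ n ih =>
    rw [bands_succ_val, List.length_append, List.length_append]
    have h1 := ih (2 * pw)
    have h2 := band_length_le ⟨max 0 (a - (2 * pw - 1) * r), a - (pw - 1) * r, true, false⟩ K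
    have h3 := band_length_le ⟨b + (pw - 1) * r, min 1 (b + (2 * pw - 1) * r), false, true⟩ K
    rw [Nat.mul_succ]
    omega

/-- Consecutive bands abut, so on each side they telescope to a single long band. Cutting to `[0,
1]` has no effect at points of the unit interval. -/
theorem bands_indSum (K : ℕ) (a b r : ℝ) (n : ℕ) (pw p : ℝ) (hK : 0 < K) (hr : 0 ≤ r)
    (hpw : 1 ≤ pw) (hp0 : 0 ≤ p) (hp1 : p ≤ 1) :
    indSum (bands K a b r n pw).val p =
      (if a - (2 ^ n * pw - 1) * r ≤ p ∧ p < a - (pw - 1) * r then 1 else 0) +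
      (if b + (pw - 1) * r < p ∧ p ≤ b + (2 ^ n * pw - 1) * r then 1 else 0) := by
  induction n generalizing pw with
  | zero =>
    simp only [bands, tick_val, indSum_nil, pow_zero, one_mul]
    rw [if_neg (by rintro ⟨h1, h2⟩; linarith), if_neg (by rintro ⟨h1, h2⟩; linarith)]
    norm_num
  | succ n ih =>
    rw [bands_succ_val, indSum_append, indSum_append, band_indSum _ _ hK (Or.inr rfl),
      band_indSum _ _ hK (Or.inl rfl), ih _ (by linarith)]
    have h2n : (1 : ℝ) ≤ 2 ^ n := one_le_pow₀ (by norm_num)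
    have e1 : (2 : ℝ) ^ (n + 1) * pw = 2 ^ n * (2 * pw) := by ring
    rw [e1]
    have o1 : (pw - 1) * r ≤ (2 * pw - 1) * r := by
      apply mul_le_mul_of_nonneg_right _ hr; linarith
    have o2 : (2 * pw - 1) * r ≤ (2 ^ n * (2 * pw) - 1) * r := by
      apply mul_le_mul_of_nonneg_right _ hr; nlinarith
    set x := (pw - 1) * r
    set y := (2 * pw - 1) * r
    set z := (2 ^ n * (2 * pw) - 1) * r
    have L : Cell.ind ⟨max 0 (a - y), a - x, true, false⟩ p + (if a - z ≤ p ∧ p < a - y then 1 else 0)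
        = if a - z ≤ p ∧ p < a - x then (1 : ℝ) else 0 := by
      unfold Cell.ind Cell.Has
      simp only [if_true, Bool.false_eq_true, if_false, max_le_iff, hp0, true_and]
      by_cases h : p < a - y
      · have h1 : ¬ (a - y ≤ p) := not_le.mpr h
        have h2 : p < a - x := by linarith
        simp [h, h1, h2]
      · have h1 : a - y ≤ p := not_lt.mp h
        have h2 : a - z ≤ p := by linarith
        simp [h, h1, h2]
    have Rr : Cell.ind ⟨b + x, min 1 (b + y), false, true⟩ p
        + (if b + y < p ∧ p ≤ b + z then 1 else 0)
        = if b + x < p ∧ p ≤ b + z then (1 : ℝ) else 0 := by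
      unfold Cell.ind Cell.Has
      simp only [if_true, Bool.false_eq_true, if_false, le_min_iff, hp1, true_and]
      by_cases h : b + y < p
      · have h1 : ¬ (p ≤ b + y) := not_le.mpr h
        have h2 : b + x < p := by linarith
        simp [h, h1, h2]
      · have h1 : p ≤ b + y := not_lt.mp h
        have h2 : p ≤ b + z := by linarith
        simp [h, h1, h2]
    rw [← L, ← Rr]
    ring

/-- Distance from a point to an interval (negative inside). -/
def Cell.gap (c : Cell) (x : ℝ) : ℝ := max (c.lo - x) (x - c.hi)

theorem Cell.gap_dir {c : Cell} {x : ℝ} :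
    (∀ p, c.Has p → c.gap x ≤ p - x) ∨ (∀ p, c.Has p → c.gap x ≤ x - p) := by
  rcases le_total (c.lo - x) (x - c.hi) with h | h
  · right; intro p hp
    rw [Cell.gap, max_eq_right h]
    linarith [Cell.has_le_hi hp]
  · left; intro p hp
    rw [Cell.gap, max_eq_left h]
    linarith [Cell.has_lo_le hp]

/-- The point `x` will be the centre of the means, at depth at least `r` inside the inner interval.
A band with parameter `pw` then has distance at least `pw * r` from `x`, which is also a bound for
its width; so the relative width of its pieces is at most `1 / K`. At most `2 K` pieces share this
`pw`, and `pw` doubles, so the reciprocals of the distances form a geometric series. -/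
theorem mem_bands (K : ℕ) (a b r x : ℝ) (n : ℕ) (pw : ℝ) (hK : 0 < K) (hr : 0 < r)
    (hpw : 1 ≤ pw) (hx0 : 0 ≤ x) (hx1 : x ≤ 1)
    (ha : 0 < a → a + r ≤ x) (hb : b < 1 → x ≤ b - r) :
    (∀ c ∈ (bands K a b r n pw).val, 0 < c.gap x ∧ c.gap x ≤ 1 ∧
      (c.hi - c.lo) ≤ c.gap x / K) ∧
    ((bands K a b r n pw).val.map fun c => 1 / c.gap x).sum ≤ 4 * K / (pw * r) := by
  have hK' : (0 : ℝ) < K := by exact_mod_cast hK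
  have hsum : ∀ (l : List Cell) (y : ℝ), (∀ c ∈ l, 1 / c.gap x ≤ y) →
      (l.map fun c => 1 / c.gap x).sum ≤ l.length * y := by
    intro l y h
    have := List.sum_le_card_nsmul (l.map fun c => 1 / c.gap x) y (by simpa using h)
    simpa using this
  induction n generalizing pw with
  | zero =>
    simp only [bands, tick_val, List.not_mem_nil, false_imp_iff, implies_true, List.map_nil,
      List.sum_nil, true_and]
    positivity
  | succ n ih =>
    have hpr : 0 < pw * r := by positivity
    have hnr : 0 ≤ (pw - 1) * r := mul_nonneg (by linarith) hr.le
    have hleft : ∀ c ∈ (band ⟨max 0 (a - (2 * pw - 1) * r), a - (pw - 1) * r, true, false⟩ K).val,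
        pw * r ≤ c.gap x ∧ c.gap x ≤ 1 ∧ (c.hi - c.lo) ≤ c.gap x / K := by
      intro c hc
      rw [band_val] at hc
      split at hc
      · rename_i hlt
        simp only at hlt
        obtain ⟨h1, h2, h3⟩ := mem_pieces _ K K hlt.le le_rfl hK c hc
        simp only at h1 h2 h3
        have h4 := le_max_left 0 (a - (2 * pw - 1) * r)
        have h5 := le_max_right 0 (a - (2 * pw - 1) * r)
        -- A nonempty left band lies to the right of 0, which forces `0 < a`; when `a = 0` the depth
        -- of `x` is irrelevant.
        have hxa := ha (by linarith)
        have hg : pw * r ≤ c.gap x := le_max_of_le_right (by linarith)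
        have hw : 0 ≤ c.hi - c.lo := by rw [h3]; apply div_nonneg _ hK'.le; linarith
        refine ⟨hg, ?_, ?_⟩
        · apply max_le <;> linarith
        · rw [h3]
          gcongr
          linarith
      · simp at hc
    have hright : ∀ c ∈ (band ⟨b + (pw - 1) * r, min 1 (b + (2 * pw - 1) * r), false, true⟩ K).val,
        pw * r ≤ c.gap x ∧ c.gap x ≤ 1 ∧ (c.hi - c.lo) ≤ c.gap x / K := by
      intro c hc
      rw [band_val] at hc
      split at hc
      · rename_i hlt
        simp only at hlt
        obtain ⟨h1, h2, h3⟩ := mem_pieces _ K K hlt.le le_rfl hK c hc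
        simp only at h1 h2 h3
        have h4 := min_le_left 1 (b + (2 * pw - 1) * r)
        have h5 := min_le_right 1 (b + (2 * pw - 1) * r)
        have hxb := hb (by linarith)
        have hg : pw * r ≤ c.gap x := le_max_of_le_left (by linarith)
        have hw : 0 ≤ c.hi - c.lo := by rw [h3]; apply div_nonneg _ hK'.le; linarith
        refine ⟨hg, ?_, ?_⟩
        · apply max_le <;> linarith
        · rw [h3]
          gcongr
          linarith
      · simp at hc
    obtain ⟨ih1, ih2⟩ := ih (2 * pw) (by linarith)
    rw [bands_succ_val]
    refine ⟨?_, ?_⟩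
    · intro c hc
      rw [List.mem_append, List.mem_append] at hc
      rcases hc with hc | hc | hc
      · exact ⟨hpr.trans_le (hleft c hc).1, (hleft c hc).2⟩
      · exact ⟨hpr.trans_le (hright c hc).1, (hright c hc).2⟩
      · exact ih1 c hc
    · rw [List.map_append, List.map_append, List.sum_append, List.sum_append]
      have h1 := hsum _ (1 / (pw * r)) fun c hc => one_div_le_one_div_of_le hpr (hleft c hc).1
      have h2 := hsum _ (1 / (pw * r)) fun c hc => one_div_le_one_div_of_le hpr (hright c hc).1
      have l1 : ((band ⟨max 0 (a - (2 * pw - 1) * r), a - (pw - 1) * r, true, false⟩ K).val.length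
          : ℝ) ≤ K := by exact_mod_cast band_length_le _ _
      have l2 : ((band ⟨b + (pw - 1) * r, min 1 (b + (2 * pw - 1) * r), false, true⟩ K).val.length
          : ℝ) ≤ K := by exact_mod_cast band_length_le _ _
      have hq : 0 < 1 / (pw * r) := by positivity
      have e1 : 4 * (K : ℝ) / (2 * pw * r) = 2 * K * (1 / (pw * r)) := by field_simp; norm_num
      have e2 : 4 * (K : ℝ) / (pw * r) = 4 * K * (1 / (pw * r)) := by field_simp
      rw [e1] at ih2
      rw [e2]
      nlinarith

/-! ### The partition with the parameters of the framework -/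

/-- Half the length of the inner interval after an epoch of length `sPrev`, up to a factor two. -/
def Params.rad (P : Params) (sPrev : ℝ) : ℝ := Real.sqrt (P.iota / sPrev) + P.C / sPrev
/-- Left end of the inner interval. -/
def Params.left (P : Params) (sPrev y : ℝ) : ℝ := max 0 (y - 2 * P.rad sPrev)
/-- Right end of the inner interval. -/
def Params.right (P : Params) (sPrev y : ℝ) : ℝ := min 1 (y + 2 * P.rad sPrev)
/-- Number of pieces of the inner interval. -/
def Params.pieceCount (P : Params) (sPrev s y : ℝ) : ℕ :=
  ⌈s ^ (1 / 3 : ℝ) * (P.right sPrev y - P.left sPrev y) ^ (2 / 3 : ℝ) / P.iota ^ (1 / 3 : ℝ)⌉₊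
/-- Number of pieces of a band. -/
def Params.bandCount (P : Params) : ℕ :=
  ⌈((1 + P.C) * (1 + P.C) / (P.iota * P.T)) ^ (1 / 3 : ℝ)⌉₊
/-- Largest index of a band. -/
def Params.bandMax (P : Params) : ℕ := ⌈Real.log P.T / Real.log 2⌉₊

theorem partition_val (P : Params) (sPrev s y : ℝ) : (partition P sPrev s y).val =
    (unifPart ⟨P.left sPrev y, P.right sPrev y, true, true⟩ (P.pieceCount sPrev s y)).val ++
    (bands P.bandCount (P.left sPrev y) (P.right sPrev y) (P.rad sPrev) (P.bandMax + 1) 1).val := by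
  simp only [partition, bind_val, append_val]
  rfl

theorem partition_length_le (P : Params) (sPrev s y : ℝ) : (partition P sPrev s y).val.length ≤
    P.pieceCount sPrev s y + 2 * P.bandCount * (P.bandMax + 1) := by
  rw [partition_val, List.length_append, unifPart, pieces_length]
  have := bands_length_le P.bandCount (P.left sPrev y) (P.right sPrev y) (P.rad sPrev)
    (P.bandMax + 1) 1
  omega

theorem Params.le_two_pow_bandMax (P : Params) (hT : 1 ≤ P.T) : (P.T : ℝ) ≤ 2 ^ P.bandMax := by
  have h := Nat.le_ceil (Real.log P.T / Real.log 2)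
  have hT' : (0 : ℝ) < P.T := by exact_mod_cast hT
  rw [div_le_iff₀ (Real.log_pos (by norm_num)), ← Real.log_pow] at h
  exact (Real.log_le_log_iff hT' (by positivity)).mp h

/-- Standing assumptions on the parameters. -/
structure Params.Ok (P : Params) : Prop where
  T : 2 ≤ P.T
  iota : 1 ≤ P.iota
  C0 : 0 ≤ P.C
  C1 : P.C ≤ P.T
  init : ∀ j, 0 ≤ P.init j ∧ P.init j ≤ 1

theorem Params.Ok.rad_pos {P : Params} (h : P.Ok) {sPrev : ℝ} (hs : 0 < sPrev) :
    0 < P.rad sPrev := by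
  have := h.iota; have := h.C0
  unfold Params.rad
  have : 0 < P.iota / sPrev := by positivity
  positivity

theorem Params.Ok.left_lt_right {P : Params} (h : P.Ok) {sPrev y : ℝ} (hs : 0 < sPrev)
    (hy0 : 0 ≤ y) (hy1 : y ≤ 1) : P.left sPrev y < P.right sPrev y := by
  have := h.rad_pos hs
  unfold Params.left Params.right
  apply max_lt <;> apply lt_min <;> linarith

theorem Params.Ok.bandCount_pos {P : Params} (h : P.Ok) : 0 < P.bandCount := by
  have h1 := h.T; have h2 := h.iota; have h3 := h.C0
  have h4 : 0 < P.T := by omega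
  unfold Params.bandCount
  apply Nat.ceil_pos.mpr
  positivity

theorem Params.Ok.pieceCount_pos {P : Params} (h : P.Ok) {sPrev s y : ℝ} (hs : 0 < sPrev)
    (hs' : 0 < s) (hy0 : 0 ≤ y) (hy1 : y ≤ 1) : 0 < P.pieceCount sPrev s y := by
  have h1 := h.left_lt_right hs hy0 hy1; have h2 := h.iota
  have : 0 < P.right sPrev y - P.left sPrev y := by linarith
  unfold Params.pieceCount
  apply Nat.ceil_pos.mpr
  positivity

/-- The bands reach across the unit interval: the radius is at least `1 / T` as `sPrev ≤ T`, and the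
outermost multiple `2 ^ (bandMax + 1) - 1` is at least `T`. -/
theorem Params.Ok.partition_indSum {P : Params} (h : P.Ok) {sPrev s y p : ℝ} (hs : 0 < sPrev)
    (hs' : 0 < s) (hsT : sPrev ≤ P.T) (hy0 : 0 ≤ y) (hy1 : y ≤ 1) (hp0 : 0 ≤ p) (hp1 : p ≤ 1) :
    indSum (partition P sPrev s y).val p = 1 := by
  have hr := h.rad_pos hs
  have hab := h.left_lt_right hs hy0 hy1
  have ha0 : 0 ≤ P.left sPrev y := le_max_left _ _
  have hb1 : P.right sPrev y ≤ 1 := min_le_left _ _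
  rw [partition_val, indSum_append, unifPart_indSum _ _ hab (h.pieceCount_pos hs hs' hy0 hy1),
    bands_indSum _ _ _ _ _ _ _ h.bandCount_pos hr.le le_rfl hp0 hp1]
  have hT2 : (2 : ℝ) ≤ P.T := by exact_mod_cast h.T
  have hfar : 1 ≤ (2 ^ (P.bandMax + 1) * 1 - 1) * P.rad sPrev := by
    have h1 := P.le_two_pow_bandMax (by have := h.T; omega)
    have h2 : (P.T : ℝ) ≤ 2 ^ (P.bandMax + 1) * 1 - 1 := by
      rw [pow_succ]; linarith
    have h3 : 1 / (P.T : ℝ) ≤ P.rad sPrev := by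
      have h4 : 1 / (P.T : ℝ) ≤ Real.sqrt (P.iota / sPrev) := by
        apply Real.le_sqrt_of_sq_le
        have := h.iota
        rw [div_pow, one_pow, div_le_div_iff₀ (by positivity) hs]
        nlinarith
      have h5 : 0 ≤ P.C / sPrev := div_nonneg h.C0 hs.le
      unfold Params.rad
      linarith
    calc (1 : ℝ) = P.T * (1 / P.T) := by field_simp
      _ ≤ _ := by
        gcongr
        linarith
  set z := (2 ^ (P.bandMax + 1) * 1 - 1) * P.rad sPrev
  unfold Cell.ind Cell.Has
  simp only [if_true, sub_self, zero_mul, sub_zero, add_zero]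
  rcases lt_or_ge p (P.left sPrev y) with h1 | h1
  · have h2 : ¬ (P.left sPrev y ≤ p) := not_le.mpr h1
    have h3 : P.left sPrev y - z ≤ p := by linarith
    have h4 : ¬ (P.right sPrev y < p) := by linarith
    simp [h1, h2, h3, h4]
  · have h2 : ¬ (p < P.left sPrev y) := not_lt.mpr h1
    rcases lt_or_ge (P.right sPrev y) p with h3 | h3
    · have h4 : ¬ (p ≤ P.right sPrev y) := not_le.mpr h3
      have h5 : p ≤ P.right sPrev y + z := by linarith
      simp [h1, h2, h3, h4, h5]
    · have h4 : ¬ (P.right sPrev y < p) := not_lt.mpr h3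
      simp [h1, h2, h3, h4]

/-- When the intervals are disjoint, sums over the interval that contains `p` are sums against
indicators. -/
theorem sum_ind_of_locate (p : ℝ) (l : List Cell) (h : indSum l p = 1) (f : Cell → ℝ) :
    ∃ c ∈ l, c.Has p ∧ (locate p l).val = c.hi ∧ (l.map fun c => c.ind p * f c).sum = f c := by
  induction l with
  | nil => simp at h
  | cons c l ih =>
    simp only [locate, bind_val, ite_val, tick_val, List.map_cons, List.sum_cons]
    rw [indSum_cons] at h
    rcases Cell.ind_zero_or_one c p with ⟨h0, hc⟩ | ⟨h1, hc⟩
    · rw [h0, zero_add] at h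
      obtain ⟨c', h1, h2, h3, h4⟩ := ih h
      have hm := mt (c.mem_val p).mp hc
      exact ⟨c', by simp [h1], h2, by rw [if_neg hm, h3], by rw [h4, h0]; ring⟩
    · refine ⟨c, by simp, hc, by rw [if_pos ((c.mem_val p).mpr hc)], ?_⟩
      have hl : indSum l p = 0 := by linarith
      have hz : ∀ (l : List Cell), indSum l p = 0 → (l.map fun c => c.ind p * f c).sum = 0 := by
        intro l
        induction l with
        | nil => simp
        | cons d l ih =>
          intro h
          rw [indSum_cons] at h
          have h2 := Cell.ind_nonneg d p
          have h3 : 0 ≤ indSum l p := List.sum_nonneg (by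
            intro x hx
            rw [List.mem_map] at hx
            obtain ⟨c, _, rfl⟩ := hx
            exact Cell.ind_nonneg _ _)
          rw [List.map_cons, List.sum_cons, ih (by linarith)]
          have : d.ind p = 0 := by linarith
          rw [this]; ring
      rw [hz l hl, h1]; ring

/-! ## Invariants of the state -/

/-- Gain of the expert `(c, 1)` when the auxiliary prediction has law `D` and the outcome is `y`. -/
def cellGain (D : Mix) (y : ℝ) (c : Cell) : ℝ :=
  (1 - D.θ) * (D.u - y) * c.ind D.u + D.θ * (D.v - y) * c.ind D.v

/-- Probability of an interval. -/
def cellProb (D : Mix) (c : Cell) : ℝ := (1 - D.θ) * c.ind D.u + D.θ * c.ind D.v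

/-- Numerical value of an outcome. -/
def bit (y : Bool) : ℝ := if y then 1 else 0

theorem bit_nonneg (y : Bool) : 0 ≤ bit y := by cases y <;> simp [bit]
theorem bit_le_one (y : Bool) : bit y ≤ 1 := by cases y <;> simp [bit]

/-- A mixture of two points of the unit interval. -/
structure Mix.Ok (D : Mix) : Prop where
  t0 : 0 ≤ D.θ
  t1 : D.θ ≤ 1
  u0 : 0 ≤ D.u
  u1 : D.u ≤ 1
  v0 : 0 ≤ D.v
  v1 : D.v ≤ 1

theorem Mix.Ok.prob_le_one {D : Mix} (h : D.Ok) (c : Cell) : cellProb D c ≤ 1 := by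
  have := c.ind_le_one D.u; have := c.ind_le_one D.v; have := h.t0; have := h.t1
  unfold cellProb
  nlinarith

theorem Mix.Ok.abs_gain_le {D : Mix} (h : D.Ok) (y : Bool) (c : Cell) :
    |cellGain D (bit y) c| ≤ cellProb D c := by
  have h1 := c.ind_nonneg D.u; have h2 := c.ind_nonneg D.v; have := h.t0; have := h.t1
  have := bit_nonneg y; have := bit_le_one y
  have := h.u0; have := h.u1; have := h.v0; have := h.v1
  have h3 : 0 ≤ (1 - D.θ) * c.ind D.u := mul_nonneg (by linarith) h1
  have h4 : 0 ≤ D.θ * c.ind D.v := mul_nonneg (by linarith) h2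
  unfold cellGain cellProb
  rw [abs_le]
  constructor <;> nlinarith

/-- This turns the second-order regret bound into one in terms of the expected number of hits of the
interval. -/
theorem Mix.Ok.gain_sq_le {D : Mix} (h : D.Ok) (y : Bool) (c : Cell) :
    cellGain D (bit y) c ^ 2 ≤ cellProb D c := by
  have h1 := h.abs_gain_le y c
  have h2 := h.prob_le_one c
  rw [← sq_abs]
  nlinarith [abs_nonneg (cellGain D (bit y) c)]

theorem gain_eq (D : Mix) (y : ℝ) (a : Arm) : (gain D y a).val = a.sgn * cellGain D y a.cell := by
  rw [gain_val]; rfl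

/-- Invariants of the experts. -/
structure ArmsOk (s : State) {d : ℕ} (A : Fin d → Arm) : Prop where
  arms : s.arms = List.ofFn A
  dim : d = 2 * s.cells.length
  floor_le : ∀ i, s.floor ≤ (A i).w
  V0 : ∀ i, 0 ≤ (A i).V
  sgn : ∀ i, (A i).sgn = 1 ∨ (A i).sgn = -1
  sum1 : 1 ≤ ∑ i, (A i).w
  sum2 : ∑ i, (A i).w ≤ 1 + (1 / 2) ^ s.m
  expert : ∀ c ∈ s.cells, ∀ σ : ℝ, (σ = 1 ∨ σ = -1) → ∃ i, (A i).cell = c ∧ (A i).sgn = σ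

/-- Invariants of a state after the first epoch. -/
structure EpochInv (P : Params) (s : State) : Prop where
  hm : 2 ≤ s.m
  len : s.len = 2 ^ s.m
  idx : s.idx < s.len
  ones0 : 0 ≤ s.ones
  ones1 : s.ones ≤ s.idx
  cells : ∃ y, 0 ≤ y ∧ y ≤ 1 ∧ s.cells = (partition P (2 ^ (s.m - 1)) (2 ^ s.m) y).val
  floor : s.floor = 1 / (2 * s.cells.length * 2 ^ s.m)
  logDim : s.logDim = Real.log (2 * s.cells.length * 2 ^ s.m)
  armsOk : ∃ (d : ℕ) (A : Fin d → Arm), ArmsOk s A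

/-- Invariants of a state in the first epoch. -/
structure FirstInv (s : State) : Prop where
  hm : s.m = 1
  len : s.len = 2 ^ s.m
  idx : s.idx < s.len
  ones0 : 0 ≤ s.ones
  ones1 : s.ones ≤ s.idx

/-- Invariants of a state. -/
def StateInv (P : Params) (s : State) : Prop := FirstInv s ∨ EpochInv P s

theorem start_inv (P : Params) : StateInv P start :=
  Or.inl ⟨rfl, rfl, by simp [start], by simp [start], by simp [start]⟩

theorem StateInv.len {P : Params} {s : State} (h : StateInv P s) : s.len = 2 ^ s.m :=
  h.elim FirstInv.len EpochInv.len
theorem StateInv.idx {P : Params} {s : State} (h : StateInv P s) : s.idx < s.len :=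
  h.elim FirstInv.idx EpochInv.idx
theorem StateInv.ones0 {P : Params} {s : State} (h : StateInv P s) : 0 ≤ s.ones :=
  h.elim FirstInv.ones0 EpochInv.ones0
theorem StateInv.ones1 {P : Params} {s : State} (h : StateInv P s) : s.ones ≤ s.idx :=
  h.elim FirstInv.ones1 EpochInv.ones1
theorem StateInv.one_le {P : Params} {s : State} (h : StateInv P s) : 1 ≤ s.m :=
  h.elim (fun h => h.hm.ge) (fun h => by have := h.hm; omega)

theorem EpochInv.cells_pos {P : Params} {s : State} (h : EpochInv P s) (hP : P.Ok) :
    0 < s.cells.length := by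
  obtain ⟨y, h0, h1, h2⟩ := h.cells
  rw [h2, partition_val, List.length_append, unifPart, pieces_length]
  have := hP.pieceCount_pos (sPrev := 2 ^ (s.m - 1)) (s := 2 ^ s.m) (by positivity)
    (by positivity) h0 h1
  omega

theorem EpochInv.dim_ge {P : Params} {s : State} (h : EpochInv P s) (hP : P.Ok) :
    (8 : ℝ) ≤ 2 * s.cells.length * 2 ^ s.m := by
  have h1 : (1 : ℝ) ≤ s.cells.length := by exact_mod_cast h.cells_pos hP
  have h2 : (4 : ℝ) ≤ 2 ^ s.m := by
    calc (4 : ℝ) = 2 ^ 2 := by norm_num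
      _ ≤ 2 ^ s.m := pow_le_pow_right₀ (by norm_num) h.hm
  nlinarith

theorem EpochInv.logDim_ge {P : Params} {s : State} (h : EpochInv P s) (hP : P.Ok) :
    2 ≤ s.logDim := by
  have h1 := h.dim_ge hP
  rw [h.logDim, Real.le_log_iff_exp_le (by linarith)]
  have h2 : Real.exp 2 = Real.exp 1 * Real.exp 1 := by rw [← Real.exp_add]; norm_num
  have := Real.exp_one_lt_d9
  have := Real.exp_pos 1
  nlinarith

theorem EpochInv.floor_pos {P : Params} {s : State} (h : EpochInv P s) (hP : P.Ok) :
    0 < s.floor := by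
  have h1 := h.dim_ge hP
  rw [h.floor]
  positivity

theorem EpochInv.log_floor {P : Params} {s : State} (h : EpochInv P s) :
    Real.log s.floor = -s.logDim := by
  rw [h.floor, h.logDim, one_div, Real.log_inv]

theorem ArmsOk.Phi_val {s : State} {d : ℕ} {A : Fin d → Arm} (h : ArmsOk s A) (p : ℝ) :
    (Phi s.arms p).val = ∑ i, (A i).w * (A i).sgn * (A i).cell.ind p := by
  rw [Calib.Phi_val, h.arms, List.map_ofFn, List.sum_ofFn]
  rfl

/-- The bound is 2 rather than 1 because inexact mirror steps let the weights sum to slightly more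
than 1. -/
theorem ArmsOk.abs_Phi_le {s : State} {d : ℕ} {A : Fin d → Arm} (h : ArmsOk s A) (hf : 0 < s.floor)
    (p : ℝ) : |(Phi s.arms p).val| ≤ 2 := by
  rw [h.Phi_val]
  refine (Finset.abs_sum_le_sum_abs _ _).trans ?_
  have h1 : ∑ i, |(A i).w * (A i).sgn * (A i).cell.ind p| ≤ ∑ i, (A i).w := by
    refine Finset.sum_le_sum fun i _ => ?_
    have hw : 0 < (A i).w := hf.trans_le (h.floor_le i)
    have hi := (A i).cell.ind_le_one p
    have h0 := (A i).cell.ind_nonneg p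
    rw [abs_mul, abs_mul, abs_of_pos hw, abs_of_nonneg h0]
    have : |(A i).sgn| = 1 := by rcases h.sgn i with h | h <;> rw [h] <;> simp
    rw [this]
    nlinarith
  have h2 : ((1 : ℝ) / 2) ^ s.m ≤ 1 := pow_le_one₀ (by norm_num) (by norm_num)
  linarith [h.sum2]

theorem mix_first (R : Routines) (P : Params) {s : State} (h : s.m ≤ 1) :
    s.mix R P = ⟨P.init s.idx, P.init s.idx, 0⟩ := by
  simp [State.mix, mixture, h]

/-- Weighting each point by the absolute value of `Φ` at the other one makes the mean of `Φ` zero,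
since the signs are opposite. Only the offset `1 / H` between the two grid points contributes. -/
theorem crossing_cancel (x y u H z : ℝ) (hxy : x * y ≤ 0) (hH : 0 < H) (hy : |y| ≤ 2) :
    (1 - |x| / (|x| + |y|)) * (u - z) * x + |x| / (|x| + |y|) * (u + 1 / H - z) * y ≤ 2 / H := by
  have hx0 := abs_nonneg x
  have hy0 := abs_nonneg y
  by_cases h0 : |x| + |y| = 0
  · have h1 : x = 0 := abs_eq_zero.mp (by linarith)
    have h2 : y = 0 := abs_eq_zero.mp (by linarith)
    rw [h1, h2]; simp; positivity
  · have hs : 0 < |x| + |y| := lt_of_le_of_ne (by positivity) (Ne.symm h0)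
    have hc : |y| * x + |x| * y = 0 := by
      rcases le_total 0 x with hx | hx <;> rcases le_total 0 y with hy' | hy'
      · rw [abs_of_nonneg hx, abs_of_nonneg hy']
        nlinarith [mul_nonneg hx hy']
      · rw [abs_of_nonneg hx, abs_of_nonpos hy']; ring
      · rw [abs_of_nonpos hx, abs_of_nonneg hy']; ring
      · rw [abs_of_nonpos hx, abs_of_nonpos hy']
        nlinarith [mul_nonneg_of_nonpos_of_nonpos hx hy']
    set t := |x| / (|x| + |y|) with ht
    have ht0 : 0 ≤ t := by positivity
    have ht1 : t ≤ 1 := by rw [ht, div_le_one hs]; linarith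
    have h1 : (1 - t) * x + t * y = 0 := by
      rw [ht]; field_simp; linarith
    have h2 : (1 - t) * (u - z) * x + t * (u + 1 / H - z) * y
        = (u - z) * ((1 - t) * x + t * y) + t * y * (1 / H) := by ring
    rw [h2, h1, mul_zero, zero_add]
    have h3 : t * y ≤ 2 := by
      have := le_abs_self y
      nlinarith
    calc t * y * (1 / H) ≤ 2 * (1 / H) := by gcongr
      _ = 2 / H := by ring

/-- The weighted gain is the mean of `Φ(p) (p - y)`. At `p = 0` with `Φ(0) > 0` it is `-y Φ(0) ≤ 0`;
at `p = 1` with `Φ(1) ≤ 0` it is `(1 - y) Φ(1) ≤ 0`; otherwise a sign change on the grid exists and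
`crossing_cancel` applies. The bound holds for both outcomes, hence without any assumption on the
means. -/
theorem mix_spec (R : Routines) (hR : R.Good) (P : Params) (hP : P.Ok) {s : State}
    (h : EpochInv P s) {d : ℕ} {A : Fin d → Arm} (hA : ArmsOk s A) :
    (s.mix R P).Ok ∧ ∀ y, ∑ i, (A i).w * ((A i).sgn * cellGain (s.mix R P) (bit y) (A i).cell)
      ≤ 2 / 2 ^ s.m := by
  have hf := h.floor_pos hP
  have hsplit : ∀ (D : Mix) (y : ℝ),
      ∑ i, (A i).w * ((A i).sgn * cellGain D y (A i).cell) =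
      (1 - D.θ) * (D.u - y) * (Phi s.arms D.u).val + D.θ * (D.v - y) * (Phi s.arms D.v).val := by
    intro D y
    rw [hA.Phi_val, hA.Phi_val, Finset.mul_sum, Finset.mul_sum, ← Finset.sum_add_distrib]
    refine Finset.sum_congr rfl fun i _ => ?_
    unfold cellGain; ring
  simp only [hsplit]
  have hm : ¬ (s.m ≤ 1) := by have := h.hm; omega
  have hpos : (0 : ℝ) ≤ 2 / 2 ^ s.m := by positivity
  have hmix : s.mix R P = if 0 < (Phi s.arms 0).val then ⟨0, 0, 0⟩ else
      if (Phi s.arms 1).val ≤ 0 then ⟨1, 1, 0⟩ else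
      let i := (R.crossing s.len (fun j => do Phi s.arms (← divR (← castN j) s.len))).val
      ⟨(i : ℝ) / s.len, ((i + 1 : ℕ) : ℝ) / s.len, |(Phi s.arms ((i : ℝ) / s.len)).val| /
        (|(Phi s.arms ((i : ℝ) / s.len)).val| + |(Phi s.arms (((i + 1 : ℕ) : ℝ) / s.len)).val|)⟩ := by
    simp only [State.mix, mixture, bind_val, leN_val, hm, decide_false, Bool.false_eq_true,
      if_false, ltR_val, leR_val, ite_val, tick_val, decide_eq_true_eq, castN_val, divR_val,
      addN_val, absR_val, addR_val]
  rw [hmix]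
  split
  · rename_i h0
    refine ⟨⟨by simp, by simp, by simp, by simp, by simp, by simp⟩, fun y => ?_⟩
    simp only [sub_zero, one_mul, zero_mul, add_zero, zero_sub]
    have := bit_nonneg y
    nlinarith
  · split
    · rename_i h1
      refine ⟨⟨by simp, by simp, by simp, by simp, by simp, by simp⟩, fun y => ?_⟩
      simp only [sub_zero, one_mul, zero_mul, add_zero]
      have := bit_le_one y
      nlinarith
    · rename_i h0 h1
      have hlen : 0 < s.len := by rw [h.len]; positivity
      have hlen' : (0 : ℝ) < s.len := by exact_mod_cast hlen
      obtain ⟨hi, hcr⟩ := hR.crossing s.len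
        (fun j => do Phi s.arms (← divR (← castN j) s.len)) hlen
        (by simp only [bind_val, castN_val, divR_val, Nat.cast_zero, zero_div]; exact not_lt.mp h0)
        (by
          simp only [bind_val, castN_val, divR_val]
          rw [div_self hlen'.ne']; exact not_le.mp h1)
      set i := (R.crossing s.len (fun j => do Phi s.arms (← divR (← castN j) s.len))).val
      simp only [bind_val, castN_val, divR_val] at hcr
      have hi1 : ((i + 1 : ℕ) : ℝ) ≤ s.len := by exact_mod_cast hi
      have hi0 : (i : ℝ) ≤ s.len := by push_cast at hi1; linarith
      refine ⟨⟨by positivity, ?_, by positivity, ?_, by positivity, ?_⟩, fun y => ?_⟩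
      · exact div_le_one_of_le₀ (by linarith [abs_nonneg (Phi s.arms (((i + 1 : ℕ) : ℝ) / s.len)).val])
          (by positivity)
      · exact (div_le_one hlen').mpr hi0
      · exact (div_le_one hlen').mpr hi1
      · have hv : ((i + 1 : ℕ) : ℝ) / s.len = (i : ℝ) / s.len + 1 / s.len := by
          push_cast; ring
        have hlen2 : (s.len : ℝ) = 2 ^ s.m := by rw [h.len]; push_cast; rfl
        have := crossing_cancel _ _ ((i : ℝ) / s.len) s.len (bit y) hcr hlen'
          (hA.abs_Phi_le hf _)
        rw [← hlen2]
        dsimp only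
        rw [hv] at this ⊢
        exact this

theorem StateInv.mix_ok {R : Routines} (hR : R.Good) {P : Params} (hP : P.Ok) {s : State}
    (h : StateInv P s) : (s.mix R P).Ok := by
  rcases h with h | h
  · rw [mix_first R P h.hm.le]
    exact ⟨le_rfl, zero_le_one, (hP.init _).1, (hP.init _).2, (hP.init _).1, (hP.init _).2⟩
  · obtain ⟨d, A, hA⟩ := h.armsOk
    exact (mix_spec R hR P hP h hA).1

/-- The lists of the program become vectors indexed by the experts, to which `Routines.Good`
applies. The corrected losses are at most `1 + 32/64 = 3/2` in absolute value. -/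
theorem learn_spec (R : Routines) (hR : R.Good) (P : Params) (hP : P.Ok) {s : State}
    (h : EpochInv P s) {d : ℕ} {A : Fin d → Arm} (hA : ArmsOk s A) {D : Mix} (hD : D.Ok) (y : Bool) :
    ∃ v : Fin d → ℝ, (learn R s D (bit y)).val = (List.ofFn fun i => (⟨(A i).cell, (A i).sgn, v i,
        (A i).V + cellGain D (bit y) (A i).cell ^ 2⟩ : Arm)) ∧
      (∀ i, s.floor ≤ v i) ∧ 1 ≤ ∑ i, v i ∧ ∑ i, v i ≤ 1 + (1 / 2) ^ s.m ∧
      ∀ u : Fin d → ℝ, (∀ i, s.floor ≤ u i) → ∑ i, u i = 1 →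
        -(2 * (1 / 2) ^ s.m) ≤ ∑ i, (Real.log (v i / (A i).w) / rate s.logDim (A i).V +
          (32 * rate s.logDim (A i).V * ((A i).sgn * cellGain D (bit y) (A i).cell) ^ 2
            - (A i).sgn * cellGain D (bit y) (A i).cell)) * (u i - v i) := by
  have hf := h.floor_pos hP
  have hc := h.cells_pos hP
  have hd : 0 < d := by rw [hA.dim]; omega
  set g : Fin d → ℝ := fun i => (A i).sgn * cellGain D (bit y) (A i).cell with hg
  have hg1 : ∀ i, |g i| ≤ 1 := by
    intro i
    have : |(A i).sgn| = 1 := by rcases hA.sgn i with h | h <;> rw [h] <;> simp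
    rw [hg]
    simp only
    rw [abs_mul, this, one_mul]
    exact (hD.abs_gain_le y _).trans (hD.prob_le_one _)
  set it : Fin d → Item := fun i => ⟨(A i).w, rate s.logDim (A i).V,
    32 * rate s.logDim (A i).V * (g i * g i) - g i⟩ with hit
  obtain ⟨v, h1, h2, h3, h4, h5⟩ := hR.mirror s.m d s.floor it hd hf (by
      rw [h.floor, hA.dim]
      push_cast
      have := h.dim_ge hP
      have h2 : (1 : ℝ) ≤ 2 ^ s.m := one_le_pow₀ (by norm_num)
      have h3 : (0 : ℝ) < s.cells.length := by exact_mod_cast hc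
      rw [one_div_mul_eq_div, div_le_one (by positivity)]
      nlinarith) (by
      intro i
      refine ⟨hA.floor_le i, rate_pos _ _, rate_le _ _, ?_⟩
      have h1 := rate_pos s.logDim (A i).V
      have h2 := rate_le s.logDim (A i).V
      obtain ⟨h3, h4⟩ := abs_le.mp (hg1 i)
      have h5 : g i * g i ≤ 1 := by nlinarith
      have h6 : 0 ≤ g i * g i := mul_self_nonneg _
      have h7 : rate s.logDim (A i).V * (g i * g i) ≤ 1 / 64 * 1 := by gcongr
      have h8 : 0 ≤ rate s.logDim (A i).V * (g i * g i) := by positivity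
      rw [abs_le]
      simp only [hit]
      constructor <;> nlinarith) hA.sum1 hA.sum2
  refine ⟨v, ?_, h2, h3, h4, ?_⟩
  · have hitems : (List.ofFn A).map (fun a => (toItem s.logDim (a, (gain D (bit y) a).val)).val)
        = List.ofFn it := by
      rw [List.map_ofFn]
      congr 1
      funext i
      simp only [Function.comp, toItem_val, gain_eq, hit, hg, rate]
    simp only [learn, bind_val, forEach_val, reweigh_val, tick_val, List.map_map, hA.arms,
      Function.comp_def]
    rw [hitems, h1, List.map_ofFn, zipWith_ofFn]
    congr 1
    funext i
    simp only [Function.comp, gain_eq]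
    have : (A i).sgn * (A i).sgn = 1 := by rcases hA.sgn i with h | h <;> rw [h] <;> norm_num
    congr 2
    linear_combination (cellGain D (bit y) (A i).cell) ^ 2 * this
  · intro u hu hus
    have := h5 u hu hus
    simpa only [hit, sq] using this

theorem update_eq (R : Routines) (P : Params) (s : State) (y : Bool) :
    s.next R P y = if s.idx + 1 = s.len then (newEpoch P s.m s.len (s.ones + bit y)).val
      else ⟨s.m, s.len, s.idx + 1, s.ones + bit y, s.cells, s.floor, s.logDim,
        if s.m ≤ 1 then [] else (learn R s (s.mix R P) (bit y)).val⟩ := by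
  simp only [State.next, update, bind_val, leN_val, ite_val, tick_val, addR_val, addN_val, eqN_val,
    decide_eq_true_eq, bit]
  by_cases h1 : s.m ≤ 1 <;> simp [h1]

theorem newEpoch_val (P : Params) (m len : ℕ) (ones : ℝ) :
    (newEpoch P m len ones).val =
      let cells := (partition P len ((2 * len : ℕ) : ℝ) (ones / len)).val
      ⟨m + 1, 2 * len, 0, 0, cells, 1 / (2 * cells.length * ((2 * len : ℕ) : ℝ)),
        Real.log (2 * cells.length * ((2 * len : ℕ) : ℝ)),
        (cells.map fun c => ⟨c, 1, 1 / (2 * cells.length), 0⟩) ++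
        (cells.map fun c => ⟨c, -1, 1 / (2 * cells.length), 0⟩)⟩ := by
  have hcount : ∀ (l : List Cell) (b : ℝ), l.foldl (fun n _ => n + 1) b = b + l.length := by
    intro l
    induction l with
    | nil => simp
    | cons c l ih => intro b; simp [ih]; ring
  simp only [newEpoch, bind_val, addN_val, mulN_val, castN_val, divR_val, loop_val, addR_val,
    hcount, mulR_val, zero_add, logR_val, forEach_val, append_val, tick_val]

/-- The state at the beginning of an epoch. -/
structure Fresh (P : Params) (s : State) (y : ℝ) : Prop where
  inv : EpochInv P s
  idx : s.idx = 0
  y0 : 0 ≤ y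
  y1 : y ≤ 1
  cells : s.cells = (partition P (2 ^ (s.m - 1)) (2 ^ s.m) y).val
  arms : ∃ (d : ℕ) (A : Fin d → Arm), ArmsOk s A ∧ ∀ i, (A i).w = 1 / d ∧ (A i).V = 0

theorem newEpoch_fresh (P : Params) (hP : P.Ok) (m len : ℕ) (ones : ℝ) (hm : 1 ≤ m)
    (hlen : len = 2 ^ m) (h0 : 0 ≤ ones) (h1 : ones ≤ len) :
    Fresh P (newEpoch P m len ones).val (ones / len) := by
  have hlen' : (0 : ℝ) < len := by rw [hlen]; positivity
  have hy0 : 0 ≤ ones / len := by positivity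
  have hy1 : ones / len ≤ 1 := (div_le_one hlen').mpr h1
  have hc2 : ((2 * len : ℕ) : ℝ) = 2 ^ (m + 1) := by rw [hlen]; push_cast; ring
  have hc1 : (len : ℝ) = 2 ^ m := by rw [hlen]; push_cast; ring
  rw [newEpoch_val]
  set cells := (partition P len ((2 * len : ℕ) : ℝ) (ones / len)).val with hcells
  have hcells' : cells = (partition P (2 ^ (m + 1 - 1)) (2 ^ (m + 1)) (ones / len)).val := by
    rw [hcells, hc2, Nat.add_sub_cancel]
    congr 2
  have hpos : 0 < cells.length := by
    rw [hcells, partition_val, List.length_append, unifPart, pieces_length]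
    have := hP.pieceCount_pos (sPrev := len) (s := ((2 * len : ℕ) : ℝ)) hlen'
      (by push_cast; positivity) hy0 hy1
    omega
  have hpos' : (0 : ℝ) < cells.length := by exact_mod_cast hpos
  set arms : List Arm := (cells.map fun c => ⟨c, 1, 1 / (2 * cells.length), 0⟩) ++
        (cells.map fun c => ⟨c, -1, 1 / (2 * cells.length), 0⟩) with harms
  have hal : arms.length = 2 * cells.length := by simp [harms]; omega
  have hprop : ∀ a ∈ arms, a.w = 1 / (2 * cells.length) ∧ a.V = 0 ∧ (a.sgn = 1 ∨ a.sgn = -1) := by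
    intro a ha
    rw [harms, List.mem_append, List.mem_map, List.mem_map] at ha
    rcases ha with ⟨c, _, rfl⟩ | ⟨c, _, rfl⟩ <;> simp
  have hprop' : ∀ i, arms.get i ∈ arms := fun i => List.get_mem _ _
  simp only
  have hok : ArmsOk ⟨m + 1, 2 * len, 0, 0, cells, 1 / (2 * cells.length * ((2 * len : ℕ) : ℝ)),
        Real.log (2 * cells.length * ((2 * len : ℕ) : ℝ)), arms⟩ arms.get := by
    have hw : ∑ i, (arms.get i).w = 1 := by
      rw [Finset.sum_congr rfl fun i _ => (hprop _ (hprop' i)).1, Finset.sum_const,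
        Finset.card_univ, Fintype.card_fin, hal]
      simp only [nsmul_eq_mul]
      push_cast
      field_simp
    refine ⟨(List.ofFn_get _).symm, hal, ?_, ?_, ?_, hw.ge, ?_, ?_⟩
    · intro i
      rw [(hprop _ (hprop' i)).1]
      simp only
      apply one_div_le_one_div_of_le (by positivity)
      rw [hc2]
      have : (1 : ℝ) ≤ 2 ^ (m + 1) := one_le_pow₀ (by norm_num)
      nlinarith
    · intro i; rw [(hprop _ (hprop' i)).2.1]
    · intro i; exact (hprop _ (hprop' i)).2.2
    · rw [hw]
      have : (0 : ℝ) < (1 / 2) ^ (m + 1) := by positivity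
      linarith
    · intro c hc σ hσ
      have : (⟨c, σ, 1 / (2 * cells.length), 0⟩ : Arm) ∈ arms := by
        rw [harms, List.mem_append, List.mem_map, List.mem_map]
        rcases hσ with rfl | rfl
        · exact Or.inl ⟨c, hc, rfl⟩
        · exact Or.inr ⟨c, hc, rfl⟩
      obtain ⟨i, hi⟩ := List.get_of_mem this
      exact ⟨i, by rw [hi], by rw [hi]⟩
  refine ⟨⟨by simp only; omega, ?_, ?_, le_rfl, by simp, ⟨_, hy0, hy1, hcells'⟩, ?_, ?_,
    ⟨_, _, hok⟩⟩, rfl, hy0, hy1, hcells', ⟨_, _, hok, ?_⟩⟩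
  · simp only; rw [hlen]; ring
  · simp only; rw [hlen]; positivity
  · simp only; rw [hc2]
  · simp only; rw [hc2]
  · intro i
    rw [(hprop _ (hprop' i)).1, (hprop _ (hprop' i)).2.1, hal]
    push_cast
    exact ⟨rfl, rfl⟩

theorem next_fresh (R : Routines) (P : Params) (hP : P.Ok) {s : State} (h : StateInv P s) (y : Bool)
    (hlast : s.idx + 1 = s.len) :
    Fresh P (s.next R P y) ((s.ones + bit y) / s.len) ∧ (s.next R P y).m = s.m + 1 := by
  rw [update_eq, if_pos hlast]
  have h1 := h.ones0; have h2 := h.ones1; have h3 := bit_nonneg y; have h4 := bit_le_one y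
  have h5 : (s.idx : ℝ) + 1 = s.len := by exact_mod_cast hlast
  refine ⟨newEpoch_fresh P hP _ _ _ h.one_le h.len (by linarith) (by linarith), ?_⟩
  rw [newEpoch_val]

theorem next_epoch (R : Routines) (P : Params) {s : State}
    (h : EpochInv P s) {d : ℕ} {A : Fin d → Arm} (hA : ArmsOk s A) (y : Bool)
    (hlast : s.idx + 1 ≠ s.len) (v : Fin d → ℝ)
    (hv : (learn R s (s.mix R P) (bit y)).val = (List.ofFn fun i => (⟨(A i).cell, (A i).sgn, v i,
        (A i).V + cellGain (s.mix R P) (bit y) (A i).cell ^ 2⟩ : Arm)))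
    (hvf : ∀ i, s.floor ≤ v i) (hv1 : 1 ≤ ∑ i, v i) (hv2 : ∑ i, v i ≤ 1 + (1 / 2) ^ s.m) :
    EpochInv P (s.next R P y) ∧ (s.next R P y).m = s.m ∧ (s.next R P y).idx = s.idx + 1 ∧
    (s.next R P y).len = s.len ∧ (s.next R P y).cells = s.cells ∧
    (s.next R P y).floor = s.floor ∧ (s.next R P y).logDim = s.logDim ∧
    ArmsOk (s.next R P y) (fun i => (⟨(A i).cell, (A i).sgn, v i,
        (A i).V + cellGain (s.mix R P) (bit y) (A i).cell ^ 2⟩ : Arm)) := by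
  have hm : ¬ (s.m ≤ 1) := by have := h.hm; omega
  rw [update_eq, if_neg hlast, if_neg hm, hv]
  have hok : ArmsOk ⟨s.m, s.len, s.idx + 1, s.ones + bit y, s.cells, s.floor, s.logDim,
      List.ofFn fun i => (⟨(A i).cell, (A i).sgn, v i,
        (A i).V + cellGain (s.mix R P) (bit y) (A i).cell ^ 2⟩ : Arm)⟩
      (fun i => (⟨(A i).cell, (A i).sgn, v i,
        (A i).V + cellGain (s.mix R P) (bit y) (A i).cell ^ 2⟩ : Arm)) :=
    ⟨rfl, hA.dim, hvf, fun i => by have := hA.V0 i; positivity, hA.sgn, hv1, hv2, hA.expert⟩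
  have h3 := bit_nonneg y; have h4 := bit_le_one y; have h5 := h.idx
  exact ⟨⟨h.hm, h.len, by simp only; omega, by have := h.ones0; simp only; linarith,
    by have := h.ones1; simp only; push_cast; linarith, h.cells, h.floor, h.logDim, ⟨_, _, hok⟩⟩,
    rfl, rfl, rfl, rfl, rfl, rfl, hok⟩

theorem StateInv.next {R : Routines} (hR : R.Good) {P : Params} (hP : P.Ok) {s : State}
    (h : StateInv P s) (y : Bool) : StateInv P (s.next R P y) := by
  by_cases hlast : s.idx + 1 = s.len
  · exact Or.inr (next_fresh R P hP h y hlast).1.inv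
  · rcases h with h | h
    · left
      have hm : s.m ≤ 1 := h.hm.le
      rw [update_eq, if_neg hlast, if_pos hm]
      have h3 := bit_nonneg y; have h4 := bit_le_one y; have h5 := h.idx
      exact ⟨h.hm, h.len, by simp only; omega, by have := h.ones0; simp only; linarith,
        by have := h.ones1; simp only; push_cast; linarith⟩
    · right
      obtain ⟨d, A, hA⟩ := h.armsOk
      obtain ⟨v, h1, h2, h3, h4, _⟩ := learn_spec R hR P hP h hA (mix_spec R hR P hP h hA).1 y
      exact (next_epoch R P h hA y hlast v h1 h2 h3 h4).1

/-! ## The regret in an epoch -/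

/-- Gain of the expert `(c, 1)` in a round. -/
def Step.gain (R : Routines) (P : Params) (st : Step) (c : Cell) : ℝ :=
  cellGain (st.s.mix R P) (bit st.y) c

/-- `regret_step` telescopes with the potential `∑ klTerm (u i) (w i) / η i`. Each round loses `2 /
2^m` through the forecaster's own gain and `2 / 2^m` through the inexact mirror step. The
second-order terms telescope as increments of `√(V + 1)`. -/
theorem regret_chain (R : Routines) (hR : R.Good) (P : Params) (hP : P.Ok) {d : ℕ} (u : Fin d → ℝ)
    (hu1 : ∀ i, u i ≤ 1) (hus : ∑ i, u i = 1) (qs : List ℝ) (s : State) (hs : EpochInv P s)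
    (A : Fin d → Arm) (hA : ArmsOk s A) (hu : ∀ i, s.floor ≤ u i) (l : List Step)
    (hl : Valid R P qs s l) (hlen : s.idx + l.length ≤ s.len) :
    (l.map fun st => ∑ i, u i * ((A i).sgn * st.gain R P (A i).cell)).sum ≤
      l.length * (4 / 2 ^ s.m) + ∑ i, klTerm (u i) (A i).w / rate s.logDim (A i).V +
      132 * Real.sqrt s.logDim * ∑ i, u i *
        (Real.sqrt ((A i).V + (l.map fun st => st.gain R P (A i).cell ^ 2).sum + 1)
          - Real.sqrt ((A i).V + 1)) := by
  induction qs generalizing s A l with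
  | nil =>
    have hl' : l = [] := hl
    subst hl'
    have : 0 ≤ ∑ i, klTerm (u i) (A i).w / rate s.logDim (A i).V :=
      Finset.sum_nonneg fun i _ => div_nonneg (klTerm_nonneg ((hs.floor_pos hP).trans_le (hu i))
        ((hs.floor_pos hP).trans_le (hA.floor_le i))) (rate_pos _ _).le
    simpa using this
  | cons q qs ih =>
    obtain ⟨st, l', rfl, hst, _, hl'⟩ := hl
    have hf := hs.floor_pos hP
    have hL := hs.logDim_ge hP
    obtain ⟨hD, hplay⟩ := mix_spec R hR P hP hs hA
    obtain ⟨v, hv0, hvf, hv1, hv2, hopt⟩ := learn_spec R hR P hP hs hA hD st.y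
    set x : Fin d → ℝ := fun i => cellGain (s.mix R P) (bit st.y) (A i).cell with hx
    have hgain : ∀ i, st.gain R P (A i).cell = x i := by intro i; rw [Step.gain, hst]
    set A' : Fin d → Arm := fun i => ⟨(A i).cell, (A i).sgn, v i, (A i).V + x i ^ 2⟩ with hA'
    have hx1 : ∀ i, |x i| ≤ 1 := fun i => (hD.abs_gain_le _ _).trans (hD.prob_le_one _)
    have hxsq : ∀ i, x i ^ 2 ≤ 1 := fun i => (sq_le_one_iff_abs_le_one _).mpr (hx1 i)
    have hsg : ∀ i, (A i).sgn ^ 2 = 1 := by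
      intro i; rcases hA.sgn i with h | h <;> rw [h] <;> norm_num
    have htail : (l'.map fun st => ∑ i, u i * ((A i).sgn * st.gain R P (A i).cell)).sum ≤
        l'.length * (4 / 2 ^ s.m) + ∑ i, klTerm (u i) (v i) / rate s.logDim ((A i).V + x i ^ 2) +
        132 * Real.sqrt s.logDim * ∑ i, u i *
        (Real.sqrt ((A i).V + x i ^ 2 + (l'.map fun st => st.gain R P (A i).cell ^ 2).sum + 1)
          - Real.sqrt ((A i).V + x i ^ 2 + 1)) := by
      -- After the last round of the epoch the state already belongs to the next epoch, where the
      -- induction hypothesis does not apply. No round is left then, and nonnegativity of the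
      -- potential suffices.
      by_cases hnil : l' = []
      · subst hnil
        have : 0 ≤ ∑ i, klTerm (u i) (v i) / rate s.logDim ((A i).V + x i ^ 2) :=
          Finset.sum_nonneg fun i _ => div_nonneg (klTerm_nonneg (hf.trans_le (hu i))
            (hf.trans_le (hvf i))) (rate_pos _ _).le
        simpa using this
      · have hpos : 0 < l'.length := List.length_pos_iff.mpr hnil
        rw [List.length_cons] at hlen
        obtain ⟨h1, h2, h3, h4, h5, h6, h7, h8⟩ :=
          next_epoch R P hs hA st.y (by omega) v hv0 hvf hv1 hv2
        have := ih _ h1 A' h8 (by rw [h6]; exact hu) l' hl' (by rw [h3, h4]; omega)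
        rw [h2, h7] at this
        exact this
    have hstep := regret_step u (fun i => (A i).w) v (fun i => (A i).sgn * x i)
      (fun i => rate s.logDim (A i).V) (fun i => rate s.logDim ((A i).V + x i ^ 2)) s.logDim
      (2 * (1 / 2) ^ s.m) hL (fun i => rate_pos _ _) (fun i => rate_le _ _)
      (fun i => by
        rw [abs_mul, ← Real.sqrt_sq_eq_abs, hsg, Real.sqrt_one, one_mul]; exact hx1 i)
      (fun i => hf.trans_le (hA.floor_le i)) (fun i => hf.trans_le (hvf i))
      (fun i => hf.trans_le (hu i)) hu1
      (fun i => by rw [← hs.log_floor]; exact Real.log_le_log hf (hvf i))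
      (fun i => by
        simp only [mul_pow, hsg, one_mul]
        exact one_div_rate_sub (by linarith) (hA.V0 i) (sq_nonneg _))
      (hopt u hu hus)
    -- `132 = 33 * 4`, with the 4 from `rate_mul_le`.
    have hrate : 33 * ∑ i, u i * rate s.logDim (A i).V * ((A i).sgn * x i) ^ 2 ≤
        132 * Real.sqrt s.logDim * ∑ i, u i * (Real.sqrt ((A i).V + x i ^ 2 + 1)
          - Real.sqrt ((A i).V + 1)) := by
      rw [Finset.mul_sum, Finset.mul_sum]
      refine Finset.sum_le_sum fun i _ => ?_
      have h1 := rate_mul_le hL (hA.V0 i) (sq_nonneg (x i)) (hxsq i)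
      have h2 : 0 ≤ u i := hf.le.trans (hu i)
      rw [mul_pow, hsg, one_mul]
      nlinarith
    have hp := hplay st.y
    rw [List.map_cons, List.sum_cons, List.length_cons]
    simp only [hgain, List.map_cons, List.sum_cons]
    have e1 : (2 : ℝ) * (1 / 2) ^ s.m = 2 / 2 ^ s.m := by rw [div_pow, one_pow]; ring
    have e2 : ((l'.length + 1 : ℕ) : ℝ) * (4 / 2 ^ s.m) =
        l'.length * (4 / 2 ^ s.m) + 2 / 2 ^ s.m + 2 / 2 ^ s.m := by push_cast; ring
    rw [e1] at hstep
    rw [e2]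
    have e3 : ∀ a b c : Fin d → ℝ, ∑ i, u i * (a i - b i) =
        ∑ i, u i * (a i - c i) + ∑ i, u i * (c i - b i) := by
      intro a b c
      rw [← Finset.sum_add_distrib]
      exact Finset.sum_congr rfl fun i _ => by ring
    rw [e3 _ _ (fun i => Real.sqrt ((A i).V + x i ^ 2 + 1))]
    simp only [← add_assoc]
    rw [mul_add]
    linarith

/-- The total gain of an expert in an epoch. -/
theorem regret_epoch (R : Routines) (hR : R.Good) (P : Params) (hP : P.Ok) (qs : List ℝ) (s : State)
    (y : ℝ) (hs : Fresh P s y) (l : List Step) (hl : Valid R P qs s l) (hlen : l.length ≤ s.len)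
    (hgain : ∀ st ∈ l, ∀ c, |st.gain R P c| ≤ 1) (c : Cell) (hc : c ∈ s.cells) :
    |(l.map fun st => st.gain R P c).sum| ≤
      266 * s.logDim + 176 * Real.sqrt s.logDim *
        Real.sqrt ((l.map fun st => st.gain R P c ^ 2).sum + 1) := by
  obtain ⟨d, A, hA, hA0⟩ := hs.arms
  have hL := hs.inv.logDim_ge hP
  have hdim := hA.dim
  have hcpos := hs.inv.cells_pos hP
  have hd2 : 2 ≤ d := by omega
  have hdpos : (0 : ℝ) < d := by exact_mod_cast (by omega : 0 < d)
  have hd2' : (2 : ℝ) ≤ d := by exact_mod_cast hd2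
  set H : ℝ := 2 ^ s.m with hH
  have hH4 : (4 : ℝ) ≤ H := by
    calc (4 : ℝ) = 2 ^ 2 := by norm_num
      _ ≤ 2 ^ s.m := pow_le_pow_right₀ (by norm_num) hs.inv.hm
  have hfloor : s.floor = 1 / (d * H) := by rw [hs.inv.floor, hdim]; push_cast; rfl
  have hlogDim : s.logDim = Real.log (d * H) := by rw [hs.inv.logDim, hdim]; push_cast; rfl
  have hlen' : (l.length : ℝ) ≤ H := by
    have : (s.len : ℝ) = H := by rw [hs.inv.len]; push_cast; rfl
    rw [← this]; exact_mod_cast hlen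
  have hG : ∀ c', (l.map fun st => st.gain R P c' ^ 2).sum ≤ H := by
    intro c'
    have := List.sum_le_card_nsmul (l.map fun st => st.gain R P c' ^ 2) 1 (by
      intro z hz
      rw [List.mem_map] at hz
      obtain ⟨st, hst, rfl⟩ := hz
      exact (sq_le_one_iff_abs_le_one _).mpr (hgain st hst c'))
    simp only [List.length_map, nsmul_eq_mul, mul_one] at this
    linarith
  have hG0 : ∀ c', 0 ≤ (l.map fun st => st.gain R P c' ^ 2).sum := by
    intro c'
    apply List.sum_nonneg
    intro z hz
    rw [List.mem_map] at hz
    obtain ⟨st, _, rfl⟩ := hz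
    positivity
  have key : ∀ σ : ℝ, (σ = 1 ∨ σ = -1) → σ * (l.map fun st => st.gain R P c).sum ≤
      266 * s.logDim + 176 * Real.sqrt s.logDim *
        Real.sqrt ((l.map fun st => st.gain R P c ^ 2).sum + 1) := by
    intro σ hσ
    obtain ⟨j, hj1, hj2⟩ := hA.expert c hc σ hσ
    set β : ℝ := 1 / (d * H) with hβ
    have hβ0 : 0 < β := by positivity
    have hdβ : d * β = 1 / H := by rw [hβ]; field_simp
    have hH1 : 1 / H ≤ 1 / 4 := one_div_le_one_div_of_le (by norm_num) hH4
    have hH0 : 0 < 1 / H := by positivity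
    have hβ1 : β ≤ 1 / H := by rw [← hdβ]; nlinarith
    -- The comparator must respect the floor `β = 1/(dH)`: it is the point mass at the expert `j`
    -- with a share `1/H = d β` spread uniformly.
    set u : Fin d → ℝ := fun i => (if i = j then 1 - 1 / H else 0) + β with hu
    have hu0 : ∀ i, β ≤ u i := by
      intro i; simp only [hu]; split <;> linarith
    have husum : ∀ f : Fin d → ℝ, ∑ i, u i * f i = (1 - 1 / H) * f j + β * ∑ i, f i := by
      intro f
      simp only [hu, add_mul, Finset.sum_add_distrib, ite_mul, zero_mul, Finset.sum_ite_eq',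
        Finset.mem_univ, if_true, ← Finset.mul_sum]
    have hus : ∑ i, u i = 1 := by
      have := husum fun _ => 1
      simp only [mul_one, Finset.sum_const, Finset.card_univ, Fintype.card_fin, nsmul_eq_mul] at this
      rw [this]; linarith
    have hu1 : ∀ i, u i ≤ 1 := by
      intro i; simp only [hu]; split <;> linarith
    have hreg := regret_chain R hR P hP u hu1 hus qs s hs.inv A hA
      (by rw [hfloor]; exact hu0) l hl (by rw [hs.idx, zero_add]; exact hlen)
    -- Since `H ≥ 4`, the expert `j` keeps weight at least 3/4, and the uniform share costs at most
    -- `1/H` per round. Dividing by 3/4 later turns 132 into 176.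
    have hleft : 3 / 4 * (σ * (l.map fun st => st.gain R P c).sum) - 1 ≤
        (l.map fun st => ∑ i, u i * ((A i).sgn * st.gain R P (A i).cell)).sum ∨
        σ * (l.map fun st => st.gain R P c).sum ≤ 0 := by
      by_cases hneg : σ * (l.map fun st => st.gain R P c).sum ≤ 0
      · exact Or.inr hneg
      left
      push Not at hneg
      have h1 : ∀ l' : List Step, (∀ st ∈ l', ∀ c, |st.gain R P c| ≤ 1) →
          (1 - 1 / H) * (σ * (l'.map fun st => st.gain R P c).sum) - l'.length * (1 / H) ≤
          (l'.map fun st => ∑ i, u i * ((A i).sgn * st.gain R P (A i).cell)).sum := by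
        intro l'
        induction l' with
        | nil => intro _; simp
        | cons st l' ih =>
          intro hb
          have ih' := ih fun st hst => hb st (by simp [hst])
          rw [List.map_cons, List.map_cons, List.sum_cons, List.sum_cons, List.length_cons, husum,
            hj1, hj2]
          have h2 : -(d : ℝ) ≤ ∑ i, (A i).sgn * st.gain R P (A i).cell := by
            have : ∑ i : Fin d, (-1 : ℝ) ≤ ∑ i, (A i).sgn * st.gain R P (A i).cell := by
              refine Finset.sum_le_sum fun i _ => ?_
              obtain ⟨h3, h4⟩ := abs_le.mp (hb st (by simp) (A i).cell)
              rcases hA.sgn i with h | h <;> rw [h] <;> linarith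
            simpa using this
          have h3 : -(1 / H) ≤ β * ∑ i, (A i).sgn * st.gain R P (A i).cell := by
            rw [← hdβ]; nlinarith
          push_cast
          linarith
      have h2 := h1 l hgain
      have h3 : (l.length : ℝ) * (1 / H) ≤ 1 := by
        rw [mul_one_div, div_le_one (by positivity)]; exact hlen'
      nlinarith
    -- All initial rates are 1/64, and `log (u d) ≤ log (d H)`.
    have hkl : ∑ i, klTerm (u i) (A i).w / rate s.logDim (A i).V ≤ 64 * s.logDim := by
      have h1 : ∀ i, klTerm (u i) (A i).w / rate s.logDim (A i).V ≤
          64 * (u i * s.logDim - u i + 1 / d) := by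
        intro i
        rw [(hA0 i).1, (hA0 i).2]
        have h2 : 1 / rate s.logDim 0 = 64 := by
          rw [one_div_rate, zero_div, Real.sqrt_zero, max_eq_left (by norm_num)]
        rw [div_eq_mul_one_div, h2, mul_comm]
        have h3 : Real.log (u i / (1 / d)) ≤ s.logDim := by
          rw [hlogDim]
          have hui : 0 < u i := hβ0.trans_le (hu0 i)
          apply Real.log_le_log (by positivity)
          rw [div_div_eq_mul_div, div_one]
          have := hu1 i
          nlinarith
        have h4 : 0 ≤ u i := hβ0.le.trans (hu0 i)
        unfold klTerm
        nlinarith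
      refine (Finset.sum_le_sum fun i _ => h1 i).trans (le_of_eq ?_)
      rw [← Finset.mul_sum, Finset.sum_add_distrib, Finset.sum_sub_distrib, ← Finset.sum_mul, hus,
        Finset.sum_const, Finset.card_univ, Fintype.card_fin, nsmul_eq_mul]
      field_simp
      ring
    have hsq : ∑ i, u i * (Real.sqrt ((A i).V + (l.map fun st =>
        st.gain R P (A i).cell ^ 2).sum + 1) - Real.sqrt ((A i).V + 1)) ≤
        Real.sqrt ((l.map fun st => st.gain R P c ^ 2).sum + 1) + 1 := by
      simp only [(hA0 _).2, zero_add, Real.sqrt_one]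
      rw [husum, hj1]
      have h1 : ∑ i, (Real.sqrt ((l.map fun st => st.gain R P (A i).cell ^ 2).sum + 1) - 1) ≤
          d * H := by
        have : ∑ i : Fin d, (Real.sqrt ((l.map fun st => st.gain R P (A i).cell ^ 2).sum + 1) - 1)
            ≤ ∑ i : Fin d, H := by
          refine Finset.sum_le_sum fun i _ => ?_
          have : Real.sqrt ((l.map fun st => st.gain R P (A i).cell ^ 2).sum + 1) ≤ H + 1 := by
            rw [Real.sqrt_le_left (by linarith)]
            have := hG (A i).cell
            nlinarith
          linarith
        simpa using this
      have h2 : β * (d * H) = 1 := by rw [hβ]; field_simp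
      have h3 : β * ∑ i, (Real.sqrt ((l.map fun st => st.gain R P (A i).cell ^ 2).sum + 1) - 1) ≤
          1 := (mul_le_mul_of_nonneg_left h1 hβ0.le).trans h2.le
      have h4 := Real.sqrt_nonneg ((l.map fun st => st.gain R P c ^ 2).sum + 1)
      have h5 : 1 ≤ Real.sqrt ((l.map fun st => st.gain R P c ^ 2).sum + 1) := by
        rw [Real.one_le_sqrt]; linarith [hG0 c]
      nlinarith
    have hsL0 : 0 ≤ Real.sqrt s.logDim := Real.sqrt_nonneg _
    have hsL : Real.sqrt s.logDim ≤ s.logDim := by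
      rw [Real.sqrt_le_left (by linarith)]; nlinarith
    have hsG := Real.sqrt_nonneg ((l.map fun st => st.gain R P c ^ 2).sum + 1)
    have hn4 : (l.length : ℝ) * (4 / 2 ^ s.m) ≤ 4 := by
      rw [← hH, ← mul_div_assoc, div_le_iff₀ (by positivity)]; linarith
    have hprod : 132 * Real.sqrt s.logDim * ∑ i, u i * (Real.sqrt ((A i).V + (l.map fun st =>
        st.gain R P (A i).cell ^ 2).sum + 1) - Real.sqrt ((A i).V + 1)) ≤
        132 * Real.sqrt s.logDim *
        (Real.sqrt ((l.map fun st => st.gain R P c ^ 2).sum + 1) + 1) := by gcongr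
    have hnn : 0 ≤ Real.sqrt s.logDim * Real.sqrt ((l.map fun st => st.gain R P c ^ 2).sum + 1) :=
      mul_nonneg hsL0 hsG
    rcases hleft with hleft | hleft
    · linarith
    · linarith
  rw [abs_le]
  have h1 := key 1 (Or.inl rfl)
  have h2 := key (-1) (Or.inr rfl)
  constructor <;> linarith

/-! ## Concentration -/

/-- Indicator that the auxiliary prediction lies in an interval. -/
def Step.hit (R : Routines) (P : Params) (st : Step) (c : Cell) : ℝ := c.ind (st.aux R P)

/-- Realized gain of the expert `(c, 1)`. -/
def Step.err (R : Routines) (P : Params) (st : Step) (c : Cell) : ℝ :=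
  st.hit R P c * (st.aux R P - bit st.y)

/-- Probability of an interval in a round. -/
def Step.prob (R : Routines) (P : Params) (st : Step) (c : Cell) : ℝ := cellProb (st.s.mix R P) c

/-- The exponential of `φ` has conditional mean at most one in every round. -/
def Super (R : Routines) (P : Params) (φ : Step → ℝ) : Prop :=
  ∀ s q, StateInv P s → 0 ≤ q → q ≤ 1 →
      (s.mix R P).θ * (q * Real.exp (φ ⟨s, q, true, true⟩)
        + (1 - q) * Real.exp (φ ⟨s, q, true, false⟩))
      + (1 - (s.mix R P).θ) * (q * Real.exp (φ ⟨s, q, false, true⟩)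
        + (1 - q) * Real.exp (φ ⟨s, q, false, false⟩)) ≤ 1

theorem exp_le_of_abs_le_one {x : ℝ} (hx : |x| ≤ 1) : Real.exp x ≤ 1 + x + x ^ 2 := by
  have := (abs_le.mp (Real.abs_exp_sub_one_sub_id_le hx)).2
  linarith

/-- The compensator `z` only has to dominate the mean of the linearised exponentials, because `1 + z
≤ exp z`. -/
theorem exp_mean_le_one {t a b z : ℝ} (ht0 : 0 ≤ t) (ht1 : t ≤ 1) {x y : ℝ}
    (hx : Real.exp x ≤ 1 + a) (hy : Real.exp y ≤ 1 + b) (h : t * a + (1 - t) * b ≤ z) :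
    t * Real.exp (x - z) + (1 - t) * Real.exp (y - z) ≤ 1 := by
  have h1 : t * Real.exp x + (1 - t) * Real.exp y ≤ 1 + z := by nlinarith
  have h2 := Real.add_one_le_exp z
  have e1 : t * Real.exp (x - z) + (1 - t) * Real.exp (y - z) =
      (t * Real.exp x + (1 - t) * Real.exp y) * Real.exp (-z) := by
    rw [sub_eq_add_neg x z, sub_eq_add_neg y z, Real.exp_add, Real.exp_add]; ring
  have e2 : Real.exp z * Real.exp (-z) = 1 := by rw [← Real.exp_add]; simp
  rw [e1]
  refine le_trans ?_ e2.le
  exact mul_le_mul_of_nonneg_right (by linarith) (Real.exp_pos _).le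

/-- Freedman's inequality in exponential form: for a fixed outcome, the realized gain has the mean
`cellGain` over the coin, and its second moment is at most the probability of the interval. -/
theorem super_err (R : Routines) (hR : R.Good) (P : Params) (hP : P.Ok) (c : Cell) (lam σ : ℝ)
    (h0 : 0 ≤ lam) (h1 : lam ≤ 1) (hσ : σ = 1 ∨ σ = -1) :
    Super R P fun st => σ * lam * (st.err R P c - st.gain R P c) - lam ^ 2 * st.prob R P c := by
  intro s q hs hq0 hq1
  have hD := hs.mix_ok hR hP
  set D := s.mix R P with hDdef
  have hσ2 : σ ^ 2 = 1 := by rcases hσ with h | h <;> rw [h] <;> norm_num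
  have hpt : ∀ (p y : ℝ), 0 ≤ p → p ≤ 1 → 0 ≤ y → y ≤ 1 →
      Real.exp (σ * lam * (c.ind p * (p - y))) ≤
        1 + (σ * lam * (c.ind p * (p - y)) + lam ^ 2 * c.ind p) := by
    intro p y hp0 hp1 hy0 hy1
    have hi := c.ind_nonneg p
    have hi1 := c.ind_le_one p
    have hb : (σ * lam * (c.ind p * (p - y))) ^ 2 = lam ^ 2 * c.ind p * (p - y) ^ 2 := by
      rw [mul_pow, mul_pow, mul_pow, hσ2, c.ind_sq]; ring
    have hpy : (p - y) ^ 2 ≤ 1 := by nlinarith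
    have hl2 : lam ^ 2 ≤ 1 := by nlinarith
    have hle : (σ * lam * (c.ind p * (p - y))) ^ 2 ≤ lam ^ 2 * c.ind p := by
      rw [hb]
      have : 0 ≤ lam ^ 2 * c.ind p := by positivity
      nlinarith
    have habs : |σ * lam * (c.ind p * (p - y))| ≤ 1 := by
      rw [← sq_le_one_iff_abs_le_one]
      have : lam ^ 2 * c.ind p ≤ 1 := by nlinarith [sq_nonneg lam]
      linarith
    have := exp_le_of_abs_le_one habs
    linarith
  have key : ∀ y : Bool,
      D.θ * Real.exp (σ * lam * (c.ind D.v * (D.v - bit y) - cellGain D (bit y) c)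
        - lam ^ 2 * cellProb D c) +
      (1 - D.θ) * Real.exp (σ * lam * (c.ind D.u * (D.u - bit y) - cellGain D (bit y) c)
        - lam ^ 2 * cellProb D c) ≤ 1 := by
    intro y
    have := exp_mean_le_one hD.t0 hD.t1
      (hpt D.v (bit y) hD.v0 hD.v1 (bit_nonneg y) (bit_le_one y))
      (hpt D.u (bit y) hD.u0 hD.u1 (bit_nonneg y) (bit_le_one y))
      (z := σ * lam * cellGain D (bit y) c + lam ^ 2 * cellProb D c)
      (le_of_eq (by unfold cellGain cellProb; ring))
    convert this using 4 <;> ring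
  have k1 := key true
  have k2 := key false
  simp only [Step.err, Step.hit, Step.aux, Step.gain, Step.prob, ← hDdef, if_true,
    Bool.false_eq_true, if_false]
  nlinarith

/-- Since `exp (-1) ≤ 1/2`, the expected number of hits is at most twice the realized number plus
twice the threshold. This replaces probabilities by counts in the variance terms. -/
theorem super_hit (R : Routines) (hR : R.Good) (P : Params) (hP : P.Ok) (c : Cell) :
    Super R P fun st => st.prob R P c / 2 - st.hit R P c := by
  intro s q hs hq0 hq1
  have hD := hs.mix_ok hR hP
  set D := s.mix R P with hDdef
  have hpt : ∀ p, Real.exp (-c.ind p) ≤ 1 + (-(c.ind p / 2)) := by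
    intro p
    rcases c.ind_zero_or_one p with ⟨h, _⟩ | ⟨h, _⟩
    · rw [h]; simp
    · rw [h, Real.exp_neg]
      have : (2 : ℝ) ≤ Real.exp 1 := by have := Real.exp_one_gt_d9; linarith
      have := inv_anti₀ (by norm_num) this
      linarith
  have := exp_mean_le_one hD.t0 hD.t1 (hpt D.v) (hpt D.u) (z := -(cellProb D c / 2))
      (le_of_eq (by unfold cellProb; ring))
  simp only [Step.hit, Step.aux, Step.prob, ← hDdef, if_true, Bool.false_eq_true, if_false]
  have e : ∀ x, -x - -(cellProb D c / 2) = cellProb D c / 2 - x := by intro x; ring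
  rw [e, e] at this
  linarith

theorem exp_coin_le_one (q lam σ h : ℝ) (h0 : 0 ≤ lam) (h1 : lam ≤ 1) (hσ : σ = 1 ∨ σ = -1)
    (hq0 : 0 ≤ q) (hq1 : q ≤ 1) (hh : h = 0 ∨ h = 1) :
    q * Real.exp (σ * lam * (h * (q - 1)) - lam ^ 2 * h)
      + (1 - q) * Real.exp (σ * lam * (h * (q - 0)) - lam ^ 2 * h) ≤ 1 := by
  have hσ2 : σ ^ 2 = 1 := by rcases hσ with h | h <;> rw [h] <;> norm_num
  rcases hh with rfl | rfl
  · simp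
  have hpt : ∀ z, z ^ 2 ≤ 1 → Real.exp (σ * lam * (1 * z)) ≤ 1 + (σ * lam * z + lam ^ 2) := by
    intro z hz
    have hb : (σ * lam * (1 * z)) ^ 2 = lam ^ 2 * z ^ 2 := by
      rw [mul_pow, mul_pow, hσ2]; ring
    have hl2 : lam ^ 2 ≤ 1 := by nlinarith
    have hle : (σ * lam * (1 * z)) ^ 2 ≤ lam ^ 2 := by
      rw [hb]; nlinarith [sq_nonneg lam]
    have habs : |σ * lam * (1 * z)| ≤ 1 := by
      rw [← sq_le_one_iff_abs_le_one]; linarith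
    have := exp_le_of_abs_le_one habs
    linarith
  have := exp_mean_le_one hq0 hq1 (hpt (q - 1) (by nlinarith)) (hpt (q - 0) (by nlinarith))
    (z := lam ^ 2) (le_of_eq (by ring))
  simpa using this

/-- The outcome is drawn independently of the coin, so the realized hit may be treated as already
known. The variance proxy is then the hit itself instead of its probability. -/
theorem super_outcome (R : Routines) (hR : R.Good) (P : Params) (hP : P.Ok) (c : Cell) (lam σ : ℝ)
    (h0 : 0 ≤ lam) (h1 : lam ≤ 1) (hσ : σ = 1 ∨ σ = -1) :
    Super R P fun st => σ * lam * (st.hit R P c * (st.q - bit st.y)) - lam ^ 2 * st.hit R P c := by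
  intro s q hs hq0 hq1
  have hD := hs.mix_ok hR hP
  have hh : ∀ p, c.ind p = 0 ∨ c.ind p = 1 := fun p => by
    rcases c.ind_zero_or_one p with h | h
    · exact Or.inl h.1
    · exact Or.inr h.1
  have k1 := exp_coin_le_one q lam σ _ h0 h1 hσ hq0 hq1 (hh (s.mix R P).v)
  have k2 := exp_coin_le_one q lam σ _ h0 h1 hσ hq0 hq1 (hh (s.mix R P).u)
  simp only [Step.hit, Step.aux, bit, if_true, Bool.false_eq_true, if_false]
  nlinarith [hD.t0, hD.t1]

theorem super_mean (R : Routines) (hR : R.Good) (P : Params) (hP : P.Ok) (lam σ : ℝ)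
    (h0 : 0 ≤ lam) (h1 : lam ≤ 1) (hσ : σ = 1 ∨ σ = -1) :
    Super R P fun st => σ * lam * (st.q - bit st.y) - lam ^ 2 := by
  intro s q hs hq0 hq1
  have hD := hs.mix_ok hR hP
  have k1 := exp_coin_le_one q lam σ _ h0 h1 hσ hq0 hq1 (Or.inr rfl)
  simp only [bit, if_true, Bool.false_eq_true, if_false]
  simp only [one_mul, mul_one] at k1
  nlinarith [hD.t0, hD.t1]

theorem super_zero (R : Routines) (P : Params) : Super R P fun _ => 0 := by
  intro s q _ _ _
  simp

/-- The sign of a Boolean. -/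
def sgnOf (b : Bool) : ℝ := if b then 1 else -1

theorem sgnOf_or (b : Bool) : sgnOf b = 1 ∨ sgnOf b = -1 := by cases b <;> simp [sgnOf]

/-- The martingale differences: epoch, index of an interval, choice of a scale, sign, kind. -/
def pot (R : Routines) (P : Params) (lam : Bool → ℕ → Cell → ℝ) (lam0 : ℕ → ℝ)
    (i : ℕ × ℕ × Bool × Bool × Fin 4) (st : Step) : ℝ :=
  if st.s.m = i.1 then
    if i.2.2.2.2 = 3 then
      sgnOf i.2.2.2.1 * lam0 i.1 * (st.q - bit st.y) - lam0 i.1 ^ 2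
    else match st.s.cells[i.2.1]? with
      | none => 0
      | some c =>
        if i.2.2.2.2 = 0 then
          sgnOf i.2.2.2.1 * lam i.2.2.1 i.1 c * (st.err R P c - st.gain R P c)
            - lam i.2.2.1 i.1 c ^ 2 * st.prob R P c
        else if i.2.2.2.2 = 1 then
          sgnOf i.2.2.2.1 * lam i.2.2.1 i.1 c * (st.hit R P c * (st.q - bit st.y))
            - lam i.2.2.1 i.1 c ^ 2 * st.hit R P c
        else st.prob R P c / 2 - st.hit R P c
  else 0

/-- The partitions are random, so the union bound ranges over positions in the list of intervals.
The interval at a given position is known before the round is played, which is all that the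
supermartingale property requires. -/
theorem super_pot (R : Routines) (hR : R.Good) (P : Params) (hP : P.Ok)
    (lam : Bool → ℕ → Cell → ℝ) (lam0 : ℕ → ℝ) (h : ∀ w m c, 0 ≤ lam w m c ∧ lam w m c ≤ 1)
    (h0 : ∀ m, 0 ≤ lam0 m ∧ lam0 m ≤ 1) (i : ℕ × ℕ × Bool × Bool × Fin 4) :
    Super R P (pot R P lam lam0 i) := by
  intro s q hs hq0 hq1
  obtain ⟨m, j, w, σ, k⟩ := i
  unfold pot
  simp only
  by_cases hm : s.m = m
  · simp only [hm, if_true]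
    by_cases h3 : k = 3
    · simp only [h3, if_true]
      exact super_mean R hR P hP _ _ (h0 m).1 (h0 m).2 (sgnOf_or σ) s q hs hq0 hq1
    · simp only [h3, if_false]
      cases hc : s.cells[j]? with
      | none => exact super_zero R P s q hs hq0 hq1
      | some c =>
        simp only
        by_cases hk0 : k = 0
        · simp only [hk0, if_true]
          exact super_err R hR P hP c _ _ (h w m c).1 (h w m c).2 (sgnOf_or σ) s q hs hq0 hq1
        · simp only [hk0, if_false]
          by_cases hk1 : k = 1
          · simp only [hk1, if_true]
            exact super_outcome R hR P hP c _ _ (h w m c).1 (h w m c).2 (sgnOf_or σ) s q hs hq0 hq1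
          · simp only [hk1, if_false]
            exact super_hit R hR P hP c s q hs hq0 hq1
  · simp only [hm, if_false]
    exact super_zero R P s q hs hq0 hq1

/-! ## The calibration error of a list of rounds -/

/-- Error of the prediction `p`. -/
def biasAt (h : List Round) (p : ℝ) : ℝ :=
  (h.map fun x => if x.p = p then bit x.y - p else 0).sum

theorem biasAt_append (h k : List Round) (p : ℝ) :
    biasAt (h ++ k) p = biasAt h p + biasAt k p := by simp [biasAt]

theorem biasAt_eq_zero (h : List Round) (p : ℝ) (hp : p ∉ h.map Round.p) : biasAt h p = 0 := by
  unfold biasAt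
  apply List.sum_eq_zero
  intro z hz
  rw [List.mem_map] at hz
  obtain ⟨x, hx, rfl⟩ := hz
  rw [if_neg]
  rintro rfl
  exact hp (List.mem_map.mpr ⟨x, hx, rfl⟩)

open Classical in
theorem calError_one (h : List Round) :
    calError 1 h = ∑ p ∈ (h.map Round.p).toFinset, |biasAt h p| := by
  unfold calError
  refine Finset.sum_congr (by congr) fun p hp => ?_
  have hsum : ∀ h : List Round, ((h.filter fun x => x.p = p).map fun x =>
      (if x.y then (1 : ℝ) else 0) - p).sum = biasAt h p := by
    intro h
    unfold biasAt
    induction h with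
    | nil => rfl
    | cons x h ih =>
      rw [List.filter_cons]
      by_cases hx : x.p = p
      · simp only [hx, decide_true, if_true, List.map_cons, List.sum_cons, ih]
        rfl
      · simp only [hx, decide_false, Bool.false_eq_true, if_false, List.map_cons, List.sum_cons, ih,
          zero_add]
  have hlen : 0 < (h.filter fun x => x.p = p).length := by
    rw [List.mem_toFinset, List.mem_map] at hp
    obtain ⟨x, hx, hxp⟩ := hp
    exact List.length_pos_iff.mpr (List.ne_nil_of_mem (List.mem_filter.mpr ⟨hx, by simpa using hxp⟩))
  have hlen' : (0 : ℝ) < (h.filter fun x => x.p = p).length := by exact_mod_cast hlen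
  simp only [pow_one]
  rw [hsum, abs_mul, abs_of_pos (by positivity)]
  field_simp

open Classical in
theorem calError_eq_sum (h : List Round) (S : Finset ℝ) (hS : ∀ x ∈ h, x.p ∈ S) :
    calError 1 h = ∑ p ∈ S, |biasAt h p| := by
  rw [calError_one]
  apply Finset.sum_subset
  · intro p hp
    rw [List.mem_toFinset, List.mem_map] at hp
    obtain ⟨x, hx, rfl⟩ := hp
    exact hS x hx
  · intro p _ hp
    rw [List.mem_toFinset] at hp
    rw [biasAt_eq_zero h p hp, abs_zero]

/-- The same value may be predicted in several epochs; by the triangle inequality for the biases it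
is enough to bound the epochs separately. -/
theorem calError_append_le (h k : List Round) :
    calError 1 (h ++ k) ≤ calError 1 h + calError 1 k := by
  classical
  set S := ((h ++ k).map Round.p).toFinset with hSdef
  have hS : ∀ x ∈ h ++ k, x.p ∈ S := fun x hx => by
    rw [hSdef, List.mem_toFinset, List.mem_map]; exact ⟨x, hx, rfl⟩
  rw [calError_eq_sum _ S hS, calError_eq_sum h S fun x hx => hS x (by simp [hx]),
    calError_eq_sum k S fun x hx => hS x (by simp [hx]), ← Finset.sum_add_distrib]
  refine Finset.sum_le_sum fun p _ => ?_
  rw [biasAt_append]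
  exact abs_add_le _ _

theorem list_sum_le_sum {α : Type} (l : List α) (f g : α → ℝ) (h : ∀ a ∈ l, f a ≤ g a) :
    (l.map f).sum ≤ (l.map g).sum := List.sum_le_sum h

theorem list_abs_sum_le {α : Type} (l : List α) (f : α → ℝ) :
    |(l.map f).sum| ≤ (l.map fun a => |f a|).sum := by
  induction l with
  | nil => simp
  | cons a l ih =>
    simp only [List.map_cons, List.sum_cons]
    exact (abs_add_le _ _).trans (by linarith)

theorem list_sum_comm {α β : Type} (l : List α) (k : List β) (f : α → β → ℝ) :
    (l.map fun a => (k.map fun b => f a b).sum).sum =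
      (k.map fun b => (l.map fun a => f a b).sum).sum := by
  induction l with
  | nil => simp
  | cons a l ih => simp only [List.map_cons, List.sum_cons, ih, List.sum_map_add]

theorem list_finset_sum_comm {α β : Type} (l : List α) (S : Finset β) (f : α → β → ℝ) :
    ∑ b ∈ S, (l.map fun a => f a b).sum = (l.map fun a => ∑ b ∈ S, f a b).sum := by
  induction l with
  | nil => simp
  | cons a l ih => simp only [List.map_cons, List.sum_cons, Finset.sum_add_distrib, ih]

theorem list_sum_mul_left {α : Type} (l : List α) (f : α → ℝ) (x : ℝ) :
    (l.map fun a => x * f a).sum = x * (l.map f).sum := List.sum_map_mul_left l f x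

theorem list_sum_sub {α : Type} (l : List α) (f g : α → ℝ) :
    (l.map fun a => f a - g a).sum = (l.map f).sum - (l.map g).sum := by
  induction l with
  | nil => simp
  | cons a l ih => simp only [List.map_cons, List.sum_cons, ih]; ring

theorem list_sum_const {α : Type} (l : List α) (x : ℝ) :
    (l.map fun _ => x).sum = l.length * x := by simp

theorem calError_le_length (h : List Round) (hp : ∀ x ∈ h, 0 ≤ x.p ∧ x.p ≤ 1) :
    calError 1 h ≤ h.length := by
  classical
  rw [calError_one]
  calc ∑ p ∈ (h.map Round.p).toFinset, |biasAt h p|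
      ≤ ∑ p ∈ (h.map Round.p).toFinset, (h.map fun x => if x.p = p then (1 : ℝ) else 0).sum := by
        refine Finset.sum_le_sum fun p _ => (list_abs_sum_le _ _).trans ?_
        refine list_sum_le_sum _ _ _ fun x hx => ?_
        split
        · rename_i he
          rw [abs_le, ← he]
          have := hp x hx; have := bit_nonneg x.y; have := bit_le_one x.y
          constructor <;> linarith
        · simp
    _ = (h.map fun x => ∑ p ∈ (h.map Round.p).toFinset, if x.p = p then (1 : ℝ) else 0).sum :=
        list_finset_sum_comm _ _ _
    _ ≤ (h.map fun _ => (1 : ℝ)).sum := by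
        refine list_sum_le_sum _ _ _ fun x _ => ?_
        rw [Finset.sum_ite_eq]
        split <;> norm_num
    _ = h.length := by simp

/-- The error of an epoch, interval by interval. -/
theorem calError_le_cells (R : Routines) (P : Params) (cells : List Cell) (l : List Step)
    (hm : ∀ st ∈ l, 2 ≤ st.s.m) (hcells : ∀ st ∈ l, st.s.cells = cells)
    (hone : ∀ st ∈ l, indSum cells (st.aux R P) = 1) :
    calError 1 (l.map (Step.round R P)) ≤
      (cells.map fun c => |(l.map fun st => st.hit R P c * (bit st.y - c.hi)).sum|).sum := by
  classical
  set S := ((l.map (Step.round R P)).map Round.p).toFinset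
  -- Injectivity of `c ↦ c.hi` is not needed: intervals with the same right end are grouped and
  -- separated by the triangle inequality.
  have hbias : ∀ p, biasAt (l.map (Step.round R P)) p =
      (cells.map fun c => if c.hi = p then
        (l.map fun st => st.hit R P c * (bit st.y - c.hi)).sum else 0).sum := by
    intro p
    have e1 : biasAt (l.map (Step.round R P)) p = (l.map fun st => (cells.map fun c =>
        st.hit R P c * (if c.hi = p then bit st.y - c.hi else 0)).sum).sum := by
      unfold biasAt
      rw [List.map_map]
      refine congrArg List.sum (List.map_congr_left fun st hst => ?_)
      obtain ⟨c, _, _, hc2, hc3⟩ := sum_ind_of_locate (st.aux R P) cells (hone st hst)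
        fun c => if c.hi = p then bit st.y - c.hi else 0
      have hm' : ¬ (st.s.m ≤ 1) := by have := hm st hst; omega
      simp only [Step.hit]
      rw [hc3]
      have : ((Step.round R P) st).p = c.hi := by
        simp only [Step.round, output, bind_val, leN_val, hm', decide_false, Bool.false_eq_true,
          if_false, hcells st hst, hc2]
      simp only [Function.comp, this]
      split
      · rename_i h; rw [h]; rfl
      · rfl
    rw [e1, list_sum_comm]
    refine congrArg List.sum (List.map_congr_left fun c _ => ?_)
    split
    · rfl
    · simp
  rw [calError_one]
  calc ∑ p ∈ S, |biasAt (l.map (Step.round R P)) p|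
      ≤ ∑ p ∈ S, (cells.map fun c => if c.hi = p then
        |(l.map fun st => st.hit R P c * (bit st.y - c.hi)).sum| else 0).sum := by
        refine Finset.sum_le_sum fun p _ => ?_
        rw [hbias]
        refine (list_abs_sum_le _ _).trans (list_sum_le_sum _ _ _ fun c _ => ?_)
        split
        · exact le_rfl
        · simp
    _ = _ := list_finset_sum_comm _ _ _
    _ ≤ _ := by
        refine list_sum_le_sum _ _ _ fun c _ => ?_
        rw [Finset.sum_ite_eq]
        split
        · exact le_rfl
        · positivity

/-! ## Epochs of a record -/

theorem valid_map_q (R : Routines) (P : Params) (qs : List ℝ) (s : State) (l : List Step)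
    (h : Valid R P qs s l) : l.map Step.q = qs := by
  induction qs generalizing s l with
  | nil => have h : l = [] := h; simp [h]
  | cons q qs ih =>
    obtain ⟨st, l', rfl, _, hq, h'⟩ := h
    rw [List.map_cons, hq, ih _ _ h']

/-- `2 ^ m + idx` is a clock that advances by exactly one per round, also across epochs since `2^m +
2^m = 2^(m+1)`. As it starts at 2, every epoch that is played satisfies `2^m ≤ T + 1`. -/
theorem valid_inv {R : Routines} (hR : R.Good) {P : Params} (hP : P.Ok) (qs : List ℝ) (s : State)
    (hs : StateInv P s) (l : List Step) (h : Valid R P qs s l) :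
    ∀ st ∈ l, StateInv P st.s ∧ s.m ≤ st.s.m ∧
      2 ^ st.s.m + st.s.idx + 1 ≤ 2 ^ s.m + s.idx + l.length := by
  induction qs generalizing s l with
  | nil => have h : l = [] := h; simp [h]
  | cons q qs ih =>
    obtain ⟨st, l', rfl, hst, _, h'⟩ := h
    intro st' hst'
    rw [List.mem_cons] at hst'
    rcases hst' with rfl | hst'
    · rw [hst, List.length_cons]
      exact ⟨hs, le_rfl, by omega⟩
    · obtain ⟨h1, h2, h3⟩ := ih _ (hs.next hR hP st.y) l' h' st' hst'
      rw [List.length_cons]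
      by_cases hlast : s.idx + 1 = s.len
      · obtain ⟨h4, h5⟩ := next_fresh R P hP hs st.y hlast
        rw [h5] at h2 h3
        rw [h4.idx] at h3
        rw [hs.len] at hlast
        rw [pow_succ] at h3
        exact ⟨h1, by omega, by omega⟩
      · have h4 : (s.next R P st.y).m = s.m := by rw [update_eq, if_neg hlast]
        have h5 : (s.next R P st.y).idx = s.idx + 1 := by rw [update_eq, if_neg hlast]
        rw [h4] at h2 h3
        rw [h5] at h3
        exact ⟨h1, h2, by omega⟩

/-- A record splits into the rest of the current epoch and a record that starts with the next
epoch. -/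
theorem valid_split {R : Routines} (hR : R.Good) {P : Params} (hP : P.Ok) (qs : List ℝ) (s : State)
    (hs : StateInv P s) (l : List Step) (h : Valid R P qs s l) :
    ∃ (l₁ l₂ : List Step) (qs₁ qs₂ : List ℝ), l = l₁ ++ l₂ ∧ Valid R P qs₁ s l₁ ∧
      s.idx + l₁.length ≤ s.len ∧
      (∀ st ∈ l₁, StateInv P st.s ∧ st.s.m = s.m ∧ st.s.cells = s.cells) ∧
      (l₂ = [] ∨ ∃ s₂, Fresh P s₂ ((s.ones + (l₁.map fun st => bit st.y).sum) / s.len) ∧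
        s₂.m = s.m + 1 ∧ Valid R P qs₂ s₂ l₂ ∧ s.idx + l₁.length = s.len) := by
  induction qs generalizing s l with
  | nil =>
    have h : l = [] := h
    subst h
    exact ⟨[], [], [], [], rfl, rfl, by simpa using hs.idx.le, by simp, Or.inl rfl⟩
  | cons q qs ih =>
    obtain ⟨st, l', rfl, hst, hq, h'⟩ := h
    by_cases hlast : s.idx + 1 = s.len
    · obtain ⟨h4, h5⟩ := next_fresh R P hP hs st.y hlast
      refine ⟨[st], l', [q], qs, rfl, ⟨st, [], rfl, hst, hq, rfl⟩, by simpa using hlast.le, ?_,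
        Or.inr ⟨_, by simpa using h4, h5, h', by simpa using hlast⟩⟩
      intro st' hst'
      rw [List.mem_singleton] at hst'
      subst hst'
      rw [hst]
      exact ⟨hs, rfl, rfl⟩
    · have hs' := hs.next hR hP st.y
      obtain ⟨l₁, l₂, qs₁, qs₂, h1, h2, h3, h4, h5⟩ := ih _ hs' l' h'
      have e1 : (s.next R P st.y).m = s.m := by rw [update_eq, if_neg hlast]
      have e2 : (s.next R P st.y).idx = s.idx + 1 := by rw [update_eq, if_neg hlast]
      have e3 : (s.next R P st.y).len = s.len := by rw [update_eq, if_neg hlast]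
      have e4 : (s.next R P st.y).cells = s.cells := by rw [update_eq, if_neg hlast]
      have e5 : (s.next R P st.y).ones = s.ones + bit st.y := by rw [update_eq, if_neg hlast]
      rw [e1, e4] at h4
      rw [e1, e2, e3, e5] at h5
      rw [e2, e3] at h3
      refine ⟨st :: l₁, l₂, q :: qs₁, qs₂, by rw [h1]; rfl, ⟨st, l₁, rfl, hst, hq, h2⟩,
        by rw [List.length_cons]; omega, ?_, ?_⟩
      · intro st' hst'
        rw [List.mem_cons] at hst'
        rcases hst' with rfl | hst'
        · rw [hst]; exact ⟨hs, rfl, rfl⟩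
        · exact h4 st' hst'
      · rw [List.map_cons, List.sum_cons, ← add_assoc, List.length_cons]
        rcases h5 with h5 | ⟨s₂, h6, h7, h8, h9⟩
        · exact Or.inl h5
        · exact Or.inr ⟨s₂, h6, h7, h8, by omega⟩

theorem Mix.Ok.aux_mem {R : Routines} {P : Params} {st : Step} (h : (st.s.mix R P).Ok) :
    0 ≤ st.aux R P ∧ st.aux R P ≤ 1 := by
  unfold Step.aux
  split
  · exact ⟨h.v0, h.v1⟩
  · exact ⟨h.u0, h.u1⟩

theorem partition_hi_le {P : Params} (hP : P.Ok) {sPrev s y : ℝ} (hs : 0 < sPrev)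
    (hs' : 0 < s) (hy0 : 0 ≤ y) (hy1 : y ≤ 1) : ∀ c ∈ (partition P sPrev s y).val, c.hi ≤ 1 := by
  intro c hc
  have hab := hP.left_lt_right hs hy0 hy1
  have hb1 : P.right sPrev y ≤ 1 := min_le_left _ _
  have hr := hP.rad_pos hs
  rw [partition_val, List.mem_append] at hc
  have hband : ∀ (n : ℕ) (pw : ℝ), 1 ≤ pw → ∀ c ∈ (bands P.bandCount (P.left sPrev y)
      (P.right sPrev y) (P.rad sPrev) n pw).val, c.hi ≤ 1 := by
    intro n
    induction n with
    | zero => intro pw _ c hc; simp [bands] at hc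
    | succ n ih =>
      intro pw hpw c hc
      rw [bands_succ_val, List.mem_append, List.mem_append] at hc
      have hnn : 0 ≤ (pw - 1) * P.rad sPrev := mul_nonneg (by linarith) hr.le
      rcases hc with hc | hc | hc
      · rw [band_val] at hc
        split at hc
        · rename_i hlt
          have := (mem_pieces _ _ _ hlt.le le_rfl hP.bandCount_pos c hc).2.1
          simp only at this
          linarith
        · simp at hc
      · rw [band_val] at hc
        split at hc
        · rename_i hlt
          have := (mem_pieces _ _ _ hlt.le le_rfl hP.bandCount_pos c hc).2.1
          simp only at this
          exact this.trans (min_le_left _ _)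
        · simp at hc
      · exact ih (2 * pw) (by linarith) c hc
  rcases hc with hc | hc
  · have := (mem_pieces _ _ _ hab.le le_rfl (hP.pieceCount_pos hs hs' hy0 hy1) c hc).2.1
    exact this.trans hb1
  · exact hband _ _ le_rfl c hc

theorem two_pow_pred_le {P : Params} {m : ℕ} (hm : 1 ≤ m) (h : 2 ^ m ≤ P.T + 1) (hT : 2 ≤ P.T) :
    (2 : ℝ) ^ (m - 1) ≤ P.T := by
  have h1 : 2 ^ m = 2 * 2 ^ (m - 1) := by
    rw [← pow_succ']; congr 1; omega
  have h2 : 2 ^ (m - 1) ≤ P.T := by omega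
  exact_mod_cast h2

/-- Predictions lie in the unit interval. -/
theorem round_p_mem {R : Routines} (hR : R.Good) {P : Params} (hP : P.Ok) {st : Step}
    (h : StateInv P st.s) (hT : 2 ^ st.s.m ≤ P.T + 1) :
    0 ≤ (st.round R P).p ∧ (st.round R P).p ≤ 1 := by
  have haux := (h.mix_ok hR hP).aux_mem
  rcases h with h | h
  · have : (st.round R P).p = st.aux R P := by
      simp [Step.round, output, h.hm]
    rw [this]; exact haux
  · obtain ⟨y, hy0, hy1, hc⟩ := h.cells
    have hm := h.hm
    have hone : indSum st.s.cells (st.aux R P) = 1 := by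
      rw [hc]
      exact hP.partition_indSum (by positivity) (by positivity)
        (two_pow_pred_le (by omega) hT hP.T) hy0 hy1 haux.1 haux.2
    obtain ⟨c, hc1, hc2, hc3, _⟩ := sum_ind_of_locate _ _ hone fun _ => 0
    have : (st.round R P).p = c.hi := by
      have hm' : ¬ (st.s.m ≤ 1) := by omega
      simp [Step.round, output, hm', hc3]
    rw [this]
    rw [hc] at hc1
    exact ⟨haux.1.trans (Cell.has_le_hi hc2),
      partition_hi_le hP (by positivity) (by positivity) hy0 hy1 c hc1⟩

/-! ### The error of one epoch on the concentration event -/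

/-- Concentration for one interval, with a scale `lam`. -/
theorem cell_conc (R : Routines) (P : Params) (c : Cell) (l : List Step) (lam x iota L : ℝ)
    (hlam0 : 0 < lam) (hlam1 : lam ≤ 1) (hx : x ≤ iota) (hL : 2 ≤ L) (hLi : L ≤ iota)
    (hE : ∀ σ : Bool, (l.map fun st => sgnOf σ * lam * (st.err R P c - st.gain R P c)
      - lam ^ 2 * st.prob R P c).sum ≤ x)
    (hO : ∀ σ : Bool, (l.map fun st => sgnOf σ * lam * (st.hit R P c * (st.q - bit st.y))
      - lam ^ 2 * st.hit R P c).sum ≤ x)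
    (hH : (l.map fun st => st.prob R P c / 2 - st.hit R P c).sum ≤ x)
    (hsq : ∀ st ∈ l, st.gain R P c ^ 2 ≤ st.prob R P c)
    (hG : |(l.map fun st => st.gain R P c).sum| ≤ 266 * L + 176 * Real.sqrt L *
        Real.sqrt ((l.map fun st => st.gain R P c ^ 2).sum + 1)) :
    |(l.map fun st => st.err R P c).sum| ≤
      1203 * (lam * (l.map fun st => st.hit R P c).sum + iota / lam) ∧
    |(l.map fun st => st.hit R P c * (st.q - bit st.y)).sum| ≤
      lam * (l.map fun st => st.hit R P c).sum + iota / lam := by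
  simp only [list_sum_sub, list_sum_mul_left] at hE hO hH
  have hdiv : (l.map fun st => st.prob R P c / 2).sum = (l.map fun st => st.prob R P c).sum / 2 := by
    simp only [div_eq_mul_inv, mul_comm _ (2 : ℝ)⁻¹, list_sum_mul_left]
  rw [hdiv] at hH
  have hGP := list_sum_le_sum l (fun st => st.gain R P c ^ 2) (fun st => st.prob R P c) hsq
  have hG0 : 0 ≤ (l.map fun st => st.gain R P c ^ 2).sum := by
    apply List.sum_nonneg
    intro z hz
    rw [List.mem_map] at hz
    obtain ⟨st, _, rfl⟩ := hz
    positivity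
  set E := (l.map fun st => st.err R P c).sum
  set G := (l.map fun st => st.gain R P c).sum
  set V := (l.map fun st => st.gain R P c ^ 2).sum
  set Q := (l.map fun st => st.prob R P c).sum
  set n := (l.map fun st => st.hit R P c).sum
  set O := (l.map fun st => st.hit R P c * (st.q - bit st.y)).sum
  have e1 := hE true
  have e2 := hE false
  have o1 := hO true
  have o2 := hO false
  simp only [sgnOf, if_true, Bool.false_eq_true, if_false] at e1 e2 o1 o2
  set z := iota / lam with hz
  have hzl : lam * z = iota := by rw [hz]; field_simp
  have hz0 : 0 < z := by rw [hz]; apply div_pos (by linarith) hlam0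
  have hlz : lam * iota ≤ z := by rw [← hzl]; nlinarith
  have hiz : iota ≤ z := by rw [← hzl]; nlinarith
  have hE1 : |E - G| ≤ lam * Q + z := by
    rw [abs_le]
    constructor
    · have : lam * (-(E - G)) ≤ lam * (lam * Q + z) := by nlinarith
      have := le_of_mul_le_mul_left this hlam0
      linarith
    · have : lam * (E - G) ≤ lam * (lam * Q + z) := by nlinarith
      exact le_of_mul_le_mul_left this hlam0
  have hO1 : |O| ≤ lam * n + z := by
    rw [abs_le]
    constructor
    · have : lam * (-O) ≤ lam * (lam * n + z) := by nlinarith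
      have := le_of_mul_le_mul_left this hlam0
      linarith
    · have : lam * O ≤ lam * (lam * n + z) := by nlinarith
      exact le_of_mul_le_mul_left this hlam0
  refine ⟨?_, hO1⟩
  -- The inequality between geometric and arithmetic mean, with `λ z = ι ≥ L` and `V ≤ Q`; the
  -- square root disappears here.
  have hs : 2 * (Real.sqrt L * Real.sqrt (V + 1)) ≤ z + lam * (Q + 1) := by
    rw [← Real.sqrt_mul (by linarith)]
    have h1 : L * (V + 1) ≤ ((z + lam * (Q + 1)) / 2) ^ 2 := by
      have h2 : L * (V + 1) ≤ lam * z * (Q + 1) := by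
        rw [hzl]; apply mul_le_mul hLi (by linarith) (by linarith) (by linarith)
      nlinarith [sq_nonneg (z - lam * (Q + 1))]
    have h3 := Real.sqrt_le_sqrt h1
    have hQ : 0 ≤ lam * (Q + 1) := mul_nonneg hlam0.le (by linarith)
    rw [Real.sqrt_sq (by linarith)] at h3
    linarith
  -- Expected hits are exchanged for realized ones.
  have hQn : lam * Q ≤ 2 * (lam * n) + 2 * z := by
    have : lam * Q ≤ lam * (2 * n + 2 * iota) := by gcongr; linarith
    nlinarith
  have hlam2 : lam ≤ z / 2 := by
    linarith
  have htri : |E| ≤ |E - G| + |G| := by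
    have := abs_add_le (E - G) G
    simpa using this
  have hn0 : 0 ≤ lam * n := by
    apply mul_nonneg hlam0.le
    apply List.sum_nonneg
    intro z hz
    rw [List.mem_map] at hz
    obtain ⟨st, _, rfl⟩ := hz
    exact Cell.ind_nonneg _ _
  have hs' : 176 * Real.sqrt L * Real.sqrt (V + 1) ≤ 88 * (z + lam * (Q + 1)) := by linarith
  linarith

/-- The martingale differences stay below `x` for the epochs from `m₀` on. -/
def Conc (R : Routines) (P : Params) (lam : Bool → ℕ → Cell → ℝ) (lam0 : ℕ → ℝ) (M B : ℕ) (x : ℝ)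
    (m₀ : ℕ) (l : List Step) : Prop :=
  ∀ i : ℕ × ℕ × Bool × Bool × Fin 4, m₀ ≤ i.1 → i.1 < M → i.2.1 < B →
    (l.map (pot R P lam lam0 i)).sum ≤ x

theorem sum_pot_eq_zero (R : Routines) (P : Params) (lam : Bool → ℕ → Cell → ℝ) (lam0 : ℕ → ℝ)
    (i : ℕ × ℕ × Bool × Bool × Fin 4) (l : List Step) (h : ∀ st ∈ l, st.s.m ≠ i.1) :
    (l.map (pot R P lam lam0 i)).sum = 0 := by
  apply List.sum_eq_zero
  intro z hz
  rw [List.mem_map] at hz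
  obtain ⟨st, hst, rfl⟩ := hz
  simp [pot, h st hst]

theorem Conc.split {R : Routines} {P : Params} {lam : Bool → ℕ → Cell → ℝ} {lam0 : ℕ → ℝ} {M B : ℕ}
    {x : ℝ} {m : ℕ} {l₁ l₂ : List Step} (h : Conc R P lam lam0 M B x m (l₁ ++ l₂))
    (h1 : ∀ st ∈ l₁, st.s.m = m) (h2 : ∀ st ∈ l₂, m + 1 ≤ st.s.m) :
    Conc R P lam lam0 M B x (m + 1) l₂ ∧ ∀ i : ℕ × ℕ × Bool × Bool × Fin 4, i.1 = m → i.1 < M →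
      i.2.1 < B → (l₁.map (pot R P lam lam0 i)).sum ≤ x := by
  constructor
  · intro i hi1 hi2 hi3
    have := h i (by omega) hi2 hi3
    rw [List.map_append, List.sum_append, sum_pot_eq_zero R P lam lam0 i l₁ fun st hst => by
      rw [h1 st hst]; omega] at this
    linarith
  · intro i hi1 hi2 hi3
    have := h i (by omega) hi2 hi3
    rw [List.map_append, List.sum_append, sum_pot_eq_zero R P lam lam0 i l₂ fun st hst => by
      have := h2 st hst; omega] at this
    linarith

/-- Calibration error of an epoch in terms of the two scales. -/
theorem epoch_error {R : Routines} (hR : R.Good) {P : Params} (hP : P.Ok)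
    (lam : Bool → ℕ → Cell → ℝ) (lam0 : ℕ → ℝ) (B : ℕ) (xs x lamIn μ : ℝ)
    (hxs0 : 0 ≤ xs) (hxs1 : xs ≤ 1) (s : State) (y : ℝ) (hs : Fresh P s y)
    (hyx : |y - xs| ≤ P.rad (2 ^ (s.m - 1)))
    (hlamIn : ∀ c, lam true s.m c = lamIn) (hlamIn0 : 0 < lamIn) (hlamIn1 : lamIn ≤ 1)
    (hlamOut : ∀ c, lam false s.m c = μ * max 0 (min 1 (c.gap xs))) (hμ0 : 0 < μ)
    (hμ1 : μ ≤ 1 / 2408) (hx : x ≤ P.iota) (hL : s.logDim ≤ P.iota)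
    (hT : 2 ^ s.m ≤ P.T + 1) (hB : s.cells.length ≤ B) (qs : List ℝ) (l : List Step)
    (hl : Valid R P qs s l) (hlen : s.idx + l.length ≤ s.len)
    (hinv : ∀ st ∈ l, StateInv P st.s ∧ st.s.m = s.m ∧ st.s.cells = s.cells)
    (hconc : ∀ i : ℕ × ℕ × Bool × Bool × Fin 4, i.1 = s.m →
      i.2.1 < B → (l.map (pot R P lam lam0 i)).sum ≤ x) :
    ∃ X, X ≤ 2 * (l.map fun st => |st.q - xs|).sum +
        9632 * (P.bandCount * P.iota / (μ * P.rad (2 ^ (s.m - 1)))) ∧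
      calError 1 (l.map (Step.round R P)) ≤
      1203 * (lamIn * 2 ^ s.m + P.pieceCount (2 ^ (s.m - 1)) (2 ^ s.m) y * P.iota / lamIn)
      + 2 ^ s.m * ((P.right (2 ^ (s.m - 1)) y - P.left (2 ^ (s.m - 1)) y) /
          P.pieceCount (2 ^ (s.m - 1)) (2 ^ s.m) y)
      + 1203 * (μ * X + 4 * (P.bandCount * P.iota / (μ * P.rad (2 ^ (s.m - 1)))))
      + X / P.bandCount := by
  have hsm := hs.inv.hm
  have hp1 : (0 : ℝ) < 2 ^ (s.m - 1) := by positivity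
  have hp2 : (0 : ℝ) < 2 ^ s.m := by positivity
  have hr := hP.rad_pos hp1
  have hab := hP.left_lt_right hp1 hs.y0 hs.y1
  have hN := hP.pieceCount_pos hp1 hp2 hs.y0 hs.y1
  have hK := hP.bandCount_pos
  have hmix : ∀ st ∈ l, (st.s.mix R P).Ok := fun st hst => (hinv st hst).1.mix_ok hR hP
  have haux : ∀ st ∈ l, 0 ≤ st.aux R P ∧ st.aux R P ≤ 1 := fun st hst => (hmix st hst).aux_mem
  have hone : ∀ st ∈ l, indSum s.cells (st.aux R P) = 1 := by
    intro st hst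
    rw [hs.cells]
    exact hP.partition_indSum hp1 hp2 (two_pow_pred_le (by omega) hT hP.T) hs.y0 hs.y1
      (haux st hst).1 (haux st hst).2
  set r := P.rad (2 ^ (s.m - 1)) with hrdef
  set a := P.left (2 ^ (s.m - 1)) y with ha
  set b := P.right (2 ^ (s.m - 1)) y with hb
  set N := P.pieceCount (2 ^ (s.m - 1)) (2 ^ s.m) y with hNdef
  set K := P.bandCount with hKdef
  set inner := (unifPart ⟨a, b, true, true⟩ N).val with hinner
  set outer := (bands K a b r (P.bandMax + 1) 1).val with houter
  have hcells : s.cells = inner ++ outer := by rw [hs.cells, partition_val]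
  have hN' : (0 : ℝ) < N := by exact_mod_cast hN
  have hK' : (1 : ℝ) ≤ K := by exact_mod_cast hK
  have hi : 1 ≤ P.iota := hP.iota
  -- concentration for every interval
  have hconc' : ∀ c ∈ s.cells, ∀ w, 0 < lam w s.m c → lam w s.m c ≤ 1 →
      |(l.map fun st => st.err R P c).sum| ≤
        1203 * (lam w s.m c * (l.map fun st => st.hit R P c).sum + P.iota / lam w s.m c) ∧
      |(l.map fun st => st.hit R P c * (st.q - bit st.y)).sum| ≤
        lam w s.m c * (l.map fun st => st.hit R P c).sum + P.iota / lam w s.m c := by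
    intro c hc w hw0 hw1
    obtain ⟨j, hj, hjc⟩ := List.getElem_of_mem hc
    have hj' : s.cells[j]? = some c := by rw [List.getElem?_eq_getElem hj, hjc]
    have hpot : ∀ (σ : Bool) (k : Fin 4) (f : Step → ℝ), (∀ st ∈ l,
        pot R P lam lam0 (s.m, j, w, σ, k) st = f st) → (l.map f).sum ≤ x := by
      intro σ k f hf
      have := hconc (s.m, j, w, σ, k) rfl (by simp only; omega)
      rwa [List.map_congr_left hf] at this
    refine cell_conc R P c l (lam w s.m c) x P.iota s.logDim hw0 hw1 hx (hs.inv.logDim_ge hP) hL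
      (fun σ => hpot σ 0 _ fun st hst => ?_) (fun σ => hpot σ 1 _ fun st hst => ?_)
      (hpot true 2 _ fun st hst => ?_) (fun st hst => (hmix st hst).gain_sq_le _ _)
      (regret_epoch R hR P hP qs s y hs l hl (by omega)
        (fun st hst c => ((hmix st hst).abs_gain_le _ _).trans ((hmix st hst).prob_le_one _)) c hc)
    all_goals
      obtain ⟨_, h2, h3⟩ := hinv st hst
      simp [pot, h2, h3, hj']
  have hhit0 : ∀ (st : Step) (c : Cell), 0 ≤ st.hit R P c := fun st c => Cell.ind_nonneg _ _
  set n : Cell → ℝ := fun c => (l.map fun st => st.hit R P c).sum with hn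
  have hn0 : ∀ c, 0 ≤ n c := by
    intro c
    apply List.sum_nonneg
    intro z hz
    rw [List.mem_map] at hz
    obtain ⟨st, _, rfl⟩ := hz
    exact hhit0 st c
  have hsumle : ∀ (k : List Cell), (∀ c, c ∈ k → 0 ≤ n c) → 0 ≤ (k.map n).sum := by
    intro k hk
    apply List.sum_nonneg
    intro z hz
    rw [List.mem_map] at hz
    obtain ⟨c, hc, rfl⟩ := hz
    exact hk c hc
  have hntot : (inner.map n).sum + (outer.map n).sum = l.length := by
    rw [← List.sum_append, ← List.map_append, ← hcells, ← list_sum_comm]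
    have e : l.map (fun st => (s.cells.map fun c => st.hit R P c).sum) = l.map fun _ => (1 : ℝ) :=
      List.map_congr_left fun st hst => hone st hst
    rw [e]
    simp
  have hlen2 : (l.length : ℝ) ≤ 2 ^ s.m := by
    have : l.length ≤ 2 ^ s.m := by rw [← hs.inv.len]; omega
    exact_mod_cast this
  have hinnern : (inner.map n).sum ≤ 2 ^ s.m := by
    have := hsumle outer fun c _ => hn0 c
    linarith
  -- the error of an interval
  have herr : ∀ c, |(l.map fun st => st.hit R P c * (bit st.y - c.hi)).sum| ≤
      |(l.map fun st => st.err R P c).sum| + n c * (c.hi - c.lo) := by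
    intro c
    have e1 : (l.map fun st => st.hit R P c * (bit st.y - c.hi)).sum =
        -(l.map fun st => st.err R P c).sum -
          (l.map fun st => st.hit R P c * (c.hi - st.aux R P)).sum := by
      rw [← neg_one_mul, ← list_sum_mul_left, ← list_sum_sub]
      congr 1
      refine List.map_congr_left fun st _ => ?_
      unfold Step.err; ring
    have e2 : ∀ st : Step, 0 ≤ st.hit R P c * (c.hi - st.aux R P) ∧
        st.hit R P c * (c.hi - st.aux R P) ≤ (c.hi - c.lo) * st.hit R P c := by
      intro st
      unfold Step.hit
      rcases Cell.ind_zero_or_one c (st.aux R P) with ⟨h, _⟩ | ⟨h, hh⟩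
      · rw [h]; simp
      · rw [h]
        have h1 := Cell.has_le_hi hh
        have h2 := Cell.has_lo_le hh
        constructor <;> linarith
    have e3 := list_sum_le_sum l _ _ fun st _ => (e2 st).2
    rw [list_sum_mul_left] at e3
    have e4 : 0 ≤ (l.map fun st => st.hit R P c * (c.hi - st.aux R P)).sum := by
      apply List.sum_nonneg
      intro z hz
      rw [List.mem_map] at hz
      obtain ⟨st, _, rfl⟩ := hz
      exact (e2 st).1
    rw [e1]
    have h1 := le_abs_self (l.map fun st => st.err R P c).sum
    have h2 := neg_abs_le (l.map fun st => st.err R P c).sum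
    rw [abs_le]
    constructor
    · simp only [hn]; linarith
    · have : 0 ≤ n c * (c.hi - c.lo) := by simp only [hn]; linarith
      linarith
  -- inner intervals
  have hIn : (inner.map fun c => |(l.map fun st => st.hit R P c * (bit st.y - c.hi)).sum|).sum ≤
      1203 * (lamIn * 2 ^ s.m + N * P.iota / lamIn) + 2 ^ s.m * ((b - a) / N) := by
    have h1 : ∀ c ∈ inner, |(l.map fun st => st.hit R P c * (bit st.y - c.hi)).sum| ≤
        (1203 * lamIn + (b - a) / N) * n c + 1203 * (P.iota / lamIn) := by
      intro c hc
      have hc' : c ∈ s.cells := by rw [hcells]; exact List.mem_append_left _ hc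
      have h2 := (hconc' c hc' true (by rw [hlamIn]; exact hlamIn0)
        (by rw [hlamIn]; exact hlamIn1)).1
      rw [hlamIn] at h2
      have h3 := (mem_pieces ⟨a, b, true, true⟩ N N hab.le le_rfl hN c hc).2.2
      have h4 := herr c
      rw [h3] at h4
      simp only at h4
      have h5 : (l.map fun st => st.hit R P c).sum = n c := rfl
      rw [h5] at h2
      linarith
    refine (list_sum_le_sum _ _ _ h1).trans ?_
    rw [List.sum_map_add, list_sum_mul_left, list_sum_const, hinner, unifPart, pieces_length,
      ← unifPart, ← hinner]
    have h6 : 0 ≤ (b - a) / N := div_nonneg (by linarith) hN'.le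
    have h7 : (1203 * lamIn + (b - a) / N) * (inner.map n).sum ≤
        (1203 * lamIn + (b - a) / N) * 2 ^ s.m := by gcongr
    have h8 : (N : ℝ) * P.iota / lamIn = N * (P.iota / lamIn) := by ring
    rw [h8]
    linarith
  -- outer intervals
  obtain ⟨hgap, hgapsum⟩ := mem_bands K a b r xs (P.bandMax + 1) 1 hK hr le_rfl hxs0 hxs1
    (by
      intro h
      have h1 : a = y - 2 * r := by
        rcases max_choice 0 (y - 2 * r) with h2 | h2
        · rw [ha, Params.left, h2] at h; exact absurd h (lt_irrefl _)
        · exact h2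
      have := (abs_le.mp hyx).2
      linarith)
    (by
      intro h
      have h1 : b = y + 2 * r := by
        rcases min_choice 1 (y + 2 * r) with h2 | h2
        · rw [hb, Params.right, h2] at h; exact absurd h (lt_irrefl _)
        · exact h2
      have := (abs_le.mp hyx).1
      linarith)
  rw [one_mul] at hgapsum
  have hout : ∀ c ∈ outer, c ∈ s.cells ∧ lam false s.m c = μ * c.gap xs := by
    intro c hc
    obtain ⟨h1, h2, _⟩ := hgap c hc
    refine ⟨by rw [hcells]; exact List.mem_append_right _ hc, ?_⟩
    rw [hlamOut, min_eq_right h2, max_eq_right h1.le]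
  -- The quantity of the self-bounding argument: hits of outer intervals weighted by their distance
  -- from `xs`.
  set X := (outer.map fun c => c.gap xs * n c).sum with hX
  have hout2 : ∀ c ∈ outer, |(l.map fun st => st.err R P c).sum| ≤
        1203 * (μ * (c.gap xs * n c) + P.iota / μ * (1 / c.gap xs)) ∧
      |(l.map fun st => st.hit R P c * (st.q - bit st.y)).sum| ≤
        μ * (c.gap xs * n c) + P.iota / μ * (1 / c.gap xs) := by
    intro c hc
    obtain ⟨h1, h2⟩ := hout c hc
    obtain ⟨h3, h4, _⟩ := hgap c hc
    have h5 := hconc' c h1 false (by rw [h2]; positivity) (by rw [h2]; nlinarith)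
    rw [h2] at h5
    have e1 : P.iota / (μ * c.gap xs) = P.iota / μ * (1 / c.gap xs) := by
      rw [div_mul_div_comm, mul_one]
    rw [e1, mul_assoc] at h5
    exact h5
  set Z := (outer.map fun c => 1 / c.gap xs).sum with hZ
  have hZle : P.iota / μ * Z ≤ 4 * (K * P.iota / (μ * r)) := by
    calc P.iota / μ * Z ≤ P.iota / μ * (4 * K / r) := by gcongr
      _ = _ := by field_simp
  refine ⟨X, ?_, ?_⟩
  · have h1 : ∀ c ∈ outer, c.gap xs * n c ≤
        1204 * (μ * (c.gap xs * n c)) + 1204 * (P.iota / μ * (1 / c.gap xs)) +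
        (l.map fun st => st.hit R P c * |st.q - xs|).sum := by
      intro c hc
      obtain ⟨h2, h3⟩ := hout2 c hc
      have e1 : (l.map fun st => st.hit R P c * (st.aux R P - xs)).sum =
          (l.map fun st => st.err R P c).sum
          - (l.map fun st => st.hit R P c * (st.q - bit st.y)).sum
          + (l.map fun st => st.hit R P c * (st.q - xs)).sum := by
        rw [← list_sum_sub, ← List.sum_map_add]
        congr 1
        refine List.map_congr_left fun st _ => ?_
        unfold Step.err; ring
      have e2 : |(l.map fun st => st.hit R P c * (st.q - xs)).sum| ≤
          (l.map fun st => st.hit R P c * |st.q - xs|).sum := by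
        refine (list_abs_sum_le _ _).trans (list_sum_le_sum _ _ _ fun st _ => ?_)
        rw [abs_mul, abs_of_nonneg (hhit0 st c)]
      -- All points of an outer interval lie on the same side of `xs`, so the signed sum has no
      -- cancellation.
      have e3 : c.gap xs * n c ≤ |(l.map fun st => st.hit R P c * (st.aux R P - xs)).sum| := by
        rw [hn, ← list_sum_mul_left]
        rcases c.gap_dir (x := xs) with hd | hd
        · refine le_trans (list_sum_le_sum _ _ _ fun st _ => ?_) (le_abs_self _)
          unfold Step.hit
          rcases Cell.ind_zero_or_one c (st.aux R P) with ⟨h, _⟩ | ⟨h, hh⟩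
          · rw [h]; simp
          · rw [h]; linarith [hd _ hh]
        · refine le_trans ?_ (neg_le_abs _)
          rw [← neg_one_mul, ← list_sum_mul_left]
          refine list_sum_le_sum _ _ _ fun st _ => ?_
          unfold Step.hit
          rcases Cell.ind_zero_or_one c (st.aux R P) with ⟨h, _⟩ | ⟨h, hh⟩
          · rw [h]; simp
          · rw [h]; linarith [hd _ hh]
      rw [e1] at e3
      have e4 := abs_add_le ((l.map fun st => st.err R P c).sum
          - (l.map fun st => st.hit R P c * (st.q - bit st.y)).sum)
          (l.map fun st => st.hit R P c * (st.q - xs)).sum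
      have e5 := abs_sub (l.map fun st => st.err R P c).sum
          (l.map fun st => st.hit R P c * (st.q - bit st.y)).sum
      linarith
    have h2 := list_sum_le_sum _ _ _ h1
    rw [List.sum_map_add, List.sum_map_add, list_sum_mul_left, list_sum_mul_left, list_sum_mul_left,
      list_sum_mul_left, ← list_sum_comm] at h2
    -- An auxiliary prediction lies in at most one outer interval, so every `|q - xs|` is counted at
    -- most once.
    have h3 : (l.map fun st => (outer.map fun c => st.hit R P c * |st.q - xs|).sum).sum ≤
        (l.map fun st => |st.q - xs|).sum := by
      refine list_sum_le_sum _ _ _ fun st hst => ?_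
      have h4 := hone st hst
      rw [hcells, indSum_append] at h4
      have h5 : 0 ≤ indSum inner (st.aux R P) := by
        apply List.sum_nonneg
        intro z hz
        rw [List.mem_map] at hz
        obtain ⟨c, _, rfl⟩ := hz
        exact Cell.ind_nonneg _ _
      have h6 : (outer.map fun c => st.hit R P c * |st.q - xs|).sum =
          |st.q - xs| * indSum outer (st.aux R P) := by
        rw [indSum, ← list_sum_mul_left]
        refine congrArg List.sum (List.map_congr_left fun c _ => ?_)
        unfold Step.hit; ring
      rw [h6]
      have := abs_nonneg (st.q - xs)
      nlinarith
    have h7 : 0 ≤ X := by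
      apply List.sum_nonneg
      intro z hz
      rw [List.mem_map] at hz
      obtain ⟨c, hc, rfl⟩ := hz
      exact mul_nonneg (hgap c hc).1.le (hn0 c)
    -- As `2408 = 2 * 1204`, the term `1204 μ X` is at most `X / 2` and moves to the left side;
    -- `9632 = 2 * 1204 * 4`.
    have h8 : μ * X ≤ 1 / 2408 * X := by gcongr
    linarith
  · refine (calError_le_cells R P s.cells l (fun st hst => by rw [(hinv st hst).2.1]; exact hsm)
      (fun st hst => (hinv st hst).2.2) hone).trans ?_
    rw [hcells, List.map_append, List.sum_append]
    have h1 : ∀ c ∈ outer, |(l.map fun st => st.hit R P c * (bit st.y - c.hi)).sum| ≤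
        (1203 * μ + 1 / K) * (c.gap xs * n c) + 1203 * (P.iota / μ) * (1 / c.gap xs) := by
      intro c hc
      have h2 := (hout2 c hc).1
      have h3 := herr c
      have h4 : n c * (c.hi - c.lo) ≤ n c * (c.gap xs / K) :=
        mul_le_mul_of_nonneg_left (hgap c hc).2.2 (hn0 c)
      have e : n c * (c.gap xs / K) = 1 / K * (c.gap xs * n c) := by ring
      rw [e] at h4
      linarith
    have h2 := list_sum_le_sum _ _ _ h1
    rw [List.sum_map_add, list_sum_mul_left, list_sum_mul_left, ← hX, ← hZ] at h2
    have e : X / K = 1 / K * X := by ring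
    rw [e]
    linarith

/-! ## The scales -/

/-- Upper bound for the number of inner pieces in epoch `m`. -/
def Params.piecesBound (P : Params) (m : ℕ) : ℝ :=
  1 + (2 ^ m) ^ (1 / 3 : ℝ) * (min 1 (4 * P.rad (2 ^ (m - 1)))) ^ (2 / 3 : ℝ) / P.iota ^ (1 / 3 : ℝ)

/-- Scale for the inner intervals. -/
def Params.scaleIn (P : Params) (m : ℕ) : ℝ :=
  min 1 (Real.sqrt (P.piecesBound m * P.iota / 2 ^ m) / 2)

/-- Relative scale for the outer intervals. -/
def Params.scaleOut (P : Params) (m : ℕ) : ℝ :=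
  min (1 / 2408) (Real.sqrt (P.bandCount * P.iota / 2 ^ m) / P.rad (2 ^ (m - 1)))

/-- The scales of all intervals. -/
def Params.scale (P : Params) (xs : ℝ) (w : Bool) (m : ℕ) (c : Cell) : ℝ :=
  if w then P.scaleIn m else P.scaleOut m * max 0 (min 1 (c.gap xs))

/-- Scale for the mean outcome of an epoch. -/
def Params.scaleMean (P : Params) (m : ℕ) : ℝ := min 1 (Real.sqrt (P.iota / 2 ^ m) / 2)

theorem Params.Ok.piecesBound_ge {P : Params} (hP : P.Ok) (m : ℕ) : 1 ≤ P.piecesBound m := by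
  have h1 := hP.iota
  have h2 := hP.rad_pos (sPrev := 2 ^ (m - 1)) (by positivity)
  have : 0 < min 1 (4 * P.rad (2 ^ (m - 1))) := lt_min one_pos (by positivity)
  unfold Params.piecesBound
  have : 0 ≤ (2 ^ m : ℝ) ^ (1 / 3 : ℝ) * (min 1 (4 * P.rad (2 ^ (m - 1)))) ^ (2 / 3 : ℝ) /
    P.iota ^ (1 / 3 : ℝ) := by positivity
  linarith

theorem Params.Ok.scaleIn_pos {P : Params} (hP : P.Ok) (m : ℕ) : 0 < P.scaleIn m := by
  have h1 := hP.piecesBound_ge m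
  have h2 := hP.iota
  unfold Params.scaleIn
  apply lt_min one_pos
  positivity

theorem Params.Ok.scaleOut_pos {P : Params} (hP : P.Ok) (m : ℕ) : 0 < P.scaleOut m := by
  have h1 : (0 : ℝ) < P.bandCount := by exact_mod_cast hP.bandCount_pos
  have h2 := hP.iota
  have h3 := hP.rad_pos (sPrev := 2 ^ (m - 1)) (by positivity)
  unfold Params.scaleOut
  apply lt_min (by norm_num)
  positivity

/-- A scale may depend on the epoch and the interval only. Therefore `scaleIn` is built from
`piecesBound` instead of the true number of pieces, which varies with the observed mean. The range
`[0, 1]` is what `super_err` and `super_outcome` need. -/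
theorem Params.Ok.scale_mem {P : Params} (hP : P.Ok) (xs : ℝ) (w : Bool) (m : ℕ) (c : Cell) :
    0 ≤ P.scale xs w m c ∧ P.scale xs w m c ≤ 1 := by
  unfold Params.scale
  split
  · exact ⟨(hP.scaleIn_pos m).le, min_le_left _ _⟩
  · have h1 := hP.scaleOut_pos m
    have h2 : P.scaleOut m ≤ 1 / 2408 := min_le_left _ _
    have h3 : 0 ≤ max 0 (min 1 (c.gap xs)) := le_max_left _ _
    have h4 : max 0 (min 1 (c.gap xs)) ≤ 1 := max_le zero_le_one (min_le_left _ _)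
    constructor
    · positivity
    · nlinarith

theorem Params.scaleMean_mem (P : Params) (m : ℕ) : 0 ≤ P.scaleMean m ∧ P.scaleMean m ≤ 1 :=
  ⟨le_min zero_le_one (by positivity), min_le_left _ _⟩

/-! ## Numerical estimates -/

theorem le_of_cube_le {a b : ℝ} (hb : 0 ≤ b) (h : a ^ 3 ≤ b ^ 3) : a ≤ b :=
  le_of_pow_le_pow_left₀ (by norm_num) hb h

theorem rpow_third_cube {x : ℝ} (hx : 0 ≤ x) : (x ^ (1 / 3 : ℝ)) ^ 3 = x := by
  rw [← Real.rpow_natCast, ← Real.rpow_mul hx]; norm_num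

theorem rpow_two_thirds {x : ℝ} (hx : 0 ≤ x) : x ^ (2 / 3 : ℝ) = (x ^ (1 / 3 : ℝ)) ^ 2 := by
  rw [← Real.rpow_natCast, ← Real.rpow_mul hx]; norm_num

/-- The real number whose ceiling is the number of pieces of a band. -/
def Params.kappa (P : Params) : ℝ := ((1 + P.C) * (1 + P.C) / (P.iota * P.T)) ^ (1 / 3 : ℝ)

/-- The leading term `(ι T C)^(1/3)`. -/
def Params.main (P : Params) : ℝ := (P.iota * P.T * P.C) ^ (1 / 3 : ℝ)

theorem Params.Ok.T_pos {P : Params} (hP : P.Ok) : (0 : ℝ) < P.T := by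
  have := hP.T; exact_mod_cast (by omega : 0 < P.T)

theorem Params.Ok.kappa_pos {P : Params} (hP : P.Ok) : 0 < P.kappa := by
  have := hP.iota; have := hP.C0; have := hP.T_pos
  unfold Params.kappa; positivity

theorem Params.Ok.kappa_cube {P : Params} (hP : P.Ok) :
    P.kappa ^ 3 = (1 + P.C) ^ 2 / (P.iota * P.T) := by
  have := hP.iota; have := hP.C0; have := hP.T_pos
  unfold Params.kappa
  rw [rpow_third_cube (by positivity), sq]

theorem Params.Ok.main_cube {P : Params} (hP : P.Ok) : P.main ^ 3 = P.iota * P.T * P.C := by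
  have := hP.iota; have := hP.C0; have := hP.T_pos
  unfold Params.main
  rw [rpow_third_cube (by positivity)]

theorem Params.Ok.main_nonneg {P : Params} (hP : P.Ok) : 0 ≤ P.main := by
  have := hP.iota; have := hP.C0; have := hP.T_pos
  unfold Params.main; positivity

/-- The cost of rounding outer predictions, and the reason for the choice of `K`: the cube of the
left side is `ι T C³ / (1 + C)²`. -/
theorem Params.Ok.C_div_kappa {P : Params} (hP : P.Ok) : P.C / P.kappa ≤ P.main := by
  have hi := hP.iota; have hC := hP.C0; have hT := hP.T_pos
  apply le_of_cube_le hP.main_nonneg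
  rw [div_pow, hP.kappa_cube, hP.main_cube, div_div_eq_mul_div, div_le_iff₀ (by positivity)]
  have h : P.C ^ 2 ≤ (1 + P.C) ^ 2 := by gcongr; linarith
  have h2 : 0 ≤ P.C * (P.iota * P.T) := by positivity
  nlinarith

theorem Params.bandCount_le {P : Params} (hP : P.Ok) : (P.bandCount : ℝ) ≤ P.kappa + 1 :=
  (Nat.ceil_lt_add_one hP.kappa_pos.le).le

theorem Params.kappa_le (P : Params) : P.kappa ≤ P.bandCount := Nat.le_ceil _

/-- The three quantities that bound the error of an epoch of length `S`. -/
theorem numeric_bounds {P : Params} (hP : P.Ok) (S r b : ℝ) (hS : 0 < S) (hST : S ≤ 2 * P.T)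
    (hr : r = Real.sqrt (P.iota / (S / 2)) + P.C / (S / 2)) (hb0 : 0 ≤ b)
    (hb : b ^ 3 = P.iota * S * P.C) :
    P.iota / r ≤ Real.sqrt (P.iota * S) ∧
    P.kappa * P.iota / r ≤ 2 * Real.sqrt (P.iota * S) + 2 * b ∧
    Real.sqrt (P.kappa * P.iota * S) ≤ 2 * Real.sqrt (P.iota * S) + 2 * b ∧
    S * P.C / S ≤ S * r / 2 ∧
    S ^ 2 * (4 * r) * P.iota ≤ (2 * Real.sqrt (P.iota * S) + 2 * b) ^ 3 := by
  have hi := hP.iota; have hC := hP.C0; have hT := hP.T_pos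
  have hT2 : (2 : ℝ) ≤ P.T := by exact_mod_cast hP.T
  set i := P.iota
  set C := P.C
  set T : ℝ := (P.T : ℝ)
  set α := Real.sqrt (i * S) with hα
  have hα2 : α ^ 2 = i * S := Real.sq_sqrt (by positivity)
  have hα0 : 0 < α := Real.sqrt_pos.mpr (by positivity)
  set ρ := Real.sqrt (i / (S / 2)) with hρ
  have hρ2 : ρ ^ 2 * S = 2 * i := by
    rw [hρ, Real.sq_sqrt (by positivity)]; field_simp
  have hρ0 : 0 < ρ := Real.sqrt_pos.mpr (by positivity)
  have hCS : 0 ≤ C / (S / 2) := by positivity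
  have hrρ : ρ ≤ r := by linarith
  have hr0 : 0 < r := by linarith
  have hrC : 2 * C ≤ S * r := by
    have : C / (S / 2) ≤ r := by linarith
    rw [div_le_iff₀ (by positivity)] at this
    linarith
  have hr2 : 2 * i ≤ r ^ 2 * S := by
    rw [← hρ2]; gcongr
  have h1 : i / r ≤ α := by
    rw [div_le_iff₀ hr0]
    apply le_of_pow_le_pow_left₀ (n := 2) (by norm_num) (by positivity)
    rw [mul_pow, hα2]
    nlinarith
  have hk := hP.kappa_cube
  have hk0 := hP.kappa_pos
  set κ := P.kappa
  have hcase : κ ≤ 2 ∨ 1 ≤ C := by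
    rcases le_total 1 C with h | h
    · exact Or.inr h
    · left
      apply le_of_cube_le (by norm_num)
      rw [hk, div_le_iff₀ (by positivity)]
      nlinarith
  refine ⟨h1, ?_, ?_, ?_, ?_⟩
  · rcases hcase with h | h
    · have : κ * i / r ≤ 2 * (i / r) := by
        rw [mul_div_assoc]; gcongr
      linarith
    · have h2 : κ * i / r ≤ 2 * b := by
        apply le_of_cube_le (by positivity)
        rw [div_pow, mul_pow, hk, mul_pow, hb, div_le_iff₀ (by positivity)]
        have e1 : (1 + C) ^ 2 / (i * T) * i ^ 3 = (1 + C) ^ 2 * i ^ 2 / T := by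
          field_simp
        rw [e1, div_le_iff₀ hT]
        have h3 : (1 + C) ^ 2 ≤ 4 * C ^ 2 := by nlinarith
        -- Both summands of `r` are used at once: `2 C ≤ S r` from the drift part and `2 ι ≤ r² S`
        -- from the noise part.
        have h4 : 4 * (C * i) ≤ S ^ 2 * r ^ 3 := by
          calc 4 * (C * i) = (2 * C) * (2 * i) := by ring
            _ ≤ (S * r) * (r ^ 2 * S) := by gcongr
            _ = S ^ 2 * r ^ 3 := by ring
        have h5 : S * (S ^ 2 * r ^ 3) ≤ (2 * T) * (S ^ 2 * r ^ 3) := by gcongr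
        have h6 : (2 : ℝ) ^ 3 * (i * S * C) * r ^ 3 * T * S =
            4 * (i * C) * ((2 * T) * (S ^ 2 * r ^ 3)) := by ring
        have h7 : 4 * (i * C) * (S * (4 * (C * i))) ≤ 2 ^ 3 * (i * S * C) * r ^ 3 * T * S := by
          rw [h6]
          have : S * (4 * (C * i)) ≤ (2 * T) * (S ^ 2 * r ^ 3) := by
            refine le_trans ?_ h5; gcongr
          gcongr
        have h8 : (4 * C ^ 2 * i ^ 2) * S ≤ 2 ^ 3 * (i * S * C) * r ^ 3 * T * S := by
          refine le_trans ?_ h7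
          have : 0 ≤ C ^ 2 * i ^ 2 * S := by positivity
          nlinarith
        have h9 := le_of_mul_le_mul_right h8 hS
        refine le_trans ?_ h9
        gcongr
      linarith
  · rcases hcase with h | h
    · have : Real.sqrt (κ * i * S) ≤ 2 * α := by
        apply Real.sqrt_le_iff.mpr ⟨by positivity, ?_⟩
        rw [mul_pow, hα2, mul_assoc]
        have : 0 < i * S := by positivity
        nlinarith
      linarith
    · have : Real.sqrt (κ * i * S) ≤ 2 * b := by
        apply Real.sqrt_le_iff.mpr ⟨by positivity, ?_⟩
        apply le_of_cube_le (by positivity)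
        have e2 : ((2 * b) ^ 2) ^ 3 = 64 * (b ^ 3) ^ 2 := by ring
        rw [e2, hb, mul_pow, mul_pow, hk]
        have e1 : (1 + C) ^ 2 / (i * T) * i ^ 3 * S ^ 3 = (1 + C) ^ 2 * i ^ 2 * S ^ 3 / T := by
          field_simp
        rw [e1, div_le_iff₀ hT]
        have h3 : (1 + C) ^ 2 ≤ 4 * C ^ 2 := by nlinarith
        calc (1 + C) ^ 2 * i ^ 2 * S ^ 3 ≤ 4 * C ^ 2 * i ^ 2 * S ^ 3 := by gcongr
          _ = 4 * C ^ 2 * i ^ 2 * S ^ 2 * S := by ring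
          _ ≤ 4 * C ^ 2 * i ^ 2 * S ^ 2 * (2 * T) := by gcongr
          _ ≤ 64 * (i * S * C) ^ 2 * T := by
              have : 0 ≤ C ^ 2 * i ^ 2 * S ^ 2 * T := by positivity
              nlinarith
      linarith
  · rw [mul_div_cancel_left₀ _ hS.ne']; linarith
  -- The two summands of `r` contribute separately: the noise part is bounded by a multiple of `(√(ι
  -- S))³`, and the drift part is exactly `8 b³`.
  · have e : S ^ 2 * (4 * r) * i = 4 * (S ^ 2 * ρ * i) + 8 * (i * S * C) := by
      rw [hr]; field_simp; ring
    have h2 : S ^ 2 * ρ * i ≤ 2 * α ^ 3 := by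
      apply le_of_pow_le_pow_left₀ (n := 2) (by norm_num) (by positivity)
      have e3 : (S ^ 2 * ρ * i) ^ 2 = S ^ 3 * (ρ ^ 2 * S) * i ^ 2 := by ring
      have e4 : (2 * α ^ 3) ^ 2 = 4 * (α ^ 2) ^ 3 := by ring
      rw [e3, e4, hρ2, hα2]
      have h5 : 0 ≤ i ^ 3 * S ^ 3 := by positivity
      have e6 : S ^ 3 * (2 * i) * i ^ 2 = 2 * (i ^ 3 * S ^ 3) := by ring
      have e7 : 4 * (i * S) ^ 3 = 4 * (i ^ 3 * S ^ 3) := by ring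
      rw [e6, e7]
      linarith only [h5]
    rw [e, ← hb]
    have h3 : 0 ≤ α ^ 2 * b := by positivity
    have h4 : 0 ≤ α * b ^ 2 := by positivity
    have e5 : (2 * α + 2 * b) ^ 3 = 8 * α ^ 3 + 24 * (α ^ 2 * b) + 24 * (α * b ^ 2) + 8 * b ^ 3 := by
      ring
    rw [e5]
    linarith only [h2, h3, h4]

set_option maxHeartbeats 1000000 in
/-- The error that the inner intervals cause in an epoch. -/
theorem inner_numeric {P : Params} (hP : P.Ok) (m : ℕ) (hm : 2 ≤ m) (hS : P.iota ≤ 2 ^ m)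
    (hST : (2 : ℝ) ^ m ≤ 2 * P.T) (y b : ℝ) (hy0 : 0 ≤ y) (hy1 : y ≤ 1) (hb0 : 0 ≤ b)
    (hb : b ^ 3 = P.iota * 2 ^ m * P.C) :
    P.scaleIn m * 2 ^ m + P.pieceCount (2 ^ (m - 1)) (2 ^ m) y * P.iota / P.scaleIn m ≤
      5 / 2 * (3 * Real.sqrt (P.iota * 2 ^ m) + 2 * b) ∧
    2 ^ m * ((P.right (2 ^ (m - 1)) y - P.left (2 ^ (m - 1)) y) /
      P.pieceCount (2 ^ (m - 1)) (2 ^ m) y) ≤ 2 * Real.sqrt (P.iota * 2 ^ m) + 2 * b := by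
  have hi := hP.iota; have hC := hP.C0; have hT := hP.T_pos
  have hp1 : (0 : ℝ) < 2 ^ (m - 1) := by positivity
  have hhalf : (2 : ℝ) ^ (m - 1) = 2 ^ m / 2 := by
    rw [eq_div_iff (by norm_num), ← pow_succ]; congr 1; omega
  have hS0 : (0 : ℝ) < 2 ^ m := by positivity
  have hr0 := hP.rad_pos hp1
  have hrdef : P.rad (2 ^ (m - 1)) = Real.sqrt (P.iota / (2 ^ m / 2)) + P.C / (2 ^ m / 2) := by
    rw [← hhalf]; rfl
  obtain ⟨n1, n2, n3, n4, n5⟩ := numeric_bounds hP (2 ^ m) _ b hS0 hST hrdef hb0 hb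
  have hab := hP.left_lt_right hp1 hy0 hy1
  have hN1 := hP.pieceCount_pos hp1 hS0 hy0 hy1
  have hpb := hP.piecesBound_ge m
  have hwle : P.right (2 ^ (m - 1)) y - P.left (2 ^ (m - 1)) y ≤
      min 1 (4 * P.rad (2 ^ (m - 1))) := by
    have h1 : P.right (2 ^ (m - 1)) y ≤ 1 := min_le_left _ _
    have h2 : 0 ≤ P.left (2 ^ (m - 1)) y := le_max_left _ _
    have h3 : P.right (2 ^ (m - 1)) y ≤ y + 2 * P.rad (2 ^ (m - 1)) := min_le_right _ _
    have h4 : y - 2 * P.rad (2 ^ (m - 1)) ≤ P.left (2 ^ (m - 1)) y := le_max_right _ _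
    apply le_min <;> linarith
  have hNle : (P.pieceCount (2 ^ (m - 1)) (2 ^ m) y : ℝ) ≤ P.piecesBound m := by
    have h0 : 0 ≤ P.right (2 ^ (m - 1)) y - P.left (2 ^ (m - 1)) y := by linarith
    unfold Params.pieceCount Params.piecesBound
    refine (Nat.ceil_lt_add_one (by positivity)).le.trans ?_
    rw [add_comm]
    gcongr
  have hNge : (2 ^ m : ℝ) ^ (1 / 3 : ℝ) * (P.right (2 ^ (m - 1)) y - P.left (2 ^ (m - 1)) y)
      ^ (2 / 3 : ℝ) / P.iota ^ (1 / 3 : ℝ) ≤ P.pieceCount (2 ^ (m - 1)) (2 ^ m) y := Nat.le_ceil _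
  set S : ℝ := 2 ^ m with hSdef
  set r := P.rad (2 ^ (m - 1)) with hr
  set i := P.iota with hidef
  set d := P.right (2 ^ (m - 1)) y - P.left (2 ^ (m - 1)) y with hd
  have hd0 : 0 < d := by linarith
  set N : ℝ := (P.pieceCount (2 ^ (m - 1)) S y : ℝ) with hN
  have hN1' : 1 ≤ N := by rw [hN]; exact_mod_cast hN1
  set α := Real.sqrt (i * S) with hα
  have hα2 : α ^ 2 = i * S := Real.sq_sqrt (by positivity)
  have hα0 : 0 < α := Real.sqrt_pos.mpr (by positivity)
  -- With cube roots as variables, all fractional powers become polynomial.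
  set t := S ^ (1 / 3 : ℝ) with ht
  set j := i ^ (1 / 3 : ℝ) with hj
  set w := min 1 (4 * r) with hw
  have hw0 : 0 < w := lt_min one_pos (by positivity)
  have ht0 : 0 < t := by positivity
  have hj0 : 0 < j := by positivity
  have ht3 : t ^ 3 = S := rpow_third_cube hS0.le
  have hj3 : j ^ 3 = i := rpow_third_cube (by positivity)
  set v := w ^ (1 / 3 : ℝ) with hv
  have hv0 : 0 < v := by positivity
  have hv3 : v ^ 3 = w := rpow_third_cube hw0.le
  set e := d ^ (1 / 3 : ℝ) with he
  have he0 : 0 < e := by positivity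
  have he3 : e ^ 3 = d := rpow_third_cube hd0.le
  have hev : e ≤ v := by rw [he, hv]; gcongr
  have hpbeq : P.piecesBound m = 1 + t * v ^ 2 / j := by
    unfold Params.piecesBound
    rw [rpow_two_thirds hw0.le]
  rw [rpow_two_thirds hd0.le] at hNge
  -- `t² v j = (S² w ι)^(1/3)` is the common size of the two inner costs, `√(N ι S)` and `S w / N`,
  -- at the balancing value of `N`.
  have hY : t ^ 2 * v * j ≤ 2 * α + 2 * b := by
    apply le_of_cube_le (by positivity)
    refine le_trans ?_ n5
    have e1 : (t ^ 2 * v * j) ^ 3 = (t ^ 3) ^ 2 * v ^ 3 * j ^ 3 := by ring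
    rw [e1, ht3, hv3, hj3]
    gcongr
    exact min_le_right _ _
  -- Since `ι ≤ S`, the cap 1 in `scaleIn` is not active.
  have hsmall : P.piecesBound m * i ≤ 4 * S := by
    rw [hpbeq]
    have hjt : j ≤ t := by rw [hj, ht]; gcongr
    have hv1 : v ≤ 1 := Real.rpow_le_one hw0.le (min_le_left _ _) (by norm_num)
    have h1 : t * v ^ 2 / j * i ≤ S := by
      rw [← hj3, ← ht3]
      have : t * v ^ 2 / j * j ^ 3 = t * v ^ 2 * j ^ 2 := by field_simp
      rw [this]
      calc t * v ^ 2 * j ^ 2 ≤ t * 1 ^ 2 * t ^ 2 := by gcongr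
        _ = t ^ 3 := by ring
    have h2 : (1 + t * v ^ 2 / j) * i = i + t * v ^ 2 / j * i := by ring
    linarith only [h1, h2, hS, hS0]
  have hlamEq : P.scaleIn m = Real.sqrt (P.piecesBound m * i / S) / 2 := by
    unfold Params.scaleIn
    apply min_eq_right
    rw [div_le_one (by norm_num)]
    apply Real.sqrt_le_iff.mpr ⟨by norm_num, ?_⟩
    rw [div_le_iff₀ hS0]; linarith
  have hroot : Real.sqrt (P.piecesBound m * i * S) ≤ α + t ^ 2 * v * j := by
    apply Real.sqrt_le_iff.mpr ⟨by positivity, ?_⟩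
    have e1 : (1 + t * v ^ 2 / j) * i * S = α ^ 2 + (t ^ 2 * v * j) ^ 2 := by
      rw [hα2, ← ht3, ← hj3]; field_simp
    rw [hpbeq, e1]
    have h0 : 0 ≤ α * (t ^ 2 * v * j) := by positivity
    linarith only [h0, sq (α + t ^ 2 * v * j), add_sq α (t ^ 2 * v * j)]
  set β := Real.sqrt (P.piecesBound m * i * S) with hβ
  have hβ2 : β ^ 2 = P.piecesBound m * i * S := Real.sq_sqrt (by positivity)
  have hβ0 : 0 < β := Real.sqrt_pos.mpr (by positivity)
  have hlamβ : P.scaleIn m = β / S / 2 := by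
    rw [hlamEq]
    congr 1
    rw [eq_div_iff hS0.ne', hβ]
    rw [← Real.sqrt_sq hS0.le, ← Real.sqrt_mul (by positivity), Real.sqrt_sq hS0.le]
    congr 1
    field_simp
  -- With `λ = β / (2 S)` the two terms are `β / 2` and at most `2 β`.
  have hin1 : P.scaleIn m * S + N * i / P.scaleIn m ≤ 5 / 2 * β := by
    have h1 : P.scaleIn m * S = β / 2 := by rw [hlamβ]; field_simp
    have h2 : N * i / P.scaleIn m ≤ 2 * β := by
      rw [hlamβ, div_le_iff₀ (by positivity)]
      have e1 : 2 * β * (β / S / 2) = β ^ 2 / S := by ring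
      rw [e1, hβ2, mul_div_assoc, div_self hS0.ne', mul_one]
      gcongr
    linarith
  have hin2 : S * (d / N) ≤ t ^ 2 * v * j := by
    have h1 : 0 < t * e ^ 2 / j := by positivity
    calc S * (d / N) ≤ S * (d / (t * e ^ 2 / j)) := by gcongr
      _ = t ^ 2 * e * j := by rw [← ht3, ← he3]; field_simp
      _ ≤ t ^ 2 * v * j := by gcongr
  constructor
  · linarith only [hin1, hroot, hY, hb0, hα0]
  · linarith only [hin2, hY]

/-- The error that the outer intervals cause in an epoch. -/
theorem outer_numeric {P : Params} (hP : P.Ok) (m : ℕ) (hm : 2 ≤ m)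
    (hST : (2 : ℝ) ^ m ≤ 2 * P.T) (b Cm X : ℝ) (hb0 : 0 ≤ b)
    (hb : b ^ 3 = P.iota * 2 ^ m * P.C) (hCm0 : 0 ≤ Cm) (hCm : Cm ≤ P.C)
    (hX : X ≤ 2 * Cm +
        9632 * (P.bandCount * P.iota / (P.scaleOut m * P.rad (2 ^ (m - 1))))) :
    P.bandCount * P.iota / (P.scaleOut m * P.rad (2 ^ (m - 1))) ≤
      2409 * (3 * Real.sqrt (P.iota * 2 ^ m) + 2 * b) ∧
    P.scaleOut m * X ≤ 9638 * (3 * Real.sqrt (P.iota * 2 ^ m) + 2 * b) ∧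
    X / P.bandCount ≤ 2 * (Cm / P.kappa) +
      9632 * (2409 * (3 * Real.sqrt (P.iota * 2 ^ m) + 2 * b)) := by
  have hi := hP.iota; have hC := hP.C0; have hT := hP.T_pos
  have hp1 : (0 : ℝ) < 2 ^ (m - 1) := by positivity
  have hhalf : (2 : ℝ) ^ (m - 1) = 2 ^ m / 2 := by
    rw [eq_div_iff (by norm_num), ← pow_succ]; congr 1; omega
  have hS0 : (0 : ℝ) < 2 ^ m := by positivity
  have hr0 := hP.rad_pos hp1
  have hrdef : P.rad (2 ^ (m - 1)) = Real.sqrt (P.iota / (2 ^ m / 2)) + P.C / (2 ^ m / 2) := by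
    rw [← hhalf]; rfl
  obtain ⟨n1, n2, n3, n4, n5⟩ := numeric_bounds hP (2 ^ m) _ b hS0 hST hrdef hb0 hb
  have hK1 : (1 : ℝ) ≤ P.bandCount := by exact_mod_cast hP.bandCount_pos
  have hKk := Params.bandCount_le hP
  have hkK := P.kappa_le
  have hk0 := hP.kappa_pos
  set S : ℝ := 2 ^ m with hSdef
  set r := P.rad (2 ^ (m - 1)) with hr
  set i := P.iota with hidef
  set K : ℝ := (P.bandCount : ℝ) with hK
  set α := Real.sqrt (i * S) with hα
  have hα2 : α ^ 2 = i * S := Real.sq_sqrt (by positivity)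
  have hα0 : 0 < α := Real.sqrt_pos.mpr (by positivity)
  set μ := P.scaleOut m with hμ
  have hμ0 : 0 < μ := hP.scaleOut_pos m
  have hμ1 : μ ≤ 1 / 2408 := min_le_left _ _
  set γ := Real.sqrt (K * i * S) with hγ
  have hγ2 : γ ^ 2 = K * i * S := Real.sq_sqrt (by positivity)
  have hγ0 : 0 < γ := Real.sqrt_pos.mpr (by positivity)
  have hγle : γ ≤ 3 * α + 2 * b := by
    have h1 : γ ≤ Real.sqrt (P.kappa * i * S) + α := by
      apply Real.sqrt_le_iff.mpr ⟨by positivity, ?_⟩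
      have h2 : Real.sqrt (P.kappa * i * S) ^ 2 = P.kappa * i * S := Real.sq_sqrt (by positivity)
      have h3 : 0 ≤ Real.sqrt (P.kappa * i * S) * α := by positivity
      have h4 : K * (i * S) ≤ (P.kappa + 1) * (i * S) := by gcongr
      linarith only [h2, h3, h4, hα2, add_sq (Real.sqrt (P.kappa * i * S)) α]
    linarith
  have hγS : Real.sqrt (K * i / S) = γ / S := by
    rw [eq_div_iff hS0.ne', hγ]
    nth_rewrite 2 [← Real.sqrt_sq hS0.le]
    rw [← Real.sqrt_mul (by positivity)]
    congr 1
    field_simp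
  have hμdef : μ = min (1 / 2408) (γ / S / r) := by rw [hμ, Params.scaleOut, ← hγS]
  set D := K * i / (μ * r) with hD
  have hD0 : 0 < D := by positivity
  have hKir : K * i / r ≤ 3 * α + 2 * b := by
    have : K * i / r ≤ (P.kappa + 1) * i / r := by gcongr
    have e1 : (P.kappa + 1) * i / r = P.kappa * i / r + i / r := by ring
    linarith
  -- If the cap of `scaleOut` is active, `D` is `2408 K ι / r`; otherwise `μ = γ / (S r)` gives
  -- exactly `D = γ`.
  have hDle : D ≤ 2408 * (K * i / r) + γ := by
    rcases min_choice (1 / 2408) (γ / S / r) with h | h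
    · have : D = 2408 * (K * i / r) := by rw [hD, hμdef, h]; field_simp
      linarith
    · have : D = γ := by
        rw [hD, hμdef, h]
        have : K * i = γ ^ 2 / S := by rw [hγ2]; field_simp
        rw [this]; field_simp
      have : 0 ≤ K * i / r := by positivity
      linarith
  -- The drift part of `r` gives `C ≤ S r / 2`, which cancels the `r` in the denominator of `μ`.
  have hμC : μ * Cm ≤ γ := by
    have h1 : μ ≤ γ / S / r := by rw [hμdef]; exact min_le_right _ _
    have h2 : Cm ≤ S * r / 2 := by
      rw [mul_div_cancel_left₀ _ hS0.ne'] at n4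
      linarith
    calc μ * Cm ≤ γ / S / r * (S * r / 2) := by gcongr
      _ = γ / 2 := by field_simp
      _ ≤ γ := by linarith
  have hμX : μ * X ≤ 2 * γ + 4 * D := by
    have h1 : μ * X ≤ μ * (2 * Cm + 9632 * D) := by gcongr
    have h2 : μ * D ≤ 1 / 2408 * D := by gcongr
    linarith
  have hXK : X / K ≤ 2 * (Cm / P.kappa) + 9632 * D := by
    have h1 : X / K ≤ (2 * Cm + 9632 * D) / K := by gcongr
    have h2 : Cm / K ≤ Cm / P.kappa := by gcongr
    have h3 : D / K ≤ D := div_le_self hD0.le hK1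
    have e1 : (2 * Cm + 9632 * D) / K = 2 * (Cm / K) + 9632 * (D / K) := by ring
    linarith
  refine ⟨?_, ?_, ?_⟩
  · linarith only [hDle, hKir, hγle]
  · linarith only [hμX, hDle, hKir, hγle]
  · linarith only [hXK, hDle, hKir, hγle]

/-- The numerical part of the bound for an epoch. -/
theorem epoch_numeric {P : Params} (hP : P.Ok) (m : ℕ) (hm : 2 ≤ m) (hS : P.iota ≤ 2 ^ m)
    (hST : (2 : ℝ) ^ m ≤ 2 * P.T) (y b Cm X E : ℝ) (hy0 : 0 ≤ y) (hy1 : y ≤ 1) (hb0 : 0 ≤ b)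
    (hb : b ^ 3 = P.iota * 2 ^ m * P.C) (hCm0 : 0 ≤ Cm) (hCm : Cm ≤ P.C)
    (hX : X ≤ 2 * Cm +
        9632 * (P.bandCount * P.iota / (P.scaleOut m * P.rad (2 ^ (m - 1)))))
    (hE : E ≤ 1203 * (P.scaleIn m * 2 ^ m +
        P.pieceCount (2 ^ (m - 1)) (2 ^ m) y * P.iota / P.scaleIn m)
      + 2 ^ m * ((P.right (2 ^ (m - 1)) y - P.left (2 ^ (m - 1)) y) /
          P.pieceCount (2 ^ (m - 1)) (2 ^ m) y)
      + 1203 * (P.scaleOut m * X +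
          4 * (P.bandCount * P.iota / (P.scaleOut m * P.rad (2 ^ (m - 1)))))
      + X / P.bandCount) :
    E ≤ 10 ^ 9 * (Real.sqrt (P.iota * 2 ^ m) + b + Cm / P.kappa) := by
  obtain ⟨i1, i2⟩ := inner_numeric hP m hm hS hST y b hy0 hy1 hb0 hb
  obtain ⟨o1, o2, o3⟩ := outer_numeric hP m hm hST b Cm X hb0 hb hCm0 hCm hX
  have hCk : 0 ≤ Cm / P.kappa := div_nonneg hCm0 hP.kappa_pos.le
  have hα : 0 ≤ Real.sqrt (P.iota * 2 ^ m) := Real.sqrt_nonneg _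
  linarith

/-! ## Summation over the epochs -/

/-- The mean outcome of a complete epoch is close to the centre of the means. -/
theorem mean_close (R : Routines) {P : Params} (hP : P.Ok) (lam : Bool → ℕ → Cell → ℝ)
    (xs x : ℝ) (hxs0 : 0 ≤ xs) (hxs1 : xs ≤ 1) (hx : x ≤ P.iota / 4) (s : State)
    (hs : StateInv P s) (h0 : s.idx = 0) (l : List Step) (hlen : l.length = s.len)
    (hm : ∀ st ∈ l, st.s.m = s.m)
    (hconc : ∀ σ, (l.map (pot R P lam P.scaleMean (s.m, 0, true, σ, 3))).sum ≤ x)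
    (hC : (l.map fun st => |st.q - xs|).sum ≤ P.C) :
    |(s.ones + (l.map fun st => bit st.y).sum) / s.len - xs| ≤ P.rad (2 ^ s.m) := by
  have hi := hP.iota
  have hC0 := hP.C0
  have hones : s.ones = 0 := by
    have h1 := hs.ones0
    have h2 := hs.ones1
    rw [h0] at h2
    simp only [Nat.cast_zero] at h2
    linarith
  have hn : (s.len : ℝ) = 2 ^ s.m := by rw [hs.len]; push_cast; rfl
  rw [hones, zero_add, hn]
  have hl : (l.length : ℝ) = 2 ^ s.m := by rw [hlen, hn]
  set n : ℝ := 2 ^ s.m with hndef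
  have hn0 : 0 < n := by positivity
  have hsum0 : 0 ≤ (l.map fun st => bit st.y).sum := by
    apply List.sum_nonneg
    intro z hz
    rw [List.mem_map] at hz
    obtain ⟨st, _, rfl⟩ := hz
    exact bit_nonneg _
  have hsum1 : (l.map fun st => bit st.y).sum ≤ n := by
    have := list_sum_le_sum l (fun st => bit st.y) (fun _ => 1) fun st _ => bit_le_one _
    rw [list_sum_const] at this
    linarith
  set w := Real.sqrt (P.iota / n) with hw
  have hw2 : w ^ 2 * n = P.iota := by
    rw [hw, Real.sq_sqrt (by positivity)]; field_simp
  have hw0 : 0 < w := Real.sqrt_pos.mpr (by positivity)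
  have hrad : P.rad n = w + P.C / n := rfl
  rw [hrad]
  have hCn : 0 ≤ P.C / n := by positivity
  set Y := (l.map fun st => bit st.y).sum with hY
  -- For `w ≥ 2` the radius exceeds 1 and nothing is to be shown; for `w < 2` the cap of `scaleMean`
  -- is inactive.
  rcases le_or_gt 2 w with h2 | h2
  · have e1 : Y / n ≤ 1 := (div_le_one hn0).mpr hsum1
    have e2 : 0 ≤ Y / n := by positivity
    rw [abs_le]
    constructor <;> linarith
  · have hlam : P.scaleMean s.m = w / 2 := by
      unfold Params.scaleMean
      exact min_eq_right (by linarith)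
    have hpot : ∀ σ, sgnOf σ * (w / 2) * (l.map fun st => st.q - bit st.y).sum - n * (w / 2) ^ 2
        ≤ x := by
      intro σ
      have h := hconc σ
      have e : l.map (pot R P lam P.scaleMean (s.m, 0, true, σ, 3)) =
          l.map fun st => sgnOf σ * (w / 2) * (st.q - bit st.y) - (w / 2) ^ 2 :=
        List.map_congr_left fun st hst => by simp [pot, hm st hst, hlam]
      rw [e, list_sum_sub, list_sum_mul_left, list_sum_const, hl] at h
      exact h
    set D := (l.map fun st => st.q - bit st.y).sum with hD
    have p1 := hpot true
    have p2 := hpot false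
    simp only [sgnOf, if_true, Bool.false_eq_true, if_false] at p1 p2
    -- The threshold `ι / 4 = n (w/2)²` equals the variance term, so `(w/2) |D| ≤ w² n / 2`.
    have hDabs : |D| ≤ w * n := by
      rw [abs_le]
      constructor
      · have : w * (-D) ≤ w * (w * n) := by nlinarith
        have := le_of_mul_le_mul_left this hw0
        linarith
      · have : w * D ≤ w * (w * n) := by nlinarith
        exact le_of_mul_le_mul_left this hw0
    have hDX : |(l.map fun st => st.q - xs).sum| ≤ P.C := (list_abs_sum_le _ _).trans hC
    have e : Y / n - xs = ((l.map fun st => st.q - xs).sum - D) / n := by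
      rw [hD, list_sum_sub, list_sum_sub, list_sum_const, hl, hY]
      field_simp
      ring
    rw [e, abs_div, abs_of_pos hn0, div_le_iff₀ hn0]
    have := abs_sub (l.map fun st => st.q - xs).sum D
    have e3 : (w + P.C / n) * n = w * n + P.C := by field_simp
    linarith

/-- Share of an epoch in the leading term. -/
def Params.share (P : Params) (m : ℕ) : ℝ := P.main * (2 ^ m / P.T) ^ (1 / 3 : ℝ)

theorem Params.Ok.share_nonneg {P : Params} (hP : P.Ok) (m : ℕ) : 0 ≤ P.share m := by
  have := hP.main_nonneg; have := hP.T_pos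
  unfold Params.share; positivity

theorem Params.Ok.share_cube {P : Params} (hP : P.Ok) (m : ℕ) :
    P.share m ^ 3 = P.iota * 2 ^ m * P.C := by
  have := hP.T_pos
  unfold Params.share
  rw [mul_pow, hP.main_cube, rpow_third_cube (by positivity)]
  field_simp

/-- Calibration error of an epoch that starts near the centre of the means. -/
theorem fresh_epoch_error {R : Routines} (hR : R.Good) {P : Params} (hP : P.Ok) (B : ℕ) (xs x : ℝ)
    (hxs0 : 0 ≤ xs) (hxs1 : xs ≤ 1) (s : State) (y : ℝ) (hs : Fresh P s y)
    (hyx : |y - xs| ≤ P.rad (2 ^ (s.m - 1))) (hx : x ≤ P.iota) (hL : s.logDim ≤ P.iota)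
    (hT : 2 ^ s.m ≤ P.T + 1) (hB : s.cells.length ≤ B) (qs : List ℝ) (l : List Step)
    (hl : Valid R P qs s l) (hlen : s.idx + l.length ≤ s.len)
    (hinv : ∀ st ∈ l, StateInv P st.s ∧ st.s.m = s.m ∧ st.s.cells = s.cells)
    (hconc : ∀ i : ℕ × ℕ × Bool × Bool × Fin 4, i.1 = s.m →
      i.2.1 < B → (l.map (pot R P (P.scale xs) P.scaleMean i)).sum ≤ x)
    (hC : (l.map fun st => |st.q - xs|).sum ≤ P.C) :
    calError 1 (l.map (Step.round R P)) ≤ 10 ^ 9 *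
      (Real.sqrt (P.iota * 2 ^ s.m) + P.share s.m + (l.map fun st => |st.q - xs|).sum / P.kappa) := by
  have hi := hP.iota
  have hCm0 : 0 ≤ (l.map fun st => |st.q - xs|).sum := by
    apply List.sum_nonneg
    intro z hz
    rw [List.mem_map] at hz
    obtain ⟨st, _, rfl⟩ := hz
    exact abs_nonneg _
  rcases le_or_gt P.iota (2 ^ s.m) with h | h
  · obtain ⟨X, hX, hE⟩ := epoch_error hR hP (P.scale xs) P.scaleMean B xs x (P.scaleIn s.m)
      (P.scaleOut s.m) hxs0 hxs1 s y hs hyx (fun c => by simp [Params.scale]) (hP.scaleIn_pos _)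
      (min_le_left _ _) (fun c => by simp [Params.scale]) (hP.scaleOut_pos _) (min_le_left _ _) hx
      hL hT hB qs l hl hlen hinv hconc
    have hST : (2 : ℝ) ^ s.m ≤ 2 * P.T := by
      have h2 := hP.T
      have h3 : 2 ^ s.m ≤ 2 * P.T := by omega
      exact_mod_cast h3
    exact epoch_numeric hP s.m hs.inv.hm h hST y (P.share s.m) _ X _ hs.y0 hs.y1
      (hP.share_nonneg _) (hP.share_cube _) hCm0 hC hX hE
  -- An epoch shorter than `ι` is bounded by its length, since then `2^m ≤ √(ι 2^m)`.
  · have h1 := calError_le_length (l.map (Step.round R P)) (by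
      intro r hr
      rw [List.mem_map] at hr
      obtain ⟨st, hst, rfl⟩ := hr
      obtain ⟨h2, h3, _⟩ := hinv st hst
      exact round_p_mem hR hP h2 (by rw [h3]; exact hT))
    rw [List.length_map] at h1
    have h2 : (l.length : ℝ) ≤ 2 ^ s.m := by
      have : l.length ≤ 2 ^ s.m := by rw [← hs.inv.len]; omega
      exact_mod_cast this
    have h3 : (2 : ℝ) ^ s.m ≤ Real.sqrt (P.iota * 2 ^ s.m) := by
      apply Real.le_sqrt_of_sq_le
      rw [sq]
      gcongr
    have h4 : 0 ≤ (l.map fun st => |st.q - xs|).sum / P.kappa := div_nonneg hCm0 hP.kappa_pos.le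
    have h5 := hP.share_nonneg s.m
    have h6 := Real.sqrt_nonneg (P.iota * 2 ^ s.m)
    linarith

/-- Bound for the sum of the errors of the epochs before epoch `m`. -/
def Params.upTo (P : Params) (m : ℕ) : ℝ := 3 * Real.sqrt (P.iota * 2 ^ m) + 4 * P.share m

/-- The coefficients 3 and 4 are chosen for the geometric growth: `3 * (4/3) = 3 + 1` with `4/3 ≤
√2`, and `4 * (5/4) = 4 + 1` with `5/4 ≤ 2^(1/3)`. -/
theorem Params.Ok.upTo_succ {P : Params} (hP : P.Ok) (m : ℕ) :
    P.upTo m + (Real.sqrt (P.iota * 2 ^ m) + P.share m) ≤ P.upTo (m + 1) := by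
  have hi := hP.iota
  have h1 : 4 / 3 * Real.sqrt (P.iota * 2 ^ m) ≤ Real.sqrt (P.iota * 2 ^ (m + 1)) := by
    apply Real.le_sqrt_of_sq_le
    rw [mul_pow, Real.sq_sqrt (by positivity), pow_succ (2 : ℝ) m]
    have : 0 < P.iota * 2 ^ m := by positivity
    linarith
  have h2 : 5 / 4 * P.share m ≤ P.share (m + 1) := by
    apply le_of_cube_le (hP.share_nonneg _)
    rw [mul_pow, hP.share_cube, hP.share_cube, pow_succ (2 : ℝ) m]
    have h3 := hP.C0
    have : 0 ≤ P.iota * 2 ^ m * P.C := by positivity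
    linarith
  unfold Params.upTo
  linarith

theorem Params.Ok.upTo_mono {P : Params} (hP : P.Ok) : Monotone P.upTo := by
  apply monotone_nat_of_le_succ
  intro m
  have h1 := hP.upTo_succ m
  have h2 := Real.sqrt_nonneg (P.iota * 2 ^ m)
  have h3 := hP.share_nonneg m
  linarith

theorem Params.Ok.upTo_le {P : Params} (hP : P.Ok) (m : ℕ) (h : (2 : ℝ) ^ m ≤ 4 * P.T) :
    P.upTo m ≤ 6 * Real.sqrt (P.iota * P.T) + 8 * P.main := by
  have hi := hP.iota; have hC := hP.C0; have hT := hP.T_pos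
  have h1 : Real.sqrt (P.iota * 2 ^ m) ≤ 2 * Real.sqrt (P.iota * P.T) := by
    apply Real.sqrt_le_iff.mpr ⟨by positivity, ?_⟩
    rw [mul_pow, Real.sq_sqrt (by positivity)]
    nlinarith
  have h2 : P.share m ≤ 2 * P.main := by
    have h3 := hP.main_nonneg
    apply le_of_cube_le (by positivity)
    rw [hP.share_cube, mul_pow, hP.main_cube]
    have h4 : P.iota * 2 ^ m * P.C ≤ P.iota * (4 * P.T) * P.C := by gcongr
    have : 0 ≤ P.iota * P.T * P.C := by positivity
    linarith
  unfold Params.upTo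
  linarith

/-- Calibration error of a record that starts with a new epoch. -/
theorem error_from {R : Routines} (hR : R.Good) {P : Params} (hP : P.Ok) (hi2 : 2 ≤ P.iota)
    (M B : ℕ) (xs x : ℝ) (hxs0 : 0 ≤ xs) (hxs1 : xs ≤ 1) (hx : x ≤ P.iota / 4) (hB0 : 0 < B)
    (hcells : ∀ s, EpochInv P s → 2 ^ s.m ≤ P.T + 1 → s.logDim ≤ P.iota ∧ s.cells.length ≤ B)
    (n : ℕ) : ∀ (qs : List ℝ) (s : State) (l : List Step), l.length ≤ n → s.idx = 0 →
      (FirstInv s ∨ ∃ y, Fresh P s y ∧ |y - xs| ≤ P.rad (2 ^ (s.m - 1))) → Valid R P qs s l →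
      (∀ st ∈ l, 2 ^ st.s.m ≤ P.T + 1 ∧ st.s.m < M) →
      Conc R P (P.scale xs) P.scaleMean M B x s.m l →
      (l.map fun st => |st.q - xs|).sum ≤ P.C →
      (l = [] ∨ calError 1 (l.map (Step.round R P)) ≤ 10 ^ 9 *
        (P.upTo M - P.upTo s.m + (l.map fun st => |st.q - xs|).sum / P.kappa)) := by
  have hi := hP.iota
  -- Whole epochs are peeled off, so the induction is on a bound for the length and not on the list
  -- of means.
  induction n with
  | zero =>
    intro qs s l hn _ _ _ _ _ _
    exact Or.inl (List.length_eq_zero_iff.mp (by omega))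
  | succ n ih =>
    intro qs s l hn hidx hs hl hbd hconc hC
    -- An empty record carries no information that `s.m < M`, and the difference of the `upTo` terms
    -- may be negative; hence the separate alternative.
    by_cases hnil : l = []
    · exact Or.inl hnil
    right
    have hinv : StateInv P s := by
      rcases hs with hs | ⟨y, hs, _⟩
      · exact Or.inl hs
      · exact Or.inr hs.inv
    have hspos : 0 < s.len := by have := hinv.idx; omega
    obtain ⟨l₁, l₂, qs₁, qs₂, rfl, hv1, hlen1, hst1, hnext⟩ := valid_split hR hP qs s hinv l hl
    have hl1 : 0 < l₁.length := by
      rcases hnext with h | ⟨_, _, _, _, h⟩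
      · rw [h, List.append_nil] at hnil
        exact List.length_pos_iff.mpr hnil
      · omega
    have hT : 2 ^ s.m ≤ P.T + 1 ∧ s.m < M := by
      obtain ⟨st, hst⟩ := List.exists_mem_of_length_pos hl1
      rw [← (hst1 st hst).2.1]
      exact hbd st (List.mem_append_left _ hst)
    have hlater : ∀ st ∈ l₂, s.m + 1 ≤ st.s.m := by
      rcases hnext with h | ⟨s₂, hf, hm2, hv2, _⟩
      · simp [h]
      · intro st hst
        rw [← hm2]
        exact (valid_inv hR hP qs₂ s₂ (Or.inr hf.inv) l₂ hv2 st hst).2.1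
    obtain ⟨hconc2, hconc1⟩ := hconc.split (fun st hst => (hst1 st hst).2.1) hlater
    have hnn : ∀ k : List Step, 0 ≤ (k.map fun st => |st.q - xs|).sum := by
      intro k
      apply List.sum_nonneg
      intro z hz
      rw [List.mem_map] at hz
      obtain ⟨st, _, rfl⟩ := hz
      exact abs_nonneg _
    rw [List.map_append, List.sum_append] at hC
    have hC1 := hnn l₁
    have hC2 := hnn l₂
    have hE1 : calError 1 (l₁.map (Step.round R P)) ≤ 10 ^ 9 * (Real.sqrt (P.iota * 2 ^ s.m) +
        P.share s.m + (l₁.map fun st => |st.q - xs|).sum / P.kappa) := by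
      rcases hs with hs | ⟨y, hs, hyx⟩
      -- The first epoch has at most two rounds, and `2 ≤ √(2 ι)`.
      · have h1 := calError_le_length (l₁.map (Step.round R P)) (by
          intro r hr
          rw [List.mem_map] at hr
          obtain ⟨st, hst, rfl⟩ := hr
          obtain ⟨h2, h3, _⟩ := hst1 st hst
          exact round_p_mem hR hP h2 (by rw [h3]; exact hT.1))
        rw [List.length_map] at h1
        have h2 : (l₁.length : ℝ) ≤ 2 := by
          have : l₁.length ≤ 2 := by
            have := hs.len
            rw [hs.hm] at this
            omega
          exact_mod_cast this
        have h3 : 2 ≤ Real.sqrt (P.iota * 2 ^ s.m) := by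
          apply Real.le_sqrt_of_sq_le
          rw [hs.hm]
          linarith
        have h4 : 0 ≤ (l₁.map fun st => |st.q - xs|).sum / P.kappa := div_nonneg hC1 hP.kappa_pos.le
        have h5 := hP.share_nonneg s.m
        linarith
      · obtain ⟨hL, hB⟩ := hcells s hs.inv hT.1
        exact fresh_epoch_error hR hP B xs x hxs0 hxs1 s y hs hyx (by linarith) hL hT.1 hB qs₁ l₁
          hv1 hlen1 hst1 (fun i hi1 hi2 => hconc1 i hi1 (by rw [hi1]; exact hT.2) hi2)
          (by linarith)
    have hup := hP.upTo_succ s.m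
    have hE2 : l₂ = [] ∨ calError 1 (l₂.map (Step.round R P)) ≤ 10 ^ 9 *
        (P.upTo M - P.upTo (s.m + 1) + (l₂.map fun st => |st.q - xs|).sum / P.kappa) := by
      rcases hnext with h | ⟨s₂, hf, hm2, hv2, hfull⟩
      · exact Or.inl h
      · rw [hidx, zero_add] at hfull
        have hclose := mean_close R hP (P.scale xs) xs x hxs0 hxs1 hx s hinv hidx l₁ hfull
          (fun st hst => (hst1 st hst).2.1)
          (fun σ => hconc1 (s.m, 0, true, σ, 3) rfl hT.2 hB0) (by linarith)
        rw [← hm2]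
        rw [← hm2] at hconc2
        refine ih qs₂ s₂ l₂ (by rw [List.length_append] at hn; omega) hf.idx
          (Or.inr ⟨_, hf, ?_⟩) hv2 (fun st hst => hbd st (List.mem_append_right _ hst)) hconc2
          (by linarith)
        rw [hm2, Nat.add_sub_cancel]
        exact hclose
    rw [List.map_append, List.map_append, List.sum_append, add_div]
    rcases hE2 with h | h
    · subst h
      have h1 := hP.upTo_mono (show s.m + 1 ≤ M from hT.2)
      simp only [List.map_nil, List.append_nil, List.sum_nil, zero_div]
      linarith
    · have h1 := calError_append_le (l₁.map (Step.round R P)) (l₂.map (Step.round R P))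
      linarith

/-! ## The calibration error of the whole game -/

theorem nonStationarity_attained {T : ℕ} (q : Fin T → ℝ) :
    ∃ x : ℝ, 0 ≤ x ∧ x ≤ 1 ∧ ∑ t, |q t - x| = nonStationarity q := by
  have hcont : Continuous fun x : Set.Icc (0 : ℝ) 1 => ∑ t, |q t - x| := by fun_prop
  obtain ⟨x, _, hx⟩ := isCompact_univ.exists_isMinOn Set.univ_nonempty hcont.continuousOn
  refine ⟨x, x.2.1, x.2.2, le_antisymm (le_ciInf fun z => hx (Set.mem_univ z)) ?_⟩
  exact ciInf_le ⟨0, by rintro _ ⟨z, rfl⟩; positivity⟩ x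

theorem Params.ok_of_nonStationarity {T : ℕ} {iota : ℝ} {q : Fin T → ℝ} {init : ℕ → ℝ} (hT : 2 ≤ T)
    (hi : 1 ≤ iota) (hq : ∀ t, q t ∈ Set.Icc (0 : ℝ) 1) (hinit : ∀ j, init j ∈ Set.Icc (0 : ℝ) 1) :
    (⟨T, iota, nonStationarity q, init⟩ : Params).Ok := by
  obtain ⟨x, hx0, hx1, hx⟩ := nonStationarity_attained q
  refine ⟨hT, hi, ?_, ?_, hinit⟩
  · rw [← hx]; positivity
  · rw [← hx]
    calc ∑ t, |q t - x| ≤ ∑ _t : Fin T, (1 : ℝ) := by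
          refine Finset.sum_le_sum fun t _ => ?_
          have := hq t
          rw [abs_le]
          constructor <;> linarith [this.1, this.2]
      _ = T := by simp

/-! ### Polynomial size bounds for the union bound -/

theorem Params.Ok.bandMax_le {P : Params} (hP : P.Ok) : P.bandMax ≤ P.T := by
  have h2 : 0 < Real.log 2 := Real.log_pos (by norm_num)
  apply Nat.ceil_le.mpr
  rw [div_le_iff₀ h2, ← Real.log_pow]
  apply Real.log_le_log hP.T_pos
  exact_mod_cast Nat.lt_two_pow_self.le

theorem Params.Ok.bandCount_le_mul {P : Params} (hP : P.Ok) : P.bandCount ≤ 4 * P.T := by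
  have hi := hP.iota; have hC := hP.C0; have hT := hP.T_pos; have hCT := hP.C1
  have hT2 : (2 : ℝ) ≤ P.T := by exact_mod_cast hP.T
  have h : P.kappa ≤ 4 * P.T := by
    apply le_of_cube_le (by positivity)
    rw [hP.kappa_cube, div_le_iff₀ (by positivity)]
    have h1 : (1 + P.C) ^ 2 ≤ (2 * P.T) ^ 2 := by gcongr; linarith
    have h2 : (1 : ℝ) ≤ (4 * P.T) ^ 3 := one_le_pow₀ (by linarith)
    have h3 : (4 * (P.T : ℝ)) ^ 3 * (1 * P.T) ≤ (4 * P.T) ^ 3 * (P.iota * P.T) := by gcongr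
    have h4 : (2 * (P.T : ℝ)) ^ 2 ≤ (4 * P.T) ^ 3 * (1 * P.T) := by
      have h5 : (2 : ℝ) * 2 ≤ P.T * P.T := by gcongr
      have h6 : (4 * (P.T : ℝ)) ^ 3 * (1 * P.T) = 64 * (P.T * P.T) * (P.T * P.T) := by ring
      have h7 : 64 * (2 * 2) * ((P.T : ℝ) * P.T) ≤ 64 * (P.T * P.T) * (P.T * P.T) := by gcongr
      nlinarith
    linarith
  apply Nat.ceil_le.mpr
  push_cast
  exact h

theorem Params.Ok.pieceCount_le_pow {P : Params} (hP : P.Ok) {sPrev y : ℝ} (m : ℕ)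
    (hs : 0 < sPrev) (hy0 : 0 ≤ y) (hy1 : y ≤ 1) : P.pieceCount sPrev (2 ^ m) y ≤ 2 ^ m := by
  have hi := hP.iota
  have hab := hP.left_lt_right hs hy0 hy1
  have h1 : P.right sPrev y - P.left sPrev y ≤ 1 := by
    have h1 : P.right sPrev y ≤ 1 := min_le_left _ _
    have h2 : 0 ≤ P.left sPrev y := le_max_left _ _
    linarith
  apply Nat.ceil_le.mpr
  push_cast
  have h2 : (P.right sPrev y - P.left sPrev y) ^ (2 / 3 : ℝ) ≤ 1 :=
    Real.rpow_le_one (by linarith) h1 (by norm_num)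
  have h3 : 1 ≤ P.iota ^ (1 / 3 : ℝ) := Real.one_le_rpow hi (by norm_num)
  have h4 : (1 : ℝ) ≤ 2 ^ m := one_le_pow₀ (by norm_num)
  have h5 : ((2 : ℝ) ^ m) ^ (1 / 3 : ℝ) ≤ 2 ^ m := by
    calc ((2 : ℝ) ^ m) ^ (1 / 3 : ℝ) ≤ (2 ^ m) ^ (1 : ℝ) :=
          Real.rpow_le_rpow_of_exponent_le h4 (by norm_num)
      _ = 2 ^ m := Real.rpow_one _
  have h6 : 0 ≤ ((2 : ℝ) ^ m) ^ (1 / 3 : ℝ) := by positivity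
  rw [div_le_iff₀ (by linarith)]
  calc ((2 : ℝ) ^ m) ^ (1 / 3 : ℝ) * (P.right sPrev y - P.left sPrev y) ^ (2 / 3 : ℝ)
      ≤ 2 ^ m * 1 := mul_le_mul h5 h2 (Real.rpow_nonneg (by linarith) _) (by positivity)
    _ ≤ 2 ^ m * P.iota ^ (1 / 3 : ℝ) := by gcongr

theorem EpochInv.cells_le {P : Params} (hP : P.Ok) {s : State} (hs : EpochInv P s)
    (hT : 2 ^ s.m ≤ P.T + 1) : s.cells.length ≤ 17 * P.T ^ 2 := by
  obtain ⟨y, hy0, hy1, hc⟩ := hs.cells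
  have h1 := partition_length_le P (2 ^ (s.m - 1)) (2 ^ s.m) y
  rw [← hc] at h1
  have h2 := hP.pieceCount_le_pow (sPrev := 2 ^ (s.m - 1)) s.m (by positivity) hy0 hy1
  have h3 := hP.bandMax_le
  have h4 := hP.bandCount_le_mul
  have h5 := hP.T
  have h6 : 2 * P.bandCount * (P.bandMax + 1) ≤ 2 * (4 * P.T) * (2 * P.T) := by gcongr; omega
  nlinarith

theorem EpochInv.logDim_le {P : Params} (hP : P.Ok) {s : State} (hs : EpochInv P s)
    (hT : 2 ^ s.m ≤ P.T + 1) : s.logDim ≤ 10 * Real.log P.T := by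
  have h1 := hs.cells_le hP hT
  have h2 := hs.dim_ge hP
  have h3 := hP.T
  rw [hs.logDim]
  have e : (10 : ℝ) * Real.log P.T = Real.log ((P.T : ℝ) ^ 10) := by
    rw [Real.log_pow]; norm_num
  rw [e]
  apply Real.log_le_log (by linarith)
  have h4 : 2 * s.cells.length * 2 ^ s.m ≤ P.T ^ 10 := by
    calc 2 * s.cells.length * 2 ^ s.m ≤ 2 * (17 * P.T ^ 2) * (2 * P.T) := by gcongr; omega
      _ = 68 * P.T ^ 3 := by ring
      _ ≤ 2 ^ 7 * P.T ^ 3 := by gcongr; norm_num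
      _ ≤ P.T ^ 7 * P.T ^ 3 := by gcongr
      _ = P.T ^ 10 := by ring
  exact_mod_cast h4

/-- The union bound, and the origin of the constant 60: at the threshold `ι / 4` the exponential is
at least `(T/δ)^15`. One factor `1/δ` is kept for the failure probability, and the others are at
least 1. -/
theorem card_le_of_log_le {T : ℕ} {δ iota : ℝ} (hT : 2 ≤ T) (hδ0 : 0 < δ) (hδ1 : δ < 1)
    (hi : 60 * Real.log (T / δ) ≤ iota) (n : ℕ) (hn : n ≤ T ^ 15) :
    (n : ℝ) ≤ δ * Real.exp (iota / 4) := by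
  have hT0 : (0 : ℝ) < T := by exact_mod_cast (by omega : 0 < T)
  have h1 : (T : ℝ) ≤ T / δ := by rw [le_div_iff₀ hδ0]; nlinarith
  have h2 : ((T : ℝ) / δ) ^ 15 ≤ Real.exp (iota / 4) := by
    rw [← Real.exp_log (show 0 < ((T : ℝ) / δ) ^ 15 by positivity), Real.log_pow]
    apply Real.exp_le_exp.mpr
    push_cast
    linarith
  calc (n : ℝ) ≤ (T : ℝ) ^ 15 := by exact_mod_cast hn
    _ = T * (T : ℝ) ^ 14 := by ring
    _ ≤ T * (T / δ) ^ 14 := by gcongr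
    _ = δ * (T / δ) ^ 15 := by field_simp
    _ ≤ _ := by gcongr

/-- The calibration error is small with high probability. -/
theorem calibration_bound {R : Routines} (hR : R.Good) {T : ℕ} {δ iota : ℝ} {q : Fin T → ℝ}
    {init : ℕ → ℝ} (hT : 2 ≤ T) (hδ0 : 0 < δ) (hδ1 : δ < 1) (hi : 60 * Real.log (T / δ) ≤ iota)
    (hq : ∀ t, q t ∈ Set.Icc (0 : ℝ) 1) (hinit : ∀ j, init j ∈ Set.Icc (0 : ℝ) 1) :
    ENNReal.ofReal (1 - δ) ≤ (transcript R ⟨T, iota, nonStationarity q, init⟩ q).toOuterMeasure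
      {h | calError 1 h ≤ 10 ^ 10 * (iota * Real.log T + Real.sqrt (iota * T) +
        (iota * T * nonStationarity q) ^ (1 / 3 : ℝ))} := by
  have hT0 : (0 : ℝ) < T := by exact_mod_cast (by omega : 0 < T)
  have hT2 : (2 : ℝ) ≤ T := by exact_mod_cast hT
  have hlogT : 1 / 2 ≤ Real.log T := by
    have h1 := Real.log_two_gt_d9
    have h2 := Real.log_le_log (by norm_num) hT2
    linarith
  have hlog : Real.log T ≤ Real.log (T / δ) := by
    apply Real.log_le_log hT0
    rw [le_div_iff₀ hδ0]
    nlinarith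
  have hi2 : 2 ≤ iota := by linarith
  have hP := Params.ok_of_nonStationarity hT (show 1 ≤ iota by linarith) hq hinit
  obtain ⟨xs, hxs0, hxs1, hxs⟩ := nonStationarity_attained q
  set P : Params := ⟨T, iota, nonStationarity q, init⟩ with hPdef
  set M := Nat.log 2 (T + 1) + 1 with hM
  have hM4 : 2 ^ M ≤ 4 * T := by
    have := Nat.pow_log_le_self 2 (show T + 1 ≠ 0 by omega)
    rw [hM, pow_succ]
    omega
  -- Epochs, positions in the partition, and 16 choices of scale, sign and kind.
  set S : Finset (ℕ × ℕ × Bool × Bool × Fin 4) :=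
    Finset.range M ×ˢ Finset.range (17 * T ^ 2) ×ˢ Finset.univ with hS
  have hcard : S.card ≤ T ^ 15 := by
    rw [hS, Finset.card_product, Finset.card_product, Finset.card_range, Finset.card_range,
      Finset.card_univ]
    have h1 : Fintype.card (Bool × Bool × Fin 4) = 16 := by simp
    rw [h1]
    have h2 : M ≤ 4 * T := (Nat.lt_two_pow_self (n := M)).le.trans hM4
    calc M * (17 * T ^ 2 * 16) ≤ 4 * T * (17 * T ^ 2 * 16) := by gcongr
      _ = 1088 * T ^ 3 := by ring
      _ ≤ 2 ^ 12 * T ^ 3 := by gcongr; norm_num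
      _ ≤ T ^ 12 * T ^ 3 := by gcongr
      _ = T ^ 15 := by ring
  refine prob_of_supermartingales R P (StateInv P) (fun s y h => h.next hR hP y) S
    (pot R P (P.scale xs) P.scaleMean)
    (fun s h => ⟨(h.mix_ok hR hP).t0, (h.mix_ok hR hP).t1⟩)
    (fun i _ => super_pot R hR P hP _ _ (hP.scale_mem xs) P.scaleMean_mem i) _ ?_ start
    (start_inv P) δ (iota / 4) hδ0.le (card_le_of_log_le hT hδ0 hδ1 hi _ hcard) _ ?_
  · intro z hz
    obtain ⟨t, rfl⟩ := (List.mem_ofFn' q z).mp hz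
    exact hq t
  · intro l hl hsum
    have hmap := valid_map_q R P _ _ l hl
    have hlen : l.length = T := by
      have := congrArg List.length hmap
      rwa [List.length_map, List.length_ofFn] at this
    have hC : (l.map fun st => |st.q - xs|).sum = P.C := by
      have e : (l.map fun st => |st.q - xs|) = (l.map Step.q).map fun z => |z - xs| := by
        rw [List.map_map]; rfl
      rw [e, hmap, List.map_ofFn, List.sum_ofFn]
      exact hxs
    have hst : ∀ st ∈ l, 2 ^ st.s.m ≤ P.T + 1 ∧ st.s.m < M := by
      intro st hst
      have h1 := (valid_inv hR hP _ _ (start_inv P) l hl st hst).2.2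
      rw [hlen] at h1
      have h2 : 2 ^ start.m + start.idx = 2 := rfl
      have h3 : 2 ^ st.s.m ≤ T + 1 := by omega
      refine ⟨h3, ?_⟩
      rw [hM, Nat.lt_succ_iff]
      exact Nat.le_log_of_pow_le (by norm_num) h3
    have hmain := error_from hR hP hi2 M (17 * T ^ 2) xs (iota / 4) hxs0 hxs1 le_rfl (by positivity)
      (fun s hs hsT => ⟨(hs.logDim_le hP hsT).trans (by
        show 10 * Real.log T ≤ iota
        linarith), hs.cells_le hP hsT⟩)
      l.length _ start l le_rfl rfl (Or.inl ⟨rfl, rfl, by simp [start], by simp [start],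
        by simp [start]⟩) hl hst
      (fun i _ h2 h3 => hsum i (by simp [hS, h2, h3])) hC.le
    have hbound : P.upTo M ≤ 6 * Real.sqrt (iota * T) + 8 * P.main :=
      hP.upTo_le M (by show (2 : ℝ) ^ M ≤ 4 * T; exact_mod_cast hM4)
    have hup : 0 ≤ P.upTo start.m := by
      have h1 := Real.sqrt_nonneg (P.iota * 2 ^ start.m)
      have h2 := hP.share_nonneg start.m
      unfold Params.upTo
      linarith
    have hCk := hP.C_div_kappa
    have hmainpos := hP.main_nonneg
    have hs := Real.sqrt_nonneg (iota * T)
    have hlogpos : 0 ≤ iota * Real.log T := by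
      apply mul_nonneg <;> linarith
    have emain : (iota * T * nonStationarity q) ^ (1 / 3 : ℝ) = P.main := rfl
    rw [Set.mem_ofPred_eq, emain]
    rcases hmain with h | h
    · subst h
      simp only [List.length_nil] at hlen
      omega
    -- The coefficients are 6 for `√(ι T)` and `8 + 1` for the leading term, the last 1 from `C /
    -- κ`. The term `ι log T` enters only as a nonnegative summand, because short epochs were
    -- already charged to `√(ι 2^m)`.
    · rw [hC] at h
      linarith

/-! ## The number of elementary operations -/

@[simp] theorem tick_cost {α : Type} (a : α) : (tick a).cost = 1 := rfl
@[simp] theorem addR_cost (x y : ℝ) : (addR x y).cost = 1 := rfl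
@[simp] theorem subR_cost (x y : ℝ) : (subR x y).cost = 1 := rfl
@[simp] theorem mulR_cost (x y : ℝ) : (mulR x y).cost = 1 := rfl
@[simp] theorem divR_cost (x y : ℝ) : (divR x y).cost = 1 := rfl
@[simp] theorem maxR_cost (x y : ℝ) : (maxR x y).cost = 1 := rfl
@[simp] theorem minR_cost (x y : ℝ) : (minR x y).cost = 1 := rfl
@[simp] theorem absR_cost (x : ℝ) : (absR x).cost = 1 := rfl
@[simp] theorem sqrtR_cost (x : ℝ) : (sqrtR x).cost = 1 := rfl
@[simp] theorem expR_cost (x : ℝ) : (expR x).cost = 1 := rfl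
@[simp] theorem logR_cost (x : ℝ) : (logR x).cost = 1 := rfl
@[simp] theorem powR_cost (x y : ℝ) : (powR x y).cost = 1 := rfl
@[simp] theorem ltR_cost (x y : ℝ) : (ltR x y).cost = 1 := rfl
@[simp] theorem leR_cost (x y : ℝ) : (leR x y).cost = 1 := rfl
@[simp] theorem ceilR_cost (x : ℝ) : (ceilR x).cost = 1 := rfl
@[simp] theorem castN_cost (n : ℕ) : (castN n).cost = 1 := rfl
@[simp] theorem addN_cost (m n : ℕ) : (addN m n).cost = 1 := rfl
@[simp] theorem mulN_cost (m n : ℕ) : (mulN m n).cost = 1 := rfl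
@[simp] theorem halfN_cost (n : ℕ) : (halfN n).cost = 1 := rfl
@[simp] theorem eqN_cost (m n : ℕ) : (eqN m n).cost = 1 := rfl
@[simp] theorem leN_cost (m n : ℕ) : (leN m n).cost = 1 := rfl

theorem forEach_cost {α β : Type} (f : α → Timed β) (k : ℕ) (hf : ∀ a, (f a).cost ≤ k)
    (l : List α) : (forEach f l).cost ≤ (k + 1) * l.length + 1 := by
  induction l with
  | nil => simp [forEach]
  | cons a l ih =>
    have := hf a
    simp only [forEach, bind_cost, tick_cost, List.length_cons, Nat.mul_succ]
    omega

theorem loop_cost {α β : Type} (f : β → α → Timed β) (k : ℕ) (hf : ∀ b a, (f b a).cost ≤ k)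
    (l : List α) (b : β) : (loop f b l).cost ≤ (k + 1) * l.length + 1 := by
  induction l generalizing b with
  | nil => simp [loop]
  | cons a l ih =>
    have h1 := hf b a
    have h2 := ih (f b a).val
    simp only [loop, bind_cost, tick_cost, tick_val, List.length_cons, Nat.mul_succ]
    omega

theorem append_cost {α : Type} (k l : List α) : (append k l).cost = k.length + 1 := by
  induction k with
  | nil => simp [append]
  | cons a k ih =>
    simp only [append, bind_cost, tick_cost, List.length_cons, ih]

theorem Cell.mem_cost (c : Cell) (p : ℝ) : (c.mem p).cost = 3 := by
  unfold Cell.mem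
  simp only [bind_cost, tick_cost, ite_cost, leR_cost, ltR_cost, ite_self]

theorem Phi_cost (arms : List Arm) (p : ℝ) : (Phi arms p).cost ≤ 6 * arms.length + 1 := by
  apply loop_cost
  intro acc a
  simp only [bind_cost, ite_cost, Cell.mem_cost, addR_cost, mulR_cost, tick_cost]
  split <;> omega

theorem locate_cost (p : ℝ) (l : List Cell) : (locate p l).cost ≤ 3 * l.length + 1 := by
  induction l with
  | nil => simp [locate]
  | cons c l ih =>
    simp only [locate, bind_cost, ite_cost, Cell.mem_cost, tick_cost, List.length_cons]
    split <;> omega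

theorem mirrorAt_cost (floor : ℝ) (items : List Item) (x : ℝ) :
    (mirrorAt floor items x).cost ≤ 6 * items.length + 1 := by
  apply forEach_cost
  intro e
  simp

theorem bisectMult_cost (floor : ℝ) (items : List Item) (n : ℕ) (lo hi : ℝ) :
    (bisectMult floor items n lo hi).cost ≤ n * (8 * items.length + 5) + 1 := by
  induction n generalizing lo hi with
  | zero => simp [bisectMult]
  | succ n ih =>
    have h1 := mirrorAt_cost floor items ((lo + hi) / 2)
    have h2 := loop_cost addR 1 (fun b a => le_rfl) (mirrorAt floor items ((lo + hi) / 2)).val 0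
    have h3 : (mirrorAt floor items ((lo + hi) / 2)).val.length = items.length := by
      simp [mirrorAt]
    rw [h3] at h2
    have h4 := ih ((lo + hi) / 2) hi
    have h5 := ih lo ((lo + hi) / 2)
    have e : (n + 1) * (8 * items.length + 5) =
        n * (8 * items.length + 5) + (8 * items.length + 5) := by ring
    rw [e]
    simp only [bisectMult, bind_cost, ite_cost, addR_cost, divR_cost, ltR_cost, addR_val, divR_val]
    split <;> omega

/-- The cost is governed by the number `k` of halvings, not by the fuel, which is as large as the
epoch. -/
theorem bisectSign_cost (f : ℕ → Timed ℝ) (F : ℕ) (hF : ∀ j, (f j).cost ≤ F) (k fuel lo hi : ℕ)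
    (h : hi ≤ lo + 2 ^ k) : (bisectSign f fuel lo hi).cost ≤ k * (F + 5) + 3 := by
  induction fuel generalizing lo hi k with
  | zero => simp [bisectSign]
  | succ fuel ih =>
    by_cases hle : hi ≤ lo + 1
    · simp [bisectSign, hle]
    · cases k with
      | zero => rw [pow_zero] at h; omega
      | succ k =>
        rw [pow_succ] at h
        have h1 := ih k ((lo + hi) / 2) hi (by omega)
        have h2 := ih k lo ((lo + hi) / 2) (by omega)
        have h3 := hF ((lo + hi) / 2)
        simp only [bisectSign, bind_cost, addN_cost, leN_cost, addN_val, leN_val, hle,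
          decide_false, Bool.false_eq_true, if_false, halfN_cost, halfN_val, leR_cost, ite_cost,
          Nat.succ_mul]
        split <;> omega

/-- `Φ` is evaluated in the `m` steps of the binary search, at 0 and 1, and at the two grid points.
-/
theorem mixture_cost (P : Params) (s : State) (hlen : s.len = 2 ^ s.m) :
    (mixture bisection P s).cost ≤ (s.m + 4) * (6 * s.arms.length + 8) + 20 := by
  have h0 := Phi_cost s.arms
  have hc := bisectSign_cost (fun j => do Phi s.arms (← divR (← castN j) s.len))
    (6 * s.arms.length + 3) (fun j => by
      have := h0 (j / s.len)
      simp only [bind_cost, castN_cost, divR_cost, castN_val, divR_val]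
      omega) s.m s.len 0 s.len (by omega)
  have e : (s.m + 4) * (6 * s.arms.length + 8) =
      s.m * (6 * s.arms.length + 3 + 5) + (24 * s.arms.length + 32) := by ring
  rw [e]
  have f0 := h0 0
  have f1 := h0 1
  simp only [mixture, bisection, bind_cost, ite_cost, leN_cost, ltR_cost, leR_cost, castN_cost,
    divR_cost, addN_cost, absR_cost, addR_cost, tick_cost, castN_val, divR_val, addN_val]
  split
  · linarith
  split
  · linarith
  split
  · linarith
  generalize (bisectSign _ _ _ _).val = i
  have f2 := h0 (i / s.len)
  have f3 := h0 ((i + 1 : ℕ) / s.len)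
  linarith

theorem output_cost (s : State) (p : ℝ) : (output s p).cost ≤ 3 * s.cells.length + 2 := by
  have := locate_cost p s.cells
  simp only [output, bind_cost, ite_cost, leN_cost, tick_cost]
  split <;> omega

theorem gain_cost (D : Mix) (y : ℝ) (a : Arm) : (gain D y a).cost ≤ 14 := by
  simp only [gain, bind_cost, ite_cost, Cell.mem_cost, mulR_cost, subR_cost, tick_cost, addR_cost]
  split <;> split <;> omega

theorem reweigh_cost (l : List (Arm × ℝ)) (ws : List ℝ) :
    (reweigh l ws).cost ≤ 3 * l.length + 1 := by
  induction l generalizing ws with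
  | nil => simp [reweigh]
  | cons ag l ih =>
    cases ws with
    | nil => simp [reweigh]
    | cons w ws =>
      have := ih ws
      simp only [reweigh, bind_cost, mulR_cost, addR_cost, tick_cost, List.length_cons]
      omega

theorem learn_cost (s : State) (D : Mix) (y : ℝ) :
    (learn bisection s D y).cost ≤ (4 * s.m + 21) * (8 * s.arms.length + 5) := by
  unfold learn
  simp only [bind_cost]
  have h1 := forEach_cost (fun a => do tick (a, ← gain D y a)) 15 (fun a => by
    have := gain_cost D y a
    simp only [bind_cost, tick_cost]
    omega) s.arms
  have hl1 : (forEach (fun a => do tick (a, ← gain D y a)) s.arms).val.length = s.arms.length := by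
    simp
  set ags := (forEach (fun a => do tick (a, ← gain D y a)) s.arms).val
  have h2 := forEach_cost (toItem s.logDim) 9 (fun a => by simp [toItem]) ags
  have hl2 : (forEach (toItem s.logDim) ags).val.length = ags.length := by simp
  set items := (forEach (toItem s.logDim) ags).val
  have h3 : (bisection.mirror s.m s.floor items).cost ≤
      2 + ((4 * s.m + 16) * (8 * items.length + 5) + 1) + (6 * items.length + 1) := by
    have h4 := bisectMult_cost s.floor items (4 * s.m + 16) (-2) 2
    have h5 := mirrorAt_cost s.floor items
      (bisectMult s.floor items (4 * s.m + 16) (-2) 2).val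
    simp only [bisection, bind_cost, addN_cost, mulN_cost, addN_val, mulN_val]
    omega
  have h6 := reweigh_cost ags (bisection.mirror s.m s.floor items).val
  rw [hl2, hl1] at h3
  rw [hl1] at h2 h6
  have e : (4 * s.m + 21) * (8 * s.arms.length + 5) =
      (4 * s.m + 16) * (8 * s.arms.length + 5) + 5 * (8 * s.arms.length + 5) := by ring
  rw [e]
  omega

theorem pieces_cost (c : Cell) (N k : ℕ) : (pieces c N k).cost = 15 * k + 1 := by
  induction k with
  | zero => rfl
  | succ k ih =>
    simp only [pieces, bind_cost, subR_cost, castN_cost, divR_cost, mulR_cost, addR_cost, addN_cost,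
      eqN_cost, tick_cost, ih]
    omega

theorem band_cost (c : Cell) (K : ℕ) : (band c K).cost ≤ 15 * K + 2 := by
  have := pieces_cost c K K
  simp only [band, bind_cost, ite_cost, ltR_cost, tick_cost, unifPart]
  split <;> omega

theorem bands_cost (K : ℕ) (a b r : ℝ) (n : ℕ) (pw : ℝ) :
    (bands K a b r n pw).cost ≤ (32 * K + 17) * n + 1 := by
  induction n generalizing pw with
  | zero => simp [bands]
  | succ n ih =>
    simp only [bands, bind_cost, subR_cost, mulR_cost, addR_cost, maxR_cost, minR_cost,
      append_cost, append_val, Nat.mul_succ]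
    have h1 := ih (2 * pw)
    have h2 := fun c => band_cost c K
    have h3 := fun c => band_length_le c K
    simp only [subR_val, mulR_val, addR_val, maxR_val, minR_val]
    have l1 := h2 ⟨max 0 (a - (2 * pw - 1) * r), a - (pw - 1) * r, true, false⟩
    have l2 := h2 ⟨b + (pw - 1) * r, min 1 (b + (2 * pw - 1) * r), false, true⟩
    have l3 := h3 ⟨max 0 (a - (2 * pw - 1) * r), a - (pw - 1) * r, true, false⟩
    have l4 := h3 ⟨b + (pw - 1) * r, min 1 (b + (2 * pw - 1) * r), false, true⟩
    omega

theorem partition_cost (P : Params) (sPrev s y : ℝ) : (partition P sPrev s y).cost ≤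
    16 * P.pieceCount sPrev s y + (32 * P.bandCount + 17) * (P.bandMax + 1) + 40 := by
  have hN : P.pieceCount sPrev s y = ⌈s ^ (1 / 3 : ℝ) * (min 1 (y + 2 * (Real.sqrt (P.iota / sPrev)
    + P.C / sPrev)) - max 0 (y - 2 * (Real.sqrt (P.iota / sPrev) + P.C / sPrev))) ^ (2 / 3 : ℝ)
    / P.iota ^ (1 / 3 : ℝ)⌉₊ := rfl
  have hK : P.bandCount = ⌈((1 + P.C) * (1 + P.C) / (P.iota * P.T)) ^ (1 / 3 : ℝ)⌉₊ := rfl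
  have hQ : P.bandMax = ⌈Real.log P.T / Real.log 2⌉₊ := rfl
  simp only [partition, bind_cost, append_cost, unifPart, subR_cost, mulR_cost, addR_cost, maxR_cost,
    minR_cost, sqrtR_cost, divR_cost, powR_cost, ceilR_cost, castN_cost, logR_cost, addN_cost,
    subR_val, mulR_val, addR_val, maxR_val, minR_val, sqrtR_val, divR_val, powR_val, ceilR_val,
    castN_val, logR_val, addN_val, pieces_cost, pieces_length]
  rw [← hN, ← hK, ← hQ]
  generalize hX : (bands _ _ _ _ _ _).cost = X
  have h3 : X ≤ (32 * P.bandCount + 17) * (P.bandMax + 1) + 1 := hX ▸ bands_cost _ _ _ _ _ _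
  linarith

theorem newEpoch_cost (P : Params) (m len : ℕ) (ones : ℝ) : (newEpoch P m len ones).cost ≤
    (partition P len (2 * len : ℕ) (ones / len)).cost +
      7 * (partition P len (2 * len : ℕ) (ones / len)).val.length + 20 := by
  simp only [newEpoch, bind_cost, append_cost, addN_cost, mulN_cost, castN_cost, divR_cost,
    mulR_cost, logR_cost, tick_cost, castN_val, mulN_val, divR_val, forEach_val, List.length_map]
  set p := partition P len (2 * len : ℕ) (ones / len)
  have h1 := loop_cost (fun n (_ : Cell) => addR n 1) 1 (fun b a => le_rfl) p.val 0
  have h2 := fun σ w => forEach_cost (fun c => tick (⟨c, σ, w, 0⟩ : Arm)) 1 (fun a => le_rfl) p.val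
  generalize (mulR _ _).val = z
  have h3 := h2 1 (1 / z)
  have h4 := h2 (-1) (1 / z)
  omega

theorem newEpoch_cost_le (P : Params) (m len : ℕ) (ones : ℝ) : (newEpoch P m len ones).cost ≤
    23 * P.pieceCount len (2 * len : ℕ) (ones / len) +
      (46 * P.bandCount + 17) * (P.bandMax + 1) + 60 := by
  have h1 := newEpoch_cost P m len ones
  have h2 := partition_cost P len (2 * len : ℕ) (ones / len)
  have h3 := partition_length_le P len (2 * len : ℕ) (ones / len)
  linarith

theorem update_cost (P : Params) (s : State) (y : Bool) : (update bisection P s (s.mix bisection P)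
    y).cost ≤ (if s.m ≤ 1 then 1 else (4 * s.m + 21) * (8 * s.arms.length + 5)) + 4 +
      (23 * P.pieceCount s.len (2 * s.len : ℕ) ((s.ones + bit y) / s.len) +
      (46 * P.bandCount + 17) * (P.bandMax + 1) + 60) := by
  have h1 := learn_cost s (s.mix bisection P) (bit y)
  have h2 := newEpoch_cost_le P s.m s.len (s.ones + bit y)
  have e : (if y = true then (1 : ℝ) else 0) = bit y := rfl
  have h3 := Nat.zero_le ((46 * P.bandCount + 17) * (P.bandMax + 1))
  simp only [update, bind_cost, ite_cost, leN_cost, leN_val, addR_cost, addN_cost, eqN_cost,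
    tick_cost, addR_val, e, decide_eq_true_eq]
  split <;> split <;> linarith

/-- In the first epoch the programs branch on `m ≤ 1` before they touch intervals or experts, so `L
= 0` is correct there without knowing that these lists are empty. -/
theorem round_cost_le (P : Params) (st : Step) (L : ℕ)
    (h : FirstInv st.s ∧ L = 0 ∨ EpochInv P st.s ∧ L = st.s.cells.length) :
    (st.round bisection P).cost ≤
      (st.s.m + 4) * (12 * L + 8) + 3 * L +
      (4 * st.s.m + 21) * (16 * L + 5) +
      (23 * P.pieceCount st.s.len (2 * st.s.len : ℕ) ((st.s.ones + bit st.y) / st.s.len) +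
      (46 * P.bandCount + 17) * (P.bandMax + 1) + 60) + 40 := by
  have h1 := update_cost P st.s st.y
  have e : (st.round bisection P).cost = (mixture bisection P st.s).cost + 1 +
    (output st.s (st.aux bisection P)).cost +
    (update bisection P st.s (st.s.mix bisection P) st.y).cost := rfl
  rw [e]
  have h2 := output_cost st.s (st.aux bisection P)
  rcases h with ⟨h, rfl⟩ | ⟨h, rfl⟩
  · have hm : st.s.m ≤ 1 := h.hm.le
    rw [if_pos hm] at h1
    have h3 : (mixture bisection P st.s).cost = 2 := by
      simp [mixture, hm]
    have h4 : (output st.s (st.aux bisection P)).cost = 2 := by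
      simp [output, hm]
    have h5 := Nat.zero_le ((st.s.m + 4) * (12 * 0 + 8))
    have h6 := Nat.zero_le ((4 * st.s.m + 21) * (16 * 0 + 5))
    linarith
  · have hm : ¬ st.s.m ≤ 1 := by have := h.hm; omega
    rw [if_neg hm] at h1
    obtain ⟨d, A, hA⟩ := h.armsOk
    have hd : st.s.arms.length = 2 * st.s.cells.length := by
      rw [hA.arms, List.length_ofFn, hA.dim]
    have h3 := mixture_cost P st.s h.len
    rw [hd] at h1 h3
    have e1 : 6 * (2 * st.s.cells.length) = 12 * st.s.cells.length := by ring
    have e2 : 8 * (2 * st.s.cells.length) = 16 * st.s.cells.length := by ring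
    rw [e1] at h3
    rw [e2] at h1
    linarith

/-! ### Size of the partition in terms of `C`, and the cost of a round -/

/-- The number of inner pieces is `O((1 + C)^(1/3))`. -/
theorem Params.Ok.pieceCount_le {P : Params} (hP : P.Ok) {sPrev s y : ℝ} (hs : 0 < sPrev)
    (hs2 : s = 2 * sPrev) (hy0 : 0 ≤ y) (hy1 : y ≤ 1) :
    (P.pieceCount sPrev s y : ℝ) ≤ 7 * (1 + P.C) ^ (1 / 3 : ℝ) := by
  have hi := hP.iota; have hC := hP.C0
  have hab := hP.left_lt_right hs hy0 hy1
  have hs0 : 0 < s := by linarith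
  have hγ : 1 ≤ (1 + P.C) ^ (1 / 3 : ℝ) := Real.one_le_rpow (by linarith) (by norm_num)
  have hγ3 : ((1 + P.C) ^ (1 / 3 : ℝ)) ^ 3 = 1 + P.C := rpow_third_cube (by linarith)
  set γ := (1 + P.C) ^ (1 / 3 : ℝ)
  set w := P.right sPrev y - P.left sPrev y with hw
  have hw0 : 0 < w := by linarith
  have h1 : P.right sPrev y ≤ 1 := min_le_left _ _
  have h2 : 0 ≤ P.left sPrev y := le_max_left _ _
  have h3 : P.right sPrev y ≤ y + 2 * P.rad sPrev := min_le_right _ _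
  have h4 : y - 2 * P.rad sPrev ≤ P.left sPrev y := le_max_right _ _
  have hw1 : w ≤ 1 := by linarith
  have hwr : w ≤ 4 * P.rad sPrev := by linarith
  have hx : s ^ (1 / 3 : ℝ) * w ^ (2 / 3 : ℝ) / P.iota ^ (1 / 3 : ℝ) ≤ 6 * γ := by
    apply le_of_cube_le (by positivity)
    rw [rpow_two_thirds hw0.le, div_pow, mul_pow, rpow_third_cube hs0.le, ← pow_mul, mul_comm 2 3,
      pow_mul, rpow_third_cube hw0.le, rpow_third_cube (by linarith), mul_pow, hγ3,
      div_le_iff₀ (by linarith)]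
    set ρ := Real.sqrt (P.iota / sPrev) with hρ
    have hρ2 : ρ ^ 2 * sPrev = P.iota := by
      rw [hρ, Real.sq_sqrt (by positivity)]; field_simp
    have hρ0 : 0 ≤ ρ := Real.sqrt_nonneg _
    have hrad : P.rad sPrev = ρ + P.C / sPrev := rfl
    rw [hrad] at hwr
    have hCi : 0 ≤ P.C * P.iota := by positivity
    -- If the drift part of the radius dominates, `s w² ≤ s w ≤ 16 C`; if the noise part dominates,
    -- `s w² ≤ 128 ι`. Either way `s w² / ι` is at most `6³ (1 + C)`, whatever the length of the
    -- epoch.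
    rcases le_total ρ (P.C / sPrev) with h | h
    · have h5 : s * w ≤ 16 * P.C := by
        have h6 : w ≤ 8 * (P.C / sPrev) := by linarith
        calc s * w ≤ s * (8 * (P.C / sPrev)) := by gcongr
          _ = 16 * P.C := by rw [hs2]; field_simp; ring
      have h7 : s * w ^ 2 ≤ s * w := by
        have : 0 < s * w := by positivity
        nlinarith
      nlinarith
    · have h6 : w ≤ 8 * ρ := by linarith
      have h5 : s * w ^ 2 ≤ 128 * P.iota := by
        calc s * w ^ 2 ≤ s * (8 * ρ) ^ 2 := by gcongr
          _ = 128 * (ρ ^ 2 * sPrev) := by rw [hs2]; ring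
          _ = 128 * P.iota := by rw [hρ2]
      nlinarith
  have h5 : (P.pieceCount sPrev s y : ℝ) ≤
      s ^ (1 / 3 : ℝ) * w ^ (2 / 3 : ℝ) / P.iota ^ (1 / 3 : ℝ) + 1 :=
    (Nat.ceil_lt_add_one (by positivity)).le
  linarith

/-- The number of pieces of a band is `O((1 + C)^(1/3))`. -/
theorem Params.Ok.bandCount_le_rpow {P : Params} (hP : P.Ok) :
    (P.bandCount : ℝ) ≤ 3 * (1 + P.C) ^ (1 / 3 : ℝ) := by
  have hi := hP.iota; have hC := hP.C0; have hT := hP.T_pos; have hCT := hP.C1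
  have hT2 : (2 : ℝ) ≤ P.T := by exact_mod_cast hP.T
  have hγ : 1 ≤ (1 + P.C) ^ (1 / 3 : ℝ) := Real.one_le_rpow (by linarith) (by norm_num)
  have hγ3 : ((1 + P.C) ^ (1 / 3 : ℝ)) ^ 3 = 1 + P.C := rpow_third_cube (by linarith)
  have h : P.kappa ≤ 2 * (1 + P.C) ^ (1 / 3 : ℝ) := by
    apply le_of_cube_le (by positivity)
    rw [hP.kappa_cube, mul_pow, hγ3, div_le_iff₀ (by positivity)]
    have h1 : 1 + P.C ≤ 2 * P.T := by linarith
    have h2 : (1 + P.C) * (1 + P.C) ≤ (1 + P.C) * (2 * P.T) := by gcongr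
    have h3 : (1 + P.C) * (1 * P.T) ≤ (1 + P.C) * (P.iota * P.T) := by gcongr
    have h4 : 0 ≤ (1 + P.C) * (P.iota * P.T) := by positivity
    linarith
  have := Params.bandCount_le hP
  linarith

theorem Params.Ok.bandMax_le_log {P : Params} (hP : P.Ok) :
    (P.bandMax : ℝ) + 1 ≤ 6 * Real.log P.T ∧ 1 / 2 ≤ Real.log P.T ∧
    ∀ m : ℕ, 2 ^ m ≤ P.T + 1 → (m : ℝ) ≤ 4 * Real.log P.T := by
  have hT2 : (2 : ℝ) ≤ P.T := by exact_mod_cast hP.T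
  have h2 : 1 / 2 ≤ Real.log 2 := by have := Real.log_two_gt_d9; linarith
  have hT : Real.log 2 ≤ Real.log P.T := Real.log_le_log (by norm_num) hT2
  refine ⟨?_, by linarith, ?_⟩
  · have h3 : (P.bandMax : ℝ) ≤ Real.log P.T / Real.log 2 + 1 :=
      (Nat.ceil_lt_add_one (div_nonneg (by linarith) (by linarith))).le
    have h4 : Real.log P.T / Real.log 2 ≤ 2 * Real.log P.T := by
      rw [div_le_iff₀ (by linarith)]
      nlinarith
    linarith
  · intro m hm
    have h3 : (2 : ℝ) ^ m ≤ (P.T : ℝ) ^ 2 := by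
      have h4 : (2 : ℝ) ^ m ≤ P.T + 1 := by exact_mod_cast hm
      nlinarith
    have h4 := Real.log_le_log (by positivity) h3
    rw [Real.log_pow, Real.log_pow] at h4
    push_cast at h4
    have h5 : (m : ℝ) * (1 / 2) ≤ m * Real.log 2 := by gcongr
    linarith

/-- Number of operations in a round. -/
theorem round_cost_bound {P : Params} (hP : P.Ok) (st : Step) (h : StateInv P st.s)
    (hm : 2 ^ st.s.m ≤ P.T + 1) : ((st.round bisection P).cost : ℝ) ≤
      100000 * (1 + P.C) ^ (1 / 3 : ℝ) * Real.log P.T ^ 2 := by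
  obtain ⟨hQ, hl, hmlog⟩ := hP.bandMax_le_log
  have hm' := hmlog _ hm
  have hK := hP.bandCount_le_rpow
  have hγ : 1 ≤ (1 + P.C) ^ (1 / 3 : ℝ) :=
    Real.one_le_rpow (by have := hP.C0; linarith) (by norm_num)
  have hlen : 0 < st.s.len := by have := h.idx; omega
  have hlen' : (0 : ℝ) < st.s.len := by exact_mod_cast hlen
  have hN : (P.pieceCount st.s.len (2 * st.s.len : ℕ) ((st.s.ones + bit st.y) / st.s.len) : ℝ) ≤
      7 * (1 + P.C) ^ (1 / 3 : ℝ) := by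
    have h1 := h.ones0; have h2 := h.ones1; have h3 := bit_nonneg st.y; have h4 := bit_le_one st.y
    have h5 : (st.s.idx : ℝ) + 1 ≤ st.s.len := by exact_mod_cast h.idx
    exact hP.pieceCount_le hlen' (by push_cast; ring) (by positivity)
      ((div_le_one hlen').mpr (by linarith))
  set γ := (1 + P.C) ^ (1 / 3 : ℝ)
  set t := Real.log P.T
  have hKQ : (P.bandCount : ℝ) * (P.bandMax + 1) ≤ 3 * γ * (6 * t) := by gcongr
  have hγt : γ ≤ 2 * (γ * t) := by nlinarith
  have ht1 : t ≤ γ * t := le_mul_of_one_le_left (by linarith) hγ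
  obtain ⟨L, hL, hLle⟩ : ∃ L : ℕ, (FirstInv st.s ∧ L = 0 ∨ EpochInv P st.s ∧
      L = st.s.cells.length) ∧ (L : ℝ) ≤ 50 * (γ * t) := by
    rcases h with h | h
    · exact ⟨0, Or.inl ⟨h, rfl⟩, by simp only [Nat.cast_zero]; linarith⟩
    · refine ⟨_, Or.inr ⟨h, rfl⟩, ?_⟩
      obtain ⟨y, hy0, hy1, hc⟩ := h.cells
      have h1 := partition_length_le P (2 ^ (st.s.m - 1)) (2 ^ st.s.m) y
      rw [← hc] at h1
      have h2 : (st.s.cells.length : ℝ) ≤ P.pieceCount (2 ^ (st.s.m - 1)) (2 ^ st.s.m) y +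
        2 * P.bandCount * (P.bandMax + 1) := by exact_mod_cast h1
      have h3 := hP.pieceCount_le (sPrev := 2 ^ (st.s.m - 1)) (s := 2 ^ st.s.m) (by positivity)
        (by rw [← pow_succ']; congr 1; have := h.hm; omega) hy0 hy1
      linarith
  have hcost := round_cost_le P st L hL
  have hcost' : ((st.round bisection P).cost : ℝ) ≤ (st.s.m + 4) * (12 * L + 8) + 3 * L +
      (4 * st.s.m + 21) * (16 * L + 5) +
      (23 * P.pieceCount st.s.len (2 * st.s.len : ℕ) ((st.s.ones + bit st.y) / st.s.len) +
      (46 * P.bandCount + 17) * (P.bandMax + 1) + 60) + 40 := by exact_mod_cast hcost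
  -- As `t ≥ 1/2` and `γ ≥ 1`, all lower-order terms are multiples of `γ t²`.
  set W := γ * t ^ 2
  have hW : γ * t ≤ 2 * W := by
    have : W = γ * t * t := by simp only [W]; ring
    have h0 : 0 ≤ γ * t := by linarith
    nlinarith
  have hm1 : ((st.s.m : ℝ) + 4) * (12 * L + 8) ≤ 12 * t * (700 * (γ * t)) := by
    gcongr <;> linarith
  have hm2 : (4 * (st.s.m : ℝ) + 21) * (16 * L + 5) ≤ 58 * t * (900 * (γ * t)) := by
    gcongr <;> linarith
  have e1 : 12 * t * (700 * (γ * t)) = 8400 * W := by simp only [W]; ring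
  have e2 : 58 * t * (900 * (γ * t)) = 52200 * W := by simp only [W]; ring
  have e3 : 100000 * γ * t ^ 2 = 100000 * W := by simp only [W]; ring
  rw [e1] at hm1
  rw [e2] at hm2
  rw [e3]
  have hQ2 : (46 * (P.bandCount : ℝ) + 17) * (P.bandMax + 1) ≤ 1000 * (γ * t) := by linarith
  linarith

/-- Number of operations in every round of the game. -/
theorem cost_bound {P : Params} (hP : P.Ok) (q : Fin P.T → ℝ) (h : List Round)
    (hh : h ∈ (transcript bisection P q).support) (x : Round) (hx : x ∈ h) :
    (x.cost : ℝ) ≤ 100000 * (1 + P.C) ^ (1 / 3 : ℝ) * Real.log P.T ^ 2 := by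
  rw [transcript, play_eq, PMF.mem_support_map_iff] at hh
  obtain ⟨l, hl, rfl⟩ := hh
  rw [List.mem_map] at hx
  obtain ⟨st, hst, rfl⟩ := hx
  have hv := valid_of_mem_support _ _ _ _ _ hl
  obtain ⟨h1, _, h2⟩ := valid_inv bisection_good hP _ _ (start_inv P) l hv st hst
  have hlen := congrArg List.length (valid_map_q _ _ _ _ _ hv)
  rw [List.length_map, List.length_ofFn] at hlen
  have h3 : 2 ^ start.m + start.idx = 2 := rfl
  exact round_cost_bound hP st h1 (by omega)

end Calib

end

theorem mainTheorem4 :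
    ∃ (c A B : ℝ) (k : ℕ), 0 < c ∧ 0 < A ∧ 0 < B ∧
      ∀ (T : ℕ) (δ iota : ℝ) (q : Fin T → ℝ) (init : ℕ → ℝ),
        2 ≤ T → 0 < δ → δ < 1 → c * Real.log (T / δ) ≤ iota →
        (∀ t, q t ∈ Set.Icc (0 : ℝ) 1) → (∀ j, init j ∈ Set.Icc (0 : ℝ) 1) →
        let C := Calib.nonStationarity q
        let P : Calib.Params := ⟨T, iota, C, init⟩
        let good : Set (List Calib.Round) := {h | Calib.calError 1 h ≤
          A * (iota * Real.log T + Real.sqrt (iota * T) + (iota * T * C) ^ (1 / 3 : ℝ))}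
        -- the calibration error, for the algorithm with exact mirror steps
        (∀ R : Calib.Routines, R.Exact →
          ENNReal.ofReal (1 - δ) ≤ (Calib.transcript R P q).toOuterMeasure good) ∧
        -- the calibration error, for the implementation with elementary operations
        ENNReal.ofReal (1 - δ) ≤ (Calib.transcript Calib.bisection P q).toOuterMeasure good ∧
        -- the number of elementary operations of the implementation in every round
        ∀ h ∈ (Calib.transcript Calib.bisection P q).support, ∀ x ∈ h,
          (x.cost : ℝ) ≤ B * (1 + C) ^ (1 / 3 : ℝ) * Real.log T ^ k := by
  -- The exponent 2 is one logarithm for the number of bands and one for the bisection and binary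
  -- search steps.
  refine ⟨60, 10 ^ 10, 100000, 2, by norm_num, by norm_num, by norm_num, ?_⟩
  intro T δ iota q init hT hδ0 hδ1 hi hq hinit C P good
  refine ⟨fun R hR => Calib.calibration_bound hR.good hT hδ0 hδ1 hi hq hinit,
    Calib.calibration_bound Calib.bisection_good hT hδ0 hδ1 hi hq hinit, ?_⟩
  have hi1 : 1 ≤ iota := by
    have hT2 : (2 : ℝ) ≤ T := by exact_mod_cast hT
    have h1 := Real.log_two_gt_d9
    have h2 : Real.log 2 ≤ Real.log (T / δ) := by
      apply Real.log_le_log (by norm_num)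
      rw [le_div_iff₀ hδ0]
      nlinarith
    linarith
  have hP := Calib.Params.ok_of_nonStationarity hT hi1 hq hinit
  exact fun h hh x hx => Calib.cost_bound hP q h hh x hx
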